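/- **Setting.** A *super Cartan datum* is a finite set $I$ with a symmetric bilinear form $(\nu,\nu')\mapsto\nu\cdot\nu'$ on $\mathbb Z[I]$ with values in $\mathbb Z$ and a parity function $p:I\to\{0,1\}$ such that $d_i=\frac{i\cdot i}{2}\in\mathbb Z_{>0}$ for all $i$; $2\frac{i\cdot j}{i\cdot i}\in-\mathbb N$ for $i\ne j$; $p(i)=1$ for at least one $i$; and $2\frac{i\cdot j}{i\cdot i}\in2\mathbb Z$ whenever $p(i)=1$. It is *consistent* if $d_i\equiv p(i)\pmod 2$ for all $i$. Extend $p$ additively to $\mathbb N[I]$ and put $\operatorname{ht}(\sum_i\nu_ii)=\sum_i\nu_i$. A *root datum* of this type consists of finitely generated free abelian groups $Y,X$ with a perfect pairing $\langle\cdot,\cdot\rangle:Y\times X\to\mathbb Z$ and linearly independent families $(i)_{i\in I}$ in $Y$ and $(i')_{i\in I}$ in $X$ with $\langle i,j'\rangle=\frac{2\,i\cdot j}{i\cdot i}$. Let $\mathbb Q(q)^\pi=\mathbb Q(q)[\pi]/(\pi^2-1)$, with the $\mathbb Q$-algebra involution $\overline q=\pi q^{-1}$, $\overline\pi=\pi$.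 Put $q_i=q^{d_i}$, $\pi_i=\pi^{p(i)}$ and, for $\nu=\sum_i\nu_ii$, $q_\nu=\prod_iq_i^{\nu_i}$, $\pi_\nu=\prod_i\pi_i^{\nu_i}$. If $\nu=i_1+\dots+i_n$ with $i_a\in I$, put $e(\nu)=\sum_{a<b}p(i_a)p(i_b)$. *The algebra $\mathbf f$.* Let ${}'\mathbf f$ be the free associative $\mathbb Q(q)^\pi$-algebra on $\theta_i$ ($i\in I$), graded by $\mathbb N[I]$ with $|\theta_i|=i$, and with $p(x)=p(|x|)$. Give ${}'\mathbf f\otimes{}'\mathbf f$ the multiplication $(x_1\otimes x_2)(x_1'\otimes x_2')=q^{|x_2|\cdot|x_1'|}\pi^{p(x_2)p(x_1')}x_1x_1'\otimes x_2x_2'$ (for homogeneous elements), and let $r:{}'\mathbf f\to{}'\mathbf f\otimes{}'\mathbf f$ be the algebra homomorphism with $r(\theta_i)=\theta_i\otimes1+1\otimes\theta_i$. Let $(\cdot,\cdot)$ be the unique $\mathbb Q(q)^\pi$-valued bilinear form on ${}'\mathbf f$ with $(1,1)=1$, $(\theta_i,\theta_j)=\delta_{ij}(1-\pi_iq_i^{-2})^{-1}$,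 $(x,y'y'')=(r(x),y'\otimes y'')$ and $(xx',y)=(x\otimes x',r(y))$, where $(x_1\otimes x_2,y_1\otimes y_2)=(x_1,y_1)(x_2,y_2)$. It is symmetric; let $\mathcal I$ be its radical and $\mathbf f={}'\mathbf f/\mathcal I=\bigoplus_\nu\mathbf f_\nu$, with the induced form. *The algebra $\mathbf U$.* Let $\mathbf U$ be the $\mathbb Q(q)^\pi$-algebra generated by $E_i,F_i$ ($i\in I$), $J_\mu,K_\mu$ ($\mu\in Y$), with relations - $K_0=1$, $K_\mu K_{\mu'}=K_{\mu+\mu'}$, $J_{2\mu}=1$, $J_\mu J_{\mu'}=J_{\mu+\mu'}$, $J_\mu K_{\mu'}=K_{\mu'}J_\mu$; - $K_\mu E_i=q^{\langle\mu,i'\rangle}E_iK_\mu$, $J_\mu E_i=\pi^{\langle\mu,i'\rangle}E_iJ_\mu$, $K_\mu F_i=q^{-\langle\mu,i'\rangle}F_iK_\mu$, $J_\mu F_i=\pi^{-\langle\mu,i'\rangle}F_iJ_\mu$; - $E_iF_j-\pi^{p(i)p(j)}F_jE_i=\delta_{ij}\dfrac{\widetilde J_i\widetilde K_i-\widetilde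 K_{-i}}{\pi_iq_i-q_i^{-1}}$, where $\widetilde J_i=J_{d_ii}$ and $\widetilde K_{\pm i}=K_{\pm d_ii}$; - $f(E_i:i\in I)=f(F_i:i\in I)=0$ for every $f=f(\theta_i:i\in I)\in\mathcal I$. It is a superalgebra with $p(E_i)=p(F_i)=p(i)$, $p(J_\mu)=p(K_\mu)=0$, and $\mathbf U\otimes\mathbf U$ has the multiplication $(a\otimes b)(c\otimes d)=\pi^{p(b)p(c)}ac\otimes bd$. Let $x\mapsto x^+$ and $x\mapsto x^-$ be the algebra homomorphisms $\mathbf f\to\mathbf U$ with $\theta_i^+=E_i$, $\theta_i^-=F_i$; let $\mathbf U^\pm$ and $\mathbf U^\pm_\nu$ be the images of $\mathbf f$ and $\mathbf f_\nu$, and $\mathbf U^0$ the subalgebra generated by all $J_\mu,K_\mu$. For a consistent datum there are an algebra homomorphism $\Delta:\mathbf U\to\mathbf U\otimes\mathbf U$ with $\Delta(E_i)=E_i\otimes1+\widetilde J_i\widetilde K_i\otimes E_i$, $\Delta(F_i)=F_i\otimes\widetilde K_{-i}+1\otimes F_i$, $\Delta(K_\mu)=K_\mu\otimes K_\mu$,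 $\Delta(J_\mu)=J_\mu\otimes J_\mu$, and a ring homomorphism $u\mapsto\overline u$ of $\mathbf U$, semilinear for the involution of $\mathbb Q(q)^\pi$, with $\overline{E_i}=E_i$, $\overline{F_i}=F_i$, $\overline{J_\mu}=J_\mu$, $\overline{K_\mu}=J_\mu K_{-\mu}$. Put $\overline\Delta(u)=(\overline{\phantom{x}}\otimes\overline{\phantom{x}})(\Delta(\overline u))$. *The completion.* For $N\ge 0$ let $$\mathcal H_N=\mathbf U^+\mathbf U^0\Big(\sum_{\operatorname{ht}\nu\ge N}\mathbf U^-_\nu\Big)\otimes\mathbf U+\mathbf U\otimes\mathbf U^-\mathbf U^0\Big(\sum_{\operatorname{ht}\nu\ge N}\mathbf U^+_\nu\Big).$$ Each $\mathcal H_N$ is a left ideal, and for $u\in\mathbf U\otimes\mathbf U$ there is $r\ge 0$ with $\mathcal H_{N+r}u\subset\mathcal H_N$ for all $N$; hence the inverse limit $(\mathbf U\otimes\mathbf U)^\wedge$ of the quotients $(\mathbf U\otimes\mathbf U)/\mathcal H_N$ is an algebra, with the multiplication extended by continuity. **Theorem.** Let a consistent super Cartan datum and a root datum of this type be given. (a)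 There is a unique family of elements $\Theta_\nu\in\mathbf U^-_\nu\otimes\mathbf U^+_\nu$ ($\nu\in\mathbb N[I]$) such that $\Theta_0=1\otimes1$ and such that $\Theta=\sum_\nu\Theta_\nu\in(\mathbf U\otimes\mathbf U)^\wedge$ satisfies $\Delta(u)\Theta=\Theta\overline\Delta(u)$ in $(\mathbf U\otimes\mathbf U)^\wedge$ for all $u\in\mathbf U$. (b) Let $B$ be a $\mathbb Q(q)^\pi$-basis of $\mathbf f$ such that $B_\nu=B\cap\mathbf f_\nu$ is a basis of $\mathbf f_\nu$ for every $\nu$. Then for every $\nu$ the set $B_\nu$ is finite, there is a unique basis $\{b^*\mid b\in B_\nu\}$ of $\mathbf f_\nu$ dual to $B_\nu$ under $(\cdot,\cdot)$, i.e. with $(b,b'^*)=\delta_{b,b'}$, and the elements of (a) are $$\Theta_\nu=(-1)^{\operatorname{ht}\nu}\,\pi^{e(\nu)}\,\pi_\nu\,q_\nu\sum_{b\in B_\nu}b^-\otimes(b^*)^+ .$$ -/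

import Mathlib

open scoped TensorProduct DirectSum Polynomial

set_option linter.unusedSectionVars false

noncomputable section

namespace QCov


/-! ## The coefficient ring `ℚ(q)^π = ℚ(q)[π] / (π² - 1)` -/

/-- `ℚ(q)`. -/
abbrev Qq : Type := RatFunc ℚ

/-- `ℚ(q)^π = ℚ(q)[π] / (π² - 1)`. -/
def Rπ : Type := AdjoinRoot (Polynomial.X ^ 2 - 1 : Qq[X])

instance : CommRing Rπ := inferInstanceAs (CommRing (AdjoinRoot (Polynomial.X ^ 2 - 1 : Qq[X])))
instance : Algebra Qq Rπ := inferInstanceAs (Algebra Qq (AdjoinRoot (Polynomial.X ^ 2 - 1 : Qq[X])))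

/-- The parameter `π`. -/
def ppi : Rπ := AdjoinRoot.root (Polynomial.X ^ 2 - 1 : Qq[X])

/-- The indeterminate `q` of `ℚ(q)`. -/
def qk : Qqˣ := Units.mk0 RatFunc.X RatFunc.X_ne_zero

/-- The parameter `q`, as a unit of `ℚ(q)^π`. -/
def qq : Rπˣ := Units.map (algebraMap Qq Rπ).toMonoidHom qk

theorem ppi_sq : ppi * ppi = 1 := by
  have h := AdjoinRoot.eval₂_root (Polynomial.X ^ 2 - 1 : Qq[X])
  simp only [Polynomial.eval₂_sub, Polynomial.eval₂_X_pow, Polynomial.eval₂_one] at h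
  have h2 := sub_eq_zero.mp h
  exact (pow_two ppi).symm.trans h2

theorem ppi_pow_mul_self (n : ℕ) : ppi ^ n * ppi ^ n = 1 := by
  rw [← mul_pow, ppi_sq, one_pow]

theorem ppi_pow_even {n : ℕ} (h : Even n) : ppi ^ n = 1 := by
  obtain ⟨m, rfl⟩ := h
  rw [pow_add, ppi_pow_mul_self]

/-- The parameter `π`, as a unit of `ℚ(q)^π`. -/
def piU : Rπˣ := ⟨ppi, ppi, ppi_sq, ppi_sq⟩

@[simp] theorem piU_val : (piU : Rπ) = ppi := rfl

theorem piU_sq : piU * piU = 1 := Units.ext ppi_sq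

theorem piU_inv : piU⁻¹ = piU := inv_eq_of_mul_eq_one_left piU_sq

theorem piU_zpow_even {n : ℤ} (h : Even n) : piU ^ n = 1 := by
  obtain ⟨m, rfl⟩ := h
  rw [zpow_add, ← mul_zpow, piU_sq, one_zpow]

theorem Rpi_squarefree : Squarefree (Polynomial.X ^ 2 - 1 : Qq[X]) :=
  (Polynomial.X_pow_sub_one_separable_iff.mpr (by norm_num)).squarefree

instance : IsReduced Rπ := by
  have h : (Ideal.span {(Polynomial.X ^ 2 - 1 : Qq[X])}).IsRadical :=
    isRadical_iff_span_singleton.mp Rpi_squarefree.isRadical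
  exact (Ideal.isRadical_iff_quotient_reduced _).mp h

instance : Module.Finite Qq Rπ :=
  (AdjoinRoot.powerBasis (f := (Polynomial.X ^ 2 - 1 : Qq[X]))
    (Rpi_squarefree.ne_zero)).finite

instance : IsArtinianRing Rπ := IsArtinianRing.of_finite Qq Rπ

instance : IsSemisimpleRing Rπ := IsArtinianRing.isSemisimpleRing_of_isReduced Rπ

instance : Nontrivial Rπ :=
  AdjoinRoot.nontrivial _ (by
    rw [show (Polynomial.X ^ 2 - 1 : Qq[X]) = Polynomial.X ^ 2 - Polynomial.C 1 by simp,
      Polynomial.degree_X_pow_sub_C (by norm_num)]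
    norm_num)

theorem flat_of_Rpi (M : Type*) [AddCommGroup M] [Module Rπ M] : Module.Flat Rπ M :=
  have := Module.projective_of_isSemisimpleRing Rπ M
  inferInstance

/-! ### The bar involution of `ℚ(q)^π`: `q ↦ π q⁻¹`, `π ↦ π` -/

/-- The inclusion of the rational numbers in `ℚ(q)^π`. -/
def ratC : ℚ →+* Rπ := (algebraMap Qq Rπ).comp RatFunc.C

theorem eval_ne_zero (f : Qq) (hf : ¬ ∃ c, f = RatFunc.C c) (p : ℚ[X]) (hp : p ≠ 0) :
    Polynomial.eval₂ RatFunc.C f p ≠ 0 := by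
  intro h0
  refine RatFunc.transcendental_of_ne_C f hf ⟨p, hp, ?_⟩
  exact h0

theorem eval_pi_mul (t : Qq) (p : ℚ[X]) :
    2 * Polynomial.eval₂ ratC (ppi * algebraMap Qq Rπ t) p =
      (1 + ppi) * algebraMap Qq Rπ (Polynomial.eval₂ RatFunc.C t p) +
      (1 - ppi) * algebraMap Qq Rπ (Polynomial.eval₂ RatFunc.C (-t) p) := by
  induction p using Polynomial.induction_on' with
  | add p q hp hq => simp only [Polynomial.eval₂_add, map_add, mul_add, hp, hq]; ring
  | monomial n a =>
    simp only [Polynomial.eval₂_monomial, map_mul, map_pow, map_neg, ratC, RingHom.comp_apply]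
    rcases Nat.even_or_odd n with h | h
    · rw [mul_pow, ppi_pow_even h, h.neg_pow]; ring
    · obtain ⟨m, rfl⟩ := h
      rw [mul_pow, pow_succ ppi, ppi_pow_even (even_two_mul m), Odd.neg_pow ⟨m, rfl⟩]
      ring

theorem isUnit_two : IsUnit (2 : Rπ) := by
  have h : IsUnit (2 : Qq) := IsUnit.mk0 _ (by norm_num)
  have := h.map (algebraMap Qq Rπ)
  rwa [map_ofNat] at this

theorem RatFunc_X_inv_ne_C (s : Qq) (hs : s * s = 1) :
    ¬ ∃ c, s * (RatFunc.X : Qq)⁻¹ = RatFunc.C c := by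
  rintro ⟨c, hc⟩
  have hX : (RatFunc.X : Qq) * RatFunc.X⁻¹ = 1 := mul_inv_cancel₀ RatFunc.X_ne_zero
  have h1 : RatFunc.C c * RatFunc.X = s := by
    rw [← hc]; linear_combination s * hX
  have h2 : (RatFunc.C (c ^ 2) * RatFunc.X ^ 2 : Qq) = 1 := by
    rw [map_pow]; linear_combination (RatFunc.C c * RatFunc.X + s) * h1 + hs
  have h3 : algebraMap ℚ[X] Qq (Polynomial.C (c ^ 2) * Polynomial.X ^ 2) =
      algebraMap ℚ[X] Qq 1 := by
    simpa using h2
  have h4 := RatFunc.algebraMap_injective ℚ h3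
  have h5 := congrArg (Polynomial.coeff · 0) h4
  simp at h5

theorem isUnit_eval_pi_mul (p : ℚ[X]) (hp : p ≠ 0) :
    IsUnit (Polynomial.eval₂RingHom ratC (ppi * algebraMap Qq Rπ (RatFunc.X)⁻¹) p) := by
  rw [Polynomial.coe_eval₂RingHom]
  set t : Qq := (RatFunc.X)⁻¹ with ht
  have h1 : Polynomial.eval₂ RatFunc.C t p ≠ 0 :=
    eval_ne_zero _ (by simpa using RatFunc_X_inv_ne_C 1 (by ring)) p hp
  have h2 : Polynomial.eval₂ RatFunc.C (-t) p ≠ 0 :=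
    eval_ne_zero _ (by simpa using RatFunc_X_inv_ne_C (-1) (by ring)) p hp
  have h := eval_pi_mul t p
  set A := Polynomial.eval₂ RatFunc.C t p
  set B := Polynomial.eval₂ RatFunc.C (-t) p
  have hA : algebraMap Qq Rπ A * algebraMap Qq Rπ A⁻¹ = 1 := by
    rw [← map_mul, mul_inv_cancel₀ h1, map_one]
  have hB : algebraMap Qq Rπ B * algebraMap Qq Rπ B⁻¹ = 1 := by
    rw [← map_mul, mul_inv_cancel₀ h2, map_one]
  have h4 : 2 * Polynomial.eval₂ ratC (ppi * algebraMap Qq Rπ t) p *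
      ((1 + ppi) * algebraMap Qq Rπ A⁻¹ + (1 - ppi) * algebraMap Qq Rπ B⁻¹) = 2 * 2 := by
    rw [h]
    have := ppi_sq
    linear_combination (1 + ppi) ^ 2 * hA + (1 - ppi) ^ 2 * hB +
      (2 - algebraMap Qq Rπ A * algebraMap Qq Rπ B⁻¹
        - algebraMap Qq Rπ B * algebraMap Qq Rπ A⁻¹) * this
  have := isUnit_of_mul_isUnit_left (h4 ▸ isUnit_two.mul isUnit_two)
  exact isUnit_of_mul_isUnit_right this

/-- The `ℚ`-algebra homomorphism `ℚ(q) → ℚ(q)^π` with `q ↦ π q⁻¹`. -/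
def barQq : Qq →+* Rπ :=
  IsLocalization.lift (M := nonZeroDivisors ℚ[X]) (S := Qq)
    (g := Polynomial.eval₂RingHom ratC (ppi * algebraMap Qq Rπ (RatFunc.X)⁻¹))
    (fun p => isUnit_eval_pi_mul p (nonZeroDivisors.coe_ne_zero p))

/-- The bar involution of `ℚ(q)^π`: `q ↦ π q⁻¹`, `π ↦ π`. -/
def barR : Rπ →+* Rπ :=
  AdjoinRoot.lift (f := (Polynomial.X ^ 2 - 1 : Qq[X])) barQq ppi (by
    simp only [Polynomial.eval₂_sub, Polynomial.eval₂_X_pow, Polynomial.eval₂_one]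
    rw [pow_two, ppi_sq, sub_self])

@[simp] theorem barR_ppi : barR ppi = ppi := AdjoinRoot.lift_root _

theorem barR_algebraMap (x : Qq) : barR (algebraMap Qq Rπ x) = barQq x := AdjoinRoot.lift_of _

theorem barR_qq : barR (qq : Rπ) = ppi * ((qq⁻¹ : Rπˣ) : Rπ) := by
  have h1 : (qq : Rπ) = algebraMap Qq Rπ RatFunc.X := rfl
  have h2 : ((qq⁻¹ : Rπˣ) : Rπ) = algebraMap Qq Rπ (RatFunc.X)⁻¹ := by
    rw [qq, ← map_inv]; rfl
  have h3 : (RatFunc.X : Qq) = algebraMap ℚ[X] Qq Polynomial.X := RatFunc.algebraMap_X.symm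
  rw [h1, h2, barR_algebraMap]
  conv_lhs => rw [h3]
  rw [barQq, IsLocalization.lift_eq]
  simp

theorem barR_units_qq : Units.map barR.toMonoidHom qq = piU * qq⁻¹ := Units.ext barR_qq

theorem barR_units_piU : Units.map barR.toMonoidHom piU = piU := Units.ext barR_ppi

theorem barR_barR_qq : barR (barR (qq : Rπ)) = qq := by
  have h : Units.map barR.toMonoidHom (Units.map barR.toMonoidHom qq) = qq := by
    rw [barR_units_qq, map_mul, map_inv, barR_units_qq, barR_units_piU, mul_inv, inv_inv,
      ← mul_assoc, mul_inv_cancel, one_mul]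
  exact congrArg Units.val h

@[simp] theorem barR_barR (x : Rπ) : barR (barR x) = x := by
  have hq : (barR.comp barR).comp (algebraMap Qq Rπ) = algebraMap Qq Rπ := by
    refine IsLocalization.ringHom_ext (nonZeroDivisors ℚ[X]) ?_
    refine Polynomial.ringHom_ext (fun a => ?_) ?_
    · exact RingHom.congr_fun (Subsingleton.elim
        ((((barR.comp barR).comp (algebraMap Qq Rπ)).comp (algebraMap ℚ[X] Qq)).comp
        Polynomial.C) (((algebraMap Qq Rπ).comp (algebraMap ℚ[X] Qq)).comp
        Polynomial.C)) a
    · have h := barR_barR_qq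
      have h1 : (qq : Rπ) = algebraMap Qq Rπ (algebraMap ℚ[X] Qq Polynomial.X) := by
        rw [RatFunc.algebraMap_X]; rfl
      rw [h1] at h
      exact h
  have key : ∀ f g : AdjoinRoot (Polynomial.X ^ 2 - 1 : Qq[X]) →+* Rπ,
      f.comp (AdjoinRoot.of _) = g.comp (AdjoinRoot.of _) →
      f (AdjoinRoot.root _) = g (AdjoinRoot.root _) → f = g :=
    fun f g => AdjoinRoot.ringHom_ext
  have key := key (barR.comp barR) (RingHom.id Rπ) hq ((congrArg barR barR_ppi).trans barR_ppi)
  exact RingHom.congr_fun key x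

instance : RingHomInvPair barR barR := ⟨RingHom.ext barR_barR, RingHom.ext barR_barR⟩


/-! ## Twisted tensor squares of graded algebras -/

/-- A bicharacter on `Γ` with values in `R`. -/
structure Bichar (Γ R : Type*) [AddCommMonoid Γ] [CommRing R] where
  /-- the values of the bicharacter -/
  toFun : Γ → Γ → R
  zero_left : ∀ b, toFun 0 b = 1
  zero_right : ∀ a, toFun a 0 = 1
  add_left : ∀ a b c, toFun (a + b) c = toFun a c * toFun b c
  add_right : ∀ a b c, toFun a (b + c) = toFun a b * toFun a c

section Twisted

variable {Γ : Type*} [AddCommMonoid Γ] [DecidableEq Γ] {R : Type*} [CommRing R]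
  {A : Type*} [Ring A] [Algebra R A]

/-- The linear map which is multiplication by `χ γ δ` on the component of degree `δ`. -/
def twist (χ : Bichar Γ R) (𝒜 : Γ → Submodule R A) [GradedAlgebra 𝒜] (γ : Γ) : A →ₗ[R] A :=
  (DirectSum.toModule R Γ A fun δ => χ.toFun γ δ • (𝒜 δ).subtype) ∘ₗ
    (DirectSum.decomposeLinearEquiv 𝒜).toLinearMap

theorem twist_of_mem (χ : Bichar Γ R) (𝒜 : Γ → Submodule R A) [GradedAlgebra 𝒜] (γ : Γ)
    {δ : Γ} {x : A} (hx : x ∈ 𝒜 δ) : twist χ 𝒜 γ x = χ.toFun γ δ • x := by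
  lift x to 𝒜 δ using hx
  simp [twist]

/-- The map `b ↦ (x ⊗ y ↦ χ(|b|,|x|) x ⊗ b y)`. -/
def twistedLeft (χ : Bichar Γ R) (𝒜 : Γ → Submodule R A) [GradedAlgebra 𝒜] :
    A →ₗ[R] Module.End R (A ⊗[R] A) :=
  (DirectSum.toModule R Γ (Module.End R (A ⊗[R] A)) fun γ =>
    (TensorProduct.mapBilinear (RingHom.id R) A A A A (twist χ 𝒜 γ)) ∘ₗ (LinearMap.mul R A) ∘ₗ
      (𝒜 γ).subtype) ∘ₗ (DirectSum.decomposeLinearEquiv 𝒜).toLinearMap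

theorem twistedLeft_of_mem (χ : Bichar Γ R) (𝒜 : Γ → Submodule R A) [GradedAlgebra 𝒜]
    {γ : Γ} {b : A} (hb : b ∈ 𝒜 γ) :
    twistedLeft χ 𝒜 b = TensorProduct.map (twist χ 𝒜 γ) (LinearMap.mul R A b) := by
  lift b to 𝒜 γ using hb
  simp [twistedLeft]

/-- The multiplication `(a ⊗ b)(c ⊗ d) = χ(|b|,|c|) ac ⊗ bd`. -/
def twistedMul (χ : Bichar Γ R) (𝒜 : Γ → Submodule R A) [GradedAlgebra 𝒜] :
    A ⊗[R] A →ₗ[R] Module.End R (A ⊗[R] A) :=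
  TensorProduct.lift ((LinearMap.mul R (Module.End R (A ⊗[R] A))).compl₁₂
    (LinearMap.rTensorHom A ∘ₗ LinearMap.mul R A) (twistedLeft χ 𝒜))

theorem twistedMul_tmul (χ : Bichar Γ R) (𝒜 : Γ → Submodule R A) [GradedAlgebra 𝒜]
    {γ δ : Γ} (a : A) {b c : A} (d : A) (hb : b ∈ 𝒜 γ) (hc : c ∈ 𝒜 δ) :
    twistedMul χ 𝒜 (a ⊗ₜ b) (c ⊗ₜ d) = χ.toFun γ δ • ((a * c) ⊗ₜ[R] (b * d)) := by
  simp [twistedMul, twistedLeft_of_mem χ 𝒜 hb, twist_of_mem χ 𝒜 γ hc, TensorProduct.smul_tmul']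

theorem tensor_homogeneous_induction (𝒜 : Γ → Submodule R A) [GradedAlgebra 𝒜]
    {P : A ⊗[R] A → Prop} (h0 : P 0) (hadd : ∀ x y, P x → P y → P (x + y))
    (h : ∀ (γ δ : Γ) (a b : A), a ∈ 𝒜 γ → b ∈ 𝒜 δ → P (a ⊗ₜ b)) (x : A ⊗[R] A) : P x := by
  induction x using TensorProduct.induction_on with
  | zero => exact h0
  | add x y hx hy => exact hadd x y hx hy
  | tmul a b =>
    refine DirectSum.Decomposition.inductionOn 𝒜 (motive := fun a => P (a ⊗ₜ b)) ?_ ?_ ?_ a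
    · simpa using h0
    · intro γ a
      refine DirectSum.Decomposition.inductionOn 𝒜
        (motive := fun b => P ((a : A) ⊗ₜ b)) ?_ ?_ ?_ b
      · simpa using h0
      · intro δ b
        exact h γ δ a b a.2 b.2
      · intro x y hx hy
        rw [TensorProduct.tmul_add]; exact hadd _ _ hx hy
    · intro x y hx hy
      rw [TensorProduct.add_tmul]; exact hadd _ _ hx hy

theorem twistedMul_assoc (χ : Bichar Γ R) (𝒜 : Γ → Submodule R A) [GradedAlgebra 𝒜]
    (x y z : A ⊗[R] A) :
    twistedMul χ 𝒜 (twistedMul χ 𝒜 x y) z = twistedMul χ 𝒜 x (twistedMul χ 𝒜 y z) := by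
  induction x using tensor_homogeneous_induction 𝒜 with
  | h0 => simp
  | hadd x x' h h' => simp only [map_add, LinearMap.add_apply, h, h']
  | h γ₁ γ₂ a b ha hb
  induction y using tensor_homogeneous_induction 𝒜 with
  | h0 => simp
  | hadd x x' h h' => simp only [map_add, LinearMap.add_apply, h, h']
  | h δ₁ δ₂ c d hc hd
  induction z using tensor_homogeneous_induction 𝒜 with
  | h0 => simp
  | hadd x x' h h' => simp only [map_add, h, h']
  | h ε₁ ε₂ e f he hf
  rw [twistedMul_tmul χ 𝒜 a d hb hc, twistedMul_tmul χ 𝒜 c f hd he, map_smul, map_smul,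
    LinearMap.smul_apply, twistedMul_tmul χ 𝒜 _ _ (SetLike.mul_mem_graded hb hd) he,
    twistedMul_tmul χ 𝒜 _ _ hb (SetLike.mul_mem_graded hc he), smul_smul, smul_smul,
    χ.add_left, χ.add_right, mul_assoc, mul_assoc]
  congr 1; ring

theorem twistedMul_one (χ : Bichar Γ R) (𝒜 : Γ → Submodule R A) [GradedAlgebra 𝒜]
    (x : A ⊗[R] A) : twistedMul χ 𝒜 x (1 ⊗ₜ 1) = x := by
  induction x using tensor_homogeneous_induction 𝒜 with
  | h0 => simp
  | hadd x x' h h' => simp only [map_add, LinearMap.add_apply, h, h']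
  | h γ δ a b _ hb
  rw [twistedMul_tmul χ 𝒜 a 1 hb SetLike.GradedOne.one_mem, χ.zero_right, one_smul, mul_one,
    mul_one]

theorem one_twistedMul (χ : Bichar Γ R) (𝒜 : Γ → Submodule R A) [GradedAlgebra 𝒜]
    (x : A ⊗[R] A) : twistedMul χ 𝒜 (1 ⊗ₜ 1) x = x := by
  induction x using tensor_homogeneous_induction 𝒜 with
  | h0 => simp
  | hadd x x' h h' => simp only [map_add, h, h']
  | h γ δ a b ha _
  rw [twistedMul_tmul χ 𝒜 1 b SetLike.GradedOne.one_mem ha, χ.zero_left, one_smul, one_mul,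
    one_mul]

/-- The tensor square `A ⊗ A` of a `Γ`-graded algebra `A`, with the multiplication
`(a ⊗ b)(c ⊗ d) = χ(|b|,|c|) ac ⊗ bd` on homogeneous elements. -/
def TwistedTensor (_χ : Bichar Γ R) (𝒜 : Γ → Submodule R A) [GradedAlgebra 𝒜] : Type _ :=
  A ⊗[R] A

variable (χ : Bichar Γ R) (𝒜 : Γ → Submodule R A) [GradedAlgebra 𝒜]

instance : AddCommGroup (TwistedTensor χ 𝒜) := inferInstanceAs (AddCommGroup (A ⊗[R] A))
instance : Module R (TwistedTensor χ 𝒜) := inferInstanceAs (Module R (A ⊗[R] A))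

instance : Ring (TwistedTensor χ 𝒜) :=
  { (inferInstance : AddCommGroup (TwistedTensor χ 𝒜)) with
    mul := fun x y => twistedMul χ 𝒜 x y
    one := (1 : A) ⊗ₜ[R] (1 : A)
    left_distrib := fun x y z => map_add (twistedMul χ 𝒜 x) y z
    right_distrib := fun x y z => LinearMap.map_add₂ (twistedMul χ 𝒜) x y z
    zero_mul := fun x => LinearMap.map_zero₂ (twistedMul χ 𝒜) x
    mul_zero := fun x => map_zero (twistedMul χ 𝒜 x)
    mul_assoc := twistedMul_assoc χ 𝒜
    one_mul := one_twistedMul χ 𝒜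
    mul_one := twistedMul_one χ 𝒜 }

instance : Algebra R (TwistedTensor χ 𝒜) :=
  Algebra.ofModule
    (fun r x y => LinearMap.map_smul₂ (twistedMul χ 𝒜) r x y)
    (fun r x y => map_smul (twistedMul χ 𝒜 x) r y)

/-- The element `a ⊗ b` of the twisted tensor square. -/
def tt (a b : A) : TwistedTensor χ 𝒜 := a ⊗ₜ[R] b

theorem tt_mul_tt {γ δ : Γ} (a : A) {b c : A} (d : A) (hb : b ∈ 𝒜 γ) (hc : c ∈ 𝒜 δ) :
    tt χ 𝒜 a b * tt χ 𝒜 c d = χ.toFun γ δ • tt χ 𝒜 (a * c) (b * d) :=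
  twistedMul_tmul χ 𝒜 a d hb hc

theorem one_eq_tt : (1 : TwistedTensor χ 𝒜) = tt χ 𝒜 1 1 := rfl

theorem tt_smul_left (r : R) (a b : A) : tt χ 𝒜 (r • a) b = r • tt χ 𝒜 a b :=
  (TensorProduct.smul_tmul' r a b).symm

theorem tt_smul_right (r : R) (a b : A) : tt χ 𝒜 a (r • b) = r • tt χ 𝒜 a b :=
  TensorProduct.tmul_smul r a b

theorem tt_add_left (a a' b : A) : tt χ 𝒜 (a + a') b = tt χ 𝒜 a b + tt χ 𝒜 a' b :=
  TensorProduct.add_tmul a a' b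

theorem tt_add_right (a b b' : A) : tt χ 𝒜 a (b + b') = tt χ 𝒜 a b + tt χ 𝒜 a b' :=
  TensorProduct.tmul_add a b b'

theorem tt_sub_left (a a' b : A) : tt χ 𝒜 (a - a') b = tt χ 𝒜 a b - tt χ 𝒜 a' b :=
  TensorProduct.sub_tmul a a' b

theorem tt_sub_right (a b b' : A) : tt χ 𝒜 a (b - b') = tt χ 𝒜 a b - tt χ 𝒜 a b' :=
  TensorProduct.tmul_sub a b b'

theorem tt_zero_left (b : A) : tt χ 𝒜 0 b = 0 := TensorProduct.zero_tmul A b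
theorem tt_zero_right (a : A) : tt χ 𝒜 a 0 = 0 := TensorProduct.tmul_zero A a

theorem tt_induction {P : TwistedTensor χ 𝒜 → Prop} (h0 : P 0)
    (hadd : ∀ x y, P x → P y → P (x + y))
    (h : ∀ (γ δ : Γ) (a b : A), a ∈ 𝒜 γ → b ∈ 𝒜 δ → P (tt χ 𝒜 a b)) (x : TwistedTensor χ 𝒜) :
    P x :=
  tensor_homogeneous_induction 𝒜 (P := P) h0 hadd h x

end Twisted


/-! ## Gradings on algebras given by generators -/

section WordGrading

variable {Γ : Type*} [AddCommMonoid Γ] [DecidableEq Γ] {R : Type*} [CommRing R]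
  {A : Type*} [Ring A] [Algebra R A] {G : Type*}

/-- The span of the words of degree `γ` in the generators `x g`, where `x g` has degree `deg g`. -/
def wordGr (R : Type*) [CommRing R] {A : Type*} [Ring A] [Algebra R A] {G : Type*}
    (x : G → A) (deg : G → Γ) (γ : Γ) : Submodule R A :=
  Submodule.span R {a | ∃ l : List G, (l.map deg).sum = γ ∧ (l.map x).prod = a}

theorem word_mem_wordGr (x : G → A) (deg : G → Γ) (l : List G) :
    (l.map x).prod ∈ wordGr R x deg (l.map deg).sum :=
  Submodule.subset_span ⟨l, rfl, rfl⟩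

theorem gen_mem_wordGr (x : G → A) (deg : G → Γ) (g : G) : x g ∈ wordGr R x deg (deg g) := by
  simpa using word_mem_wordGr (R := R) x deg [g]

instance wordGr_gradedMonoid (x : G → A) (deg : G → Γ) :
    SetLike.GradedMonoid (wordGr R x deg) where
  one_mem := Submodule.subset_span ⟨[], rfl, rfl⟩
  mul_mem := by
    intro γ δ a b ha hb
    induction ha, hb using Submodule.span_induction₂ with
    | mem_mem a b ha hb =>
      obtain ⟨l, rfl, rfl⟩ := ha
      obtain ⟨l', rfl, rfl⟩ := hb
      exact Submodule.subset_span ⟨l ++ l', by simp, by simp⟩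
    | zero_left y hy => simp
    | zero_right y hy => simp
    | add_left x y z _ _ _ h h' => rw [add_mul]; exact add_mem h h'
    | add_right x y z _ _ _ h h' => rw [mul_add]; exact add_mem h h'
    | smul_left r x y _ _ h => rw [smul_mul_assoc]; exact Submodule.smul_mem _ _ h
    | smul_right r x y _ _ h => rw [mul_smul_comm]; exact Submodule.smul_mem _ _ h

theorem dec_word (x : G → A) (deg : G → Γ) (dec : A →ₐ[R] ⨁ γ, wordGr R x deg γ)
    (hdec : ∀ g, dec (x g) = DirectSum.of (fun γ => wordGr R x deg γ) (deg g)
      ⟨x g, gen_mem_wordGr x deg g⟩) (l : List G) :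
    dec (l.map x).prod = DirectSum.of (fun γ => wordGr R x deg γ) (l.map deg).sum
      ⟨(l.map x).prod, word_mem_wordGr x deg l⟩ := by
  induction l with
  | nil => simp only [List.map_nil, List.prod_nil, map_one]; rfl
  | cons g l ih =>
    simp only [List.map_cons, List.prod_cons, map_mul, hdec, ih, DirectSum.of_mul_of]
    rfl

/-- The grading by words, when it is compatible with the relations. -/
@[reducible]
def wordGr_gradedAlgebra (x : G → A) (deg : G → Γ) (hgen : Algebra.adjoin R (Set.range x) = ⊤)
    (dec : A →ₐ[R] ⨁ γ, wordGr R x deg γ)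
    (hdec : ∀ g, dec (x g) = DirectSum.of (fun γ => wordGr R x deg γ) (deg g)
      ⟨x g, gen_mem_wordGr x deg g⟩) : GradedAlgebra (wordGr R x deg) :=
  GradedAlgebra.ofAlgHom _ dec
    (by
      refine AlgHom.ext_of_adjoin_eq_top hgen ?_
      rintro _ ⟨g, rfl⟩
      simp [hdec])
    (by
      rintro γ ⟨a, ha⟩
      change dec a = _
      induction ha using Submodule.span_induction with
      | mem a ha =>
        obtain ⟨l, rfl, rfl⟩ := ha
        exact dec_word x deg dec hdec l
      | zero => rw [map_zero]; exact (map_zero _).symm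
      | add a b _ _ ha hb => rw [map_add, ha, hb, ← map_add]; rfl
      | smul r a _ ha =>
        rw [map_smul, ha]
        exact ((DirectSum.lof R Γ (fun γ => wordGr R x deg γ) γ).map_smul r _).symm)

end WordGrading

/-! ## Super Cartan data -/

/-- A super Cartan datum on a set `I`: a symmetric bilinear form on `ℤ[I]` with values in `ℤ`,
given by the integers `dot i j = i · j`, and a parity function `p : I → {0, 1}`. -/
structure SuperCartanDatum (I : Type*) where
  dot : I → I → ℤ
  dot_comm : ∀ i j, dot i j = dot j i
  dot_self_pos : ∀ i, 0 < dot i i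
  two_dvd_dot_self : ∀ i, 2 ∣ dot i i
  /-- `2 (i · j) / (i · i)` is a non-positive integer for `i ≠ j` -/
  dot_off_diag : ∀ i j, i ≠ j → ∃ n : ℕ, 2 * dot i j = -(n : ℤ) * dot i i
  p : I → ℕ
  p_le_one : ∀ i, p i ≤ 1
  exists_odd : ∃ i, p i = 1
  /-- `2 (i · j) / (i · i)` is an even integer for `i` odd -/
  even_of_odd : ∀ i j, p i = 1 → ∃ m : ℤ, 2 * dot i j = 2 * m * dot i i

namespace SuperCartanDatum

variable {I : Type*} (C : SuperCartanDatum I)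

/-- `d_i = (i · i) / 2`. -/
def d (i : I) : ℤ := C.dot i i / 2

/-- A super Cartan datum is (bar-)consistent if `d_i ≡ p(i)` modulo `2` for all `i`. -/
class Consistent : Prop where
  d_modEq : ∀ i, C.d i ≡ (C.p i : ℤ) [ZMOD 2]

theorem two_mul_d (i : I) : 2 * C.d i = C.dot i i := Int.mul_ediv_cancel' (C.two_dvd_dot_self i)

theorem d_pos (i : I) : 0 < C.d i := by
  have := C.two_mul_d i
  have := C.dot_self_pos i
  omega

theorem dvd_d (i j : I) : ∃ m : ℤ, C.dot i j = m * C.d i := by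
  by_cases h : i = j
  · exact ⟨2, by rw [← h, C.two_mul_d]⟩
  · obtain ⟨n, hn⟩ := C.dot_off_diag i j h
    refine ⟨-n, ?_⟩
    rw [← C.two_mul_d] at hn
    linarith

theorem even_dot [hC : C.Consistent] (i j : I) : Even (C.dot i j) := by
  have hp := C.p_le_one i
  by_cases h : C.p i = 1
  · obtain ⟨m, hm⟩ := C.even_of_odd i j h
    rw [← C.two_mul_d] at hm
    exact ⟨m * C.d i, by linarith⟩
  · have h0 : C.p i = 0 := by omega
    have h1 := hC.d_modEq i
    rw [h0] at h1
    obtain ⟨k, hk⟩ : (2 : ℤ) ∣ C.d i := (Int.modEq_zero_iff_dvd).mp h1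
    obtain ⟨m, hm⟩ := C.dvd_d i j
    exact ⟨m * k, by rw [hm, hk]; ring⟩

/-- The height `ht ν` of `ν ∈ ℕ[I]`. -/
def ht (ν : I →₀ ℕ) : ℕ := ν.sum fun _ a => a

/-- The parity `p(ν)` of `ν ∈ ℕ[I]`, as an integer: `p` is extended additively. -/
def pw (ν : I →₀ ℕ) : ℕ := ν.sum fun i a => a * C.p i

/-- The form `ν · μ` on `ℕ[I]`. -/
def dotw (ν μ : I →₀ ℕ) : ℤ := ν.sum fun i a => μ.sum fun j b => (a : ℤ) * b * C.dot i j

theorem pw_zero : C.pw 0 = 0 := Finsupp.sum_zero_index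

theorem pw_add (ν μ : I →₀ ℕ) : C.pw (ν + μ) = C.pw ν + C.pw μ := by
  classical
  exact Finsupp.sum_add_index (by simp) (by intros; ring)

@[simp] theorem pw_single (i : I) : C.pw (Finsupp.single i 1) = C.p i := by
  simp [pw]

theorem dotw_zero_left (μ : I →₀ ℕ) : C.dotw 0 μ = 0 := Finsupp.sum_zero_index

theorem dotw_zero_right (ν : I →₀ ℕ) : C.dotw ν 0 = 0 := by simp [dotw]

theorem dotw_add_left (ν ν' μ : I →₀ ℕ) : C.dotw (ν + ν') μ = C.dotw ν μ + C.dotw ν' μ := by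
  classical
  refine Finsupp.sum_add_index (by simp) ?_
  intro i _ a b
  rw [← Finsupp.sum_add]
  refine Finsupp.sum_congr fun j _ => ?_
  push_cast; ring

theorem dotw_add_right (ν μ μ' : I →₀ ℕ) : C.dotw ν (μ + μ') = C.dotw ν μ + C.dotw ν μ' := by
  classical
  rw [dotw, dotw, dotw, ← Finsupp.sum_add]
  refine Finsupp.sum_congr fun i _ => ?_
  exact Finsupp.sum_add_index (by simp) (by intros; push_cast; ring)

@[simp] theorem dotw_single (i j : I) :
    C.dotw (Finsupp.single i 1) (Finsupp.single j 1) = C.dot i j := by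
  simp [dotw]

/-- The bicharacter `(ν, μ) ↦ q^{ν · μ} π^{p(ν) p(μ)}` on `ℕ[I]`. -/
def chi : Bichar (I →₀ ℕ) Rπ where
  toFun ν μ := ((qq ^ C.dotw ν μ : Rπˣ) : Rπ) * ppi ^ (C.pw ν * C.pw μ)
  zero_left μ := by simp [dotw_zero_left, pw_zero]
  zero_right μ := by simp [dotw_zero_right, pw_zero]
  add_left a b c := by
    rw [dotw_add_left, pw_add, zpow_add, Units.val_mul, add_mul, pow_add]; ring
  add_right a b c := by
    rw [dotw_add_right, pw_add, zpow_add, Units.val_mul, mul_add, pow_add]; ring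

/-- The value `q^{i · j} π^{p(i) p(j)}` of the bicharacter at a pair of elements of `I`. -/
def chiU (i j : I) : Rπˣ := qq ^ C.dot i j * piU ^ (C.p i * C.p j)

theorem chi_single (i j : I) :
    C.chi.toFun (Finsupp.single i 1) (Finsupp.single j 1) = C.chiU i j := by
  simp [chi, chiU]

theorem chiU_comm (i j : I) : C.chiU i j = C.chiU j i := by
  rw [chiU, chiU, C.dot_comm, mul_comm (C.p i)]

/-- `q_i = q^{(i · i) / 2}`. -/
def qi (i : I) : Rπˣ := qq ^ C.d i

/-- `π_i = π^{p(i)}`. -/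
def pii (i : I) : Rπ := ppi ^ C.p i

theorem qq_zpow_sub_isUnit {n : ℤ} (hn : 0 < n) :
    IsUnit (((qq ^ n : Rπˣ) : Rπ) ^ 2 - (((qq ^ n)⁻¹ : Rπˣ) : Rπ) ^ 2) := by
  obtain ⟨m, rfl⟩ := Int.eq_ofNat_of_zero_le hn.le
  have hm : m ≠ 0 := by rintro rfl; simp at hn
  have key : (RatFunc.X ^ m : Qq) ^ 2 - ((RatFunc.X ^ m)⁻¹) ^ 2 ≠ 0 := by
    intro h
    have h0 : (RatFunc.X ^ m : Qq) ≠ 0 := pow_ne_zero _ RatFunc.X_ne_zero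
    have h1 : (RatFunc.X ^ m : Qq) ^ 4 = 1 := by
      field_simp at h
      linear_combination h
    have h2 : algebraMap ℚ[X] Qq (Polynomial.X ^ (m * 4)) = algebraMap ℚ[X] Qq 1 := by
      rw [map_pow, RatFunc.algebraMap_X, map_one, pow_mul, h1]
    have h3 := congrArg (Polynomial.coeff · 0) (RatFunc.algebraMap_injective ℚ h2)
    simp [Polynomial.coeff_X_pow, hm] at h3
  have e1 : ((qq ^ (m : ℤ) : Rπˣ) : Rπ) = algebraMap Qq Rπ (RatFunc.X ^ m) := by
    rw [zpow_natCast, Units.val_pow_eq_pow_val, map_pow]; rfl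
  have e2 : (((qq ^ (m : ℤ))⁻¹ : Rπˣ) : Rπ) = algebraMap Qq Rπ (RatFunc.X ^ m)⁻¹ := by
    rw [zpow_natCast, ← inv_pow, Units.val_pow_eq_pow_val, ← inv_pow, map_pow, qq, ← map_inv]; rfl
  have := (IsUnit.mk0 _ key).map (algebraMap Qq Rπ)
  rw [e1, e2, ← map_pow, ← map_pow, ← map_sub]
  exact this

/-- `π_i q_i - q_i⁻¹` is invertible in `ℚ(q)^π`. -/
theorem isUnit_den (i : I) : IsUnit (C.pii i * C.qi i - (((C.qi i)⁻¹ : Rπˣ) : Rπ)) := by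
  have h := qq_zpow_sub_isUnit (C.d_pos i)
  have hp : C.pii i * C.pii i = 1 := ppi_pow_mul_self _
  have e : ((qq ^ C.d i : Rπˣ) : Rπ) ^ 2 - (((qq ^ C.d i)⁻¹ : Rπˣ) : Rπ) ^ 2 =
      (C.pii i * C.qi i - (((C.qi i)⁻¹ : Rπˣ) : Rπ)) *
        (C.pii i * C.qi i + (((C.qi i)⁻¹ : Rπˣ) : Rπ)) := by
    rw [qi]
    linear_combination (-((qq ^ C.d i : Rπˣ) : Rπ) ^ 2) * hp
  rw [e] at h
  exact isUnit_of_mul_isUnit_left h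

/-- The inverse of `π_i q_i - q_i⁻¹` in `ℚ(q)^π`. -/
def invDen (i : I) : Rπ := Ring.inverse (C.pii i * C.qi i - (((C.qi i)⁻¹ : Rπˣ) : Rπ))

/-- `1 - π_i q_i⁻²` is invertible in `ℚ(q)^π`. -/
theorem isUnit_form_den (i : I) : IsUnit (1 - C.pii i * ((C.qi i ^ (-2 : ℤ) : Rπˣ) : Rπ)) := by
  have h := C.isUnit_den i
  have hp : C.pii i * C.pii i = 1 := ppi_pow_mul_self _
  have hq : ((C.qi i : Rπˣ) : Rπ) * (((C.qi i)⁻¹ : Rπˣ) : Rπ) = 1 := Units.mul_inv _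
  have e : ((C.qi i ^ (-2 : ℤ) : Rπˣ) : Rπ) = (((C.qi i)⁻¹ : Rπˣ) : Rπ) ^ 2 := by
    rw [zpow_neg, ← inv_zpow]; norm_cast
  have hu : IsUnit (C.pii i * (((C.qi i)⁻¹ : Rπˣ) : Rπ)) :=
    (IsUnit.of_mul_eq_one _ hp).mul (Units.isUnit _)
  have := hu.mul h
  rw [e]
  convert this using 1
  linear_combination (-(C.pii i * C.pii i)) * hq - hp

/-- `(θ_i, θ_i) = (1 - π_i q_i⁻²)⁻¹`. -/
def cc (i : I) : Rπ := Ring.inverse (1 - C.pii i * ((C.qi i ^ (-2 : ℤ) : Rπˣ) : Rπ))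

theorem isUnit_cc (i : I) : IsUnit (C.cc i) := (C.isUnit_form_den i).ringInverse

end SuperCartanDatum


/-! ## The free algebra `'f` -/

/-- The free algebra `'f` on generators `θ_i`, `i ∈ I`. -/
abbrev FreeF (I : Type*) : Type _ := FreeAlgebra Rπ I

section FreeF

variable {I : Type*}

/-- The generator `θ_i` of `'f`. -/
abbrev th (i : I) : FreeF I := FreeAlgebra.ι Rπ i

theorem FreeF.induction_left {P : FreeF I → Prop} (h1 : P 1)
    (hadd : ∀ x y, P x → P y → P (x + y)) (hsmul : ∀ (r : Rπ) x, P x → P (r • x))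
    (hmul : ∀ i x, P x → P (th i * x)) (x : FreeF I) : P x := by
  have key : ∀ a : FreeF I, ∀ x, P x → P (a * x) := by
    intro a
    induction a using FreeAlgebra.induction with
    | grade0 r => intro x hx; rw [← Algebra.smul_def]; exact hsmul r x hx
    | grade1 i => exact hmul i
    | mul a b ha hb => intro x hx; rw [mul_assoc]; exact ha _ (hb _ hx)
    | add a b ha hb => intro x hx; rw [add_mul]; exact hadd _ _ (ha _ hx) (hb _ hx)
  simpa using key x 1 h1

theorem FreeF.linearMap_ext {M : Type*} [AddCommMonoid M] [Module Rπ M] {f g : FreeF I →ₗ[Rπ] M}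
    (h1 : f 1 = g 1) (hmul : ∀ i x, f x = g x → f (th i * x) = g (th i * x)) : f = g := by
  ext x
  induction x using FreeF.induction_left with
  | h1 => exact h1
  | hadd x y hx hy => rw [map_add, map_add, hx, hy]
  | hsmul r x hx => rw [map_smul, map_smul, hx]
  | hmul i x hx => exact hmul i x hx

variable [DecidableEq I]

/-- The weight space `'f_ν`: the span of the monomials `θ_{i_1} ⋯ θ_{i_n}` of weight
`i_1 + ⋯ + i_n = ν`. -/
def fwt (I : Type*) (ν : I →₀ ℕ) : Submodule Rπ (FreeF I) :=
  wordGr Rπ (fun i : I => th i) (fun i => Finsupp.single i 1) ν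

instance : GradedAlgebra (fwt I) :=
  wordGr_gradedAlgebra _ _ (FreeAlgebra.adjoin_range_ι Rπ I)
    (FreeAlgebra.lift Rπ fun i => DirectSum.of (fun γ => fwt I γ) (Finsupp.single i 1)
      ⟨th i, gen_mem_wordGr (fun i : I => th i) (fun i => Finsupp.single i 1) i⟩)
    (fun _ => FreeAlgebra.lift_ι_apply _ _)

theorem th_mem (i : I) : th i ∈ fwt I (Finsupp.single i 1) :=
  gen_mem_wordGr (fun i : I => th i) (fun i => Finsupp.single i 1) i

variable (C : SuperCartanDatum I)

/-- The algebra `'f ⊗ 'f` with multiplication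
`(x₁ ⊗ x₂)(x₁' ⊗ x₂') = q^{|x₂| · |x₁'|} π^{p(x₂) p(x₁')} x₁ x₁' ⊗ x₂ x₂'`. -/
abbrev FF : Type _ := TwistedTensor C.chi (fwt I)

/-- The algebra homomorphism `r : 'f → 'f ⊗ 'f` with `r(θ_i) = θ_i ⊗ 1 + 1 ⊗ θ_i`. -/
def rHom : FreeF I →ₐ[Rπ] FF C :=
  FreeAlgebra.lift Rπ fun i => tt C.chi (fwt I) (th i) 1 + tt C.chi (fwt I) 1 (th i)

/-- `r` as a linear map. -/
def rL : FreeF I →ₗ[Rπ] FreeF I ⊗[Rπ] FreeF I where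
  toFun x := (rHom C x : FF C)
  map_add' x y := map_add (rHom C) x y
  map_smul' c x := map_smul (rHom C) c x

/-- `x ↦ q^{i · |x|} π^{p(i) p(x)} x`. -/
abbrev tw (i : I) : FreeF I →ₗ[Rπ] FreeF I := twist C.chi (fwt I) (Finsupp.single i 1)

theorem tw_one (i : I) : tw C i 1 = 1 := by
  rw [twist_of_mem C.chi (fwt I) _ (SetLike.GradedOne.one_mem), C.chi.zero_right, one_smul]

theorem tw_mul (i j : I) (x : FreeF I) : tw C i (th j * x) = (C.chiU i j : Rπ) • (th j * tw C i x) := by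
  refine DirectSum.Decomposition.inductionOn (fwt I) (motive := fun x =>
    tw C i (th j * x) = (C.chiU i j : Rπ) • (th j * tw C i x)) (by simp) ?_ ?_ x
  · intro δ x
    rw [twist_of_mem C.chi (fwt I) _ x.2,
      twist_of_mem C.chi (fwt I) _ (SetLike.mul_mem_graded (th_mem j) x.2), C.chi.add_right,
      C.chi_single, mul_smul, mul_smul_comm]
  · intro x y hx hy
    rw [mul_add, map_add, hx, hy, map_add, mul_add, smul_add]

theorem tw_surjective (i : I) : Function.Surjective (tw C i) := by
  intro x
  induction x using FreeF.induction_left with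
  | h1 => exact ⟨1, tw_one C i⟩
  | hadd x y hx hy =>
    obtain ⟨a, rfl⟩ := hx
    obtain ⟨b, rfl⟩ := hy
    exact ⟨a + b, map_add _ _ _⟩
  | hsmul r x hx =>
    obtain ⟨a, rfl⟩ := hx
    exact ⟨r • a, map_smul _ _ _⟩
  | hmul j x hx =>
    obtain ⟨a, rfl⟩ := hx
    refine ⟨(((C.chiU i j)⁻¹ : Rπˣ) : Rπ) • (th j * a), ?_⟩
    rw [map_smul, tw_mul, smul_smul, Units.inv_mul, one_smul]

theorem rL_one : rL C 1 = 1 ⊗ₜ 1 := map_one (rHom C)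

theorem rL_mul (i : I) (x : FreeF I) : rL C (th i * x) =
    TensorProduct.map (LinearMap.mulLeft Rπ (th i)) LinearMap.id (rL C x) +
    TensorProduct.map (tw C i) (LinearMap.mulLeft Rπ (th i)) (rL C x) := by
  have h : rHom C (th i * x) = (tt C.chi (fwt I) (th i) 1 + tt C.chi (fwt I) 1 (th i)) * rHom C x := by
    rw [map_mul]; simp [rHom]
  have key : ∀ z : FF C, (tt C.chi (fwt I) (th i) 1 + tt C.chi (fwt I) 1 (th i)) * z =
      (show FF C from TensorProduct.map (LinearMap.mulLeft Rπ (th i)) LinearMap.id z) +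
      (show FF C from TensorProduct.map (tw C i) (LinearMap.mulLeft Rπ (th i)) z) := by
    intro z
    rw [add_mul]
    induction z using tt_induction with
    | h0 =>
      rw [mul_zero, mul_zero]
      exact (congrArg₂ (· + ·) (map_zero (TensorProduct.map (LinearMap.mulLeft Rπ (th i))
        (LinearMap.id : FreeF I →ₗ[Rπ] FreeF I))) (map_zero (TensorProduct.map (tw C i)
        (LinearMap.mulLeft Rπ (th i))))).symm
    | hadd x y hx hy =>
      have e1 := map_add (TensorProduct.map (LinearMap.mulLeft Rπ (th i))
        (LinearMap.id : FreeF I →ₗ[Rπ] FreeF I)) x y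
      have e2 := map_add (TensorProduct.map (tw C i) (LinearMap.mulLeft Rπ (th i))) x y
      refine Eq.trans ?_ (congrArg₂ (fun a b : FF C => a + b) e1 e2).symm
      rw [mul_add, mul_add, add_add_add_comm, hx, hy]
      exact add_add_add_comm _ _ _ _
    | h γ δ a b ha hb =>
      rw [tt_mul_tt C.chi (fwt I) _ _ (SetLike.GradedOne.one_mem) ha,
        tt_mul_tt C.chi (fwt I) _ _ (th_mem i) ha, C.chi.zero_left, one_smul, one_mul, one_mul]
      congr 1
      change _ = (twist C.chi (fwt I) (Finsupp.single i 1) a) ⊗ₜ (th i * b)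
      rw [twist_of_mem C.chi (fwt I) _ ha]
      exact (tt_smul_left C.chi (fwt I) _ _ _).symm
  exact h.trans (key _)

/-! ### The bilinear form on `'f` -/

/-- The counit of `'f`, with `θ_i ↦ 0`. -/
def eps (I : Type*) : FreeF I →ₐ[Rπ] Rπ := FreeAlgebra.lift Rπ fun _ => 0

/-- The coefficient of the monomial `θ_i`. -/
def coef (i : I) : FreeF I →ₗ[Rπ] Rπ :=
  (FreeAlgebra.basisFreeMonoid Rπ I).coord (FreeMonoid.of i)

@[simp] theorem eps_mul (i : I) (x : FreeF I) : eps I (th i * x) = 0 := by simp [eps]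

theorem coef_mul (i j : I) (x : FreeF I) :
    coef i (th j * x) = (if i = j then 1 else 0) * eps I x := by
  have hb : ∀ w : FreeMonoid I, FreeAlgebra.basisFreeMonoid Rπ I w =
      (w.toList.map fun i => th i).prod := by
    intro w
    have : FreeAlgebra.basisFreeMonoid Rπ I w =
      FreeAlgebra.equivMonoidAlgebraFreeMonoid.symm (MonoidAlgebra.single w 1) := rfl
    rw [this]
    simp [FreeAlgebra.equivMonoidAlgebraFreeMonoid, FreeMonoid.lift_apply]
  have key : (coef i) ∘ₗ (LinearMap.mulLeft Rπ (th j)) =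
      (if i = j then (1 : Rπ) else 0) • (eps I).toLinearMap := by
    refine (FreeAlgebra.basisFreeMonoid Rπ I).ext fun w => ?_
    have h1 : th j * FreeAlgebra.basisFreeMonoid Rπ I w =
        FreeAlgebra.basisFreeMonoid Rπ I (FreeMonoid.of j * w) := by
      rw [hb, hb]; simp
    simp only [LinearMap.comp_apply, LinearMap.mulLeft_apply, h1, coef, Module.Basis.coord_apply,
      Module.Basis.repr_self, LinearMap.smul_apply, AlgHom.toLinearMap_apply]
    induction w using FreeMonoid.casesOn with
    | one =>
      by_cases h : i = j
      · subst h; rw [hb]; simp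
      · have : FreeMonoid.of j ≠ FreeMonoid.of i := fun h' => h (FreeMonoid.of_injective h').symm
        simp [h, this]
    | of_mul k w =>
      have : FreeMonoid.of j * (FreeMonoid.of k * w) ≠ FreeMonoid.of i := by
        intro h
        have := congrArg FreeMonoid.length h
        simp at this
      rw [hb]
      simp [this]
  exact LinearMap.congr_fun key x

end FreeF


section Form

variable {I : Type*} [DecidableEq I] (C : SuperCartanDatum I)

/-- The product on the dual of `'f` obtained by transposing `r`: `(g h)(x) = (g ⊗ h)(r(x))`. -/
def conv (g h : FreeF I →ₗ[Rπ] Rπ) : FreeF I →ₗ[Rπ] Rπ :=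
  LinearMap.mul' Rπ Rπ ∘ₗ TensorProduct.map g h ∘ₗ rL C

/-- The functional `ξ_i` on `'f` with `ξ_i(θ_i) = (1 - π_i q_i⁻²)⁻¹`, vanishing on all other
monomials. -/
def xi (i : I) : FreeF I →ₗ[Rπ] Rπ := C.cc i • coef i

/-- The map `h ↦ g h` on the dual of `'f`. -/
def convL (g : FreeF I →ₗ[Rπ] Rπ) : Module.End Rπ (FreeF I →ₗ[Rπ] Rπ) where
  toFun h := conv C g h
  map_add' h h' := by
    rw [conv, TensorProduct.map_add_right, LinearMap.add_comp, LinearMap.comp_add]; rfl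
  map_smul' c h := by
    rw [conv, TensorProduct.map_smul_right, LinearMap.smul_comp, LinearMap.comp_smul]; rfl

/-- The algebra homomorphism `φ` from `'f` to the dual of `'f` with `φ(θ_i) = ξ_i`: since the
counit is the unit of the dual, `φ(y)` is obtained by letting `y` act on the counit, with `θ_i`
acting by left multiplication by `ξ_i`. -/
def phi : FreeF I →ₗ[Rπ] FreeF I →ₗ[Rπ] Rπ :=
  (LinearMap.applyₗ (eps I).toLinearMap) ∘ₗ
    (FreeAlgebra.lift Rπ fun i => convL C (xi C i) :
      FreeF I →ₐ[Rπ] Module.End Rπ (FreeF I →ₗ[Rπ] Rπ)).toLinearMap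

/-- The bilinear form on `'f`: `(x, y) = φ(y)(x)`. -/
def form : FreeF I →ₗ[Rπ] FreeF I →ₗ[Rπ] Rπ := (phi C).flip

theorem form_one_right (x : FreeF I) : form C x 1 = eps I x := by simp [form, phi]

theorem phi_mul (i : I) (y : FreeF I) : phi C (th i * y) = conv C (xi C i) (phi C y) := by
  simp [phi, convL]

/-- The twisted derivation `ᵢr`: the component `θ_i ⊗ ᵢr(x)` of `r(x)`. -/
def ir (i : I) : FreeF I →ₗ[Rπ] FreeF I :=
  (TensorProduct.lid Rπ (FreeF I)).toLinearMap ∘ₗ LinearMap.rTensor (FreeF I) (coef i) ∘ₗ rL C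

theorem eps_tw (j : I) (x : FreeF I) : eps I (tw C j x) = eps I x := by
  induction x using FreeF.induction_left with
  | h1 => rw [tw_one]
  | hadd x y hx hy => rw [map_add, map_add, map_add, hx, hy]
  | hsmul r x hx => rw [map_smul, map_smul, map_smul, hx]
  | hmul i x hx => rw [tw_mul, map_smul, eps_mul, eps_mul, smul_zero]

theorem coef_one (i : I) : coef i (1 : FreeF I) = 0 := by
  have : (1 : FreeF I) = FreeAlgebra.basisFreeMonoid Rπ I 1 := by
    have : FreeAlgebra.basisFreeMonoid Rπ I 1 =
      FreeAlgebra.equivMonoidAlgebraFreeMonoid.symm (MonoidAlgebra.single 1 1) := rfl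
    rw [this, ← MonoidAlgebra.one_def, map_one]
  rw [this, coef, Module.Basis.coord_apply, Module.Basis.repr_self]
  have h : (1 : FreeMonoid I) ≠ FreeMonoid.of i := fun h => by
    have := congrArg FreeMonoid.length h
    simp at this
  simp

theorem coef_tw (i j : I) (x : FreeF I) : coef i (tw C j x) = (C.chiU j i : Rπ) * coef i x := by
  induction x using FreeF.induction_left with
  | h1 => rw [tw_one, coef_one, mul_zero]
  | hadd x y hx hy => rw [map_add, map_add, map_add, hx, hy, mul_add]
  | hsmul r x hx => rw [map_smul, map_smul, map_smul, hx, smul_eq_mul, smul_eq_mul]; ring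
  | hmul k x hx =>
    rw [tw_mul, map_smul, coef_mul, coef_mul, eps_tw, smul_eq_mul]
    by_cases h : i = k
    · subst h; ring
    · simp [h]

theorem counit_left (x : FreeF I) :
    TensorProduct.lid Rπ (FreeF I) (LinearMap.rTensor (FreeF I) (eps I).toLinearMap (rL C x)) =
      x := by
  induction x using FreeF.induction_left with
  | h1 => simp [rL_one]
  | hadd x y hx hy => simp only [map_add, hx, hy]
  | hsmul r x hx => simp only [map_smul, hx]
  | hmul i x hx =>
    have key : ∀ z : FreeF I ⊗[Rπ] FreeF I,
        TensorProduct.lid Rπ (FreeF I) (LinearMap.rTensor (FreeF I) (eps I).toLinearMap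
          (TensorProduct.map (LinearMap.mulLeft Rπ (th i)) LinearMap.id z +
          TensorProduct.map (tw C i) (LinearMap.mulLeft Rπ (th i)) z)) =
        th i * TensorProduct.lid Rπ (FreeF I)
          (LinearMap.rTensor (FreeF I) (eps I).toLinearMap z) := by
      intro z
      induction z using TensorProduct.induction_on with
      | zero => simp
      | add a b ha hb => simp only [map_add, mul_add] at *; rw [← ha, ← hb]; abel
      | tmul a b => simp [eps_tw]
    rw [rL_mul, key, hx]

theorem ir_one (i : I) : ir C i 1 = 0 := by
  simp [ir, rL_one, coef_one]

theorem ir_mul (i j : I) (x : FreeF I) : ir C i (th j * x) =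
    (if i = j then (1 : Rπ) else 0) • x + (C.chiU i j : Rπ) • (th j * ir C i x) := by
  have key : ∀ z : FreeF I ⊗[Rπ] FreeF I,
      TensorProduct.lid Rπ (FreeF I) (LinearMap.rTensor (FreeF I) (coef i)
        (TensorProduct.map (LinearMap.mulLeft Rπ (th j)) LinearMap.id z +
        TensorProduct.map (tw C j) (LinearMap.mulLeft Rπ (th j)) z)) =
      (if i = j then (1 : Rπ) else 0) • TensorProduct.lid Rπ (FreeF I)
          (LinearMap.rTensor (FreeF I) (eps I).toLinearMap z) +
      (C.chiU i j : Rπ) • (th j * TensorProduct.lid Rπ (FreeF I)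
          (LinearMap.rTensor (FreeF I) (coef i) z)) := by
    intro z
    induction z using TensorProduct.induction_on with
    | zero => simp
    | add a b ha hb =>
      simp only [map_add, mul_add, smul_add] at *
      rw [add_add_add_comm, ha, hb]; abel
    | tmul a b =>
      simp only [TensorProduct.map_tmul, map_add, LinearMap.rTensor_tmul, LinearMap.mulLeft_apply,
        LinearMap.id_apply, TensorProduct.lid_tmul, coef_mul, coef_tw, AlgHom.toLinearMap_apply,
        mul_smul, mul_smul_comm, C.chiU_comm j i]
  simp only [ir, LinearMap.comp_apply, LinearEquiv.coe_coe, rL_mul]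
  rw [key, counit_left]

theorem form_mul_right (i : I) (x y : FreeF I) :
    form C x (th i * y) = C.cc i * form C (ir C i x) y := by
  have key : ∀ z : FreeF I ⊗[Rπ] FreeF I,
      LinearMap.mul' Rπ Rπ (TensorProduct.map (xi C i) (phi C y) z) =
      C.cc i * phi C y (TensorProduct.lid Rπ (FreeF I)
          (LinearMap.rTensor (FreeF I) (coef i) z)) := by
    intro z
    induction z using TensorProduct.induction_on with
    | zero => simp
    | add a b ha hb => simp only [map_add, mul_add, ha, hb]
    | tmul a b => simp [xi, mul_assoc]
  simp only [form, LinearMap.flip_apply, phi_mul]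
  exact key _

theorem ir_tw (i j : I) (x : FreeF I) :
    ir C j (tw C i x) = (C.chiU i j : Rπ) • tw C i (ir C j x) := by
  induction x using FreeF.induction_left with
  | h1 => rw [tw_one, ir_one, map_zero, smul_zero]
  | hadd x y hx hy => simp only [map_add, smul_add, hx, hy]
  | hsmul r x hx => simp only [map_smul, hx, smul_comm r]
  | hmul k x hx =>
    rw [tw_mul, map_smul, ir_mul, ir_mul, hx]
    simp only [map_add, map_smul, smul_add, tw_mul, mul_smul_comm, smul_smul]
    by_cases h : j = k
    · subst h; simp only [if_true, mul_comm]
    · simp only [h, if_false, mul_zero, zero_smul, zero_add]; congr 1; ring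

theorem form_tw (i : I) (x y : FreeF I) : form C (tw C i x) y = form C x (tw C i y) := by
  induction y using FreeF.induction_left generalizing x with
  | h1 => rw [tw_one, form_one_right, form_one_right, eps_tw]
  | hadd y y' hx hy => simp only [map_add, hx, hy]
  | hsmul r y hy => simp only [map_smul, hy]
  | hmul j y hy =>
    rw [tw_mul, form_mul_right, ir_tw, map_smul, map_smul, form_mul_right, LinearMap.smul_apply, hy,
      smul_eq_mul, smul_eq_mul]
    ring

theorem form_one_left (y : FreeF I) : form C 1 y = eps I y := by
  induction y using FreeF.induction_left with
  | h1 => rw [form_one_right]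
  | hadd y y' hx hy => simp only [map_add, hx, hy]
  | hsmul r y hy => simp only [map_smul, hy]
  | hmul j y hy => rw [form_mul_right, ir_one, eps_mul]; simp

theorem form_mul_left (i : I) (x y : FreeF I) :
    form C (th i * x) y = C.cc i * form C x (ir C i y) := by
  induction y using FreeF.induction_left generalizing x with
  | h1 => rw [form_one_right, eps_mul, ir_one, map_zero, mul_zero]
  | hadd y y' hx hy => simp only [map_add, hx, hy, mul_add]
  | hsmul r y hy => simp only [map_smul, hy, smul_eq_mul]; ring
  | hmul j y hy =>
    rw [form_mul_right, ir_mul, ir_mul]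
    simp only [map_add, map_smul, LinearMap.add_apply, LinearMap.smul_apply, hy, form_mul_right,
      smul_eq_mul]
    rw [C.chiU_comm j i]
    by_cases h : i = j
    · subst h; simp only [if_true]
    · simp only [h, Ne.symm h, if_false]; ring

/-- The bilinear form is symmetric. -/
theorem form_symm (x y : FreeF I) : form C x y = form C y x := by
  induction x using FreeF.induction_left generalizing y with
  | h1 => rw [form_one_right, form_one_left]
  | hadd y y' hx hy => simp only [map_add, LinearMap.add_apply, hx, hy]
  | hsmul r y hy => simp only [map_smul, LinearMap.smul_apply, hy]
  | hmul j y hy => rw [form_mul_right, form_mul_left, hy]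

theorem rL_ir (i : I) (x : FreeF I) :
    rL C (ir C i x) = TensorProduct.map (ir C i) LinearMap.id (rL C x) := by
  induction x using FreeF.induction_left with
  | h1 => rw [ir_one, rL_one, map_zero, TensorProduct.map_tmul, ir_one, TensorProduct.zero_tmul]
  | hadd y y' hx hy => simp only [map_add, hx, hy]
  | hsmul r y hy => simp only [map_smul, hy]
  | hmul j x hx =>
    have key : ∀ z : FreeF I ⊗[Rπ] FreeF I,
        TensorProduct.map (ir C i) LinearMap.id
          (TensorProduct.map (LinearMap.mulLeft Rπ (th j)) LinearMap.id z +
          TensorProduct.map (tw C j) (LinearMap.mulLeft Rπ (th j)) z) =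
        (if i = j then (1 : Rπ) else 0) • z + (C.chiU i j : Rπ) •
          (TensorProduct.map (LinearMap.mulLeft Rπ (th j)) LinearMap.id
            (TensorProduct.map (ir C i) LinearMap.id z) +
          TensorProduct.map (tw C j) (LinearMap.mulLeft Rπ (th j))
            (TensorProduct.map (ir C i) LinearMap.id z)) := by
      intro z
      induction z using TensorProduct.induction_on with
      | zero => simp
      | add a b ha hb =>
        simp only [map_add, smul_add] at *
        rw [add_add_add_comm, ha, hb]; abel
      | tmul a b =>
        simp only [TensorProduct.map_tmul, map_add, LinearMap.mulLeft_apply,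
          LinearMap.id_apply, ir_mul, ir_tw, TensorProduct.add_tmul, smul_add,
          ← TensorProduct.smul_tmul', C.chiU_comm j i]
        abel
    rw [rL_mul, key, ir_mul, map_add, map_smul, map_smul, rL_mul, hx]

/-- `(x, y'y'') = (r(x), y' ⊗ y'')`. -/
theorem form_mul (x y y' : FreeF I) :
    form C x (y * y') =
      LinearMap.mul' Rπ Rπ (TensorProduct.map ((form C).flip y) ((form C).flip y') (rL C x)) := by
  induction y using FreeF.induction_left generalizing x with
  | h1 =>
    have : ∀ z : FreeF I ⊗[Rπ] FreeF I, form C (TensorProduct.lid Rπ (FreeF I)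
        (LinearMap.rTensor (FreeF I) (eps I).toLinearMap z)) y' =
        LinearMap.mul' Rπ Rπ (TensorProduct.map ((form C).flip 1) ((form C).flip y') z) := by
      intro z
      induction z using TensorProduct.induction_on with
      | zero => simp
      | add a b ha hb => simp only [map_add, LinearMap.add_apply, ha, hb]
      | tmul a b => simp [form_one_right]
    rw [← this, counit_left, one_mul]
  | hadd y₁ y₂ h h' =>
    rw [add_mul, map_add, h, h', map_add, TensorProduct.map_add_left, LinearMap.add_apply, map_add]
  | hsmul r y h =>
    rw [smul_mul_assoc, map_smul, h, map_smul, TensorProduct.map_smul_left, LinearMap.smul_apply,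
      map_smul]
  | hmul i y h =>
    have : ∀ z : FreeF I ⊗[Rπ] FreeF I,
        LinearMap.mul' Rπ Rπ (TensorProduct.map ((form C).flip (th i * y)) ((form C).flip y') z) =
        C.cc i * LinearMap.mul' Rπ Rπ (TensorProduct.map ((form C).flip y) ((form C).flip y')
          (TensorProduct.map (ir C i) LinearMap.id z)) := by
      intro z
      induction z using TensorProduct.induction_on with
      | zero => simp
      | add a b ha hb => simp only [map_add, mul_add, ha, hb]
      | tmul a b => simp [form_mul_right, mul_assoc]
    rw [mul_assoc, form_mul_right, h, rL_ir, this]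

/-- `(x x', y) = (x ⊗ x', r(y))`. -/
theorem form_mul' (x x' y : FreeF I) :
    form C (x * x') y =
      LinearMap.mul' Rπ Rπ (TensorProduct.map (form C x) (form C x') (rL C y)) := by
  have e : ∀ z, (form C).flip z = form C z := fun z => LinearMap.ext fun w => form_symm C w z
  rw [form_symm, form_mul, e, e]

/-- The form on `'f` has the properties that characterize it. -/
theorem form_characterization :
    form C 1 1 = 1 ∧ (∀ i j, form C (th i) (th j) = if i = j then C.cc i else 0) ∧
    (∀ x y y', form C x (y * y') =
      LinearMap.mul' Rπ Rπ (TensorProduct.map ((form C).flip y) ((form C).flip y') (rL C x))) ∧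
    (∀ x x' y, form C (x * x') y =
      LinearMap.mul' Rπ Rπ (TensorProduct.map (form C x) (form C x') (rL C y))) := by
  refine ⟨by rw [form_one_right, map_one], fun i j => ?_, form_mul C, form_mul' C⟩
  have h1 : (th j : FreeF I) = th j * 1 := (mul_one _).symm
  have h2 : (th i : FreeF I) = th i * 1 := (mul_one _).symm
  rw [h1, form_mul_right, form_one_right, h2, ir_mul, ir_one]
  by_cases h : i = j
  · subst h; simp
  · simp [h, Ne.symm h]

/-! ### The radical and the algebra `f` -/

/-- The radical of the bilinear form. -/
def rad : Ideal (FreeF I) where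
  carrier := {x | ∀ y, form C x y = 0}
  zero_mem' := fun y => by simp
  add_mem' := fun {a b} ha hb y => by
    rw [map_add, LinearMap.add_apply, ha y, hb y, add_zero]
  smul_mem' := fun a x hx y => by
    have h : form C x = 0 := LinearMap.ext hx
    rw [smul_eq_mul, form_mul', h, TensorProduct.map_zero_right]
    simp

theorem mem_rad {x : FreeF I} : x ∈ rad C ↔ ∀ y, form C x y = 0 := Iff.rfl

instance : (rad C).IsTwoSided where
  mul_mem_of_left := fun {a} b ha y => by
    have h : form C a = 0 := LinearMap.ext ha
    rw [form_mul', h, TensorProduct.map_zero_left]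
    simp

/-- The algebra `f`, the quotient of `'f` by the radical of the form. -/
def fAlg : Type _ := FreeF I ⧸ rad C

instance : Ring (fAlg C) := inferInstanceAs (Ring (FreeF I ⧸ rad C))
instance : Algebra Rπ (fAlg C) := inferInstanceAs (Algebra Rπ (FreeF I ⧸ rad C))

/-- The projection `'f → f`. -/
def fmk : FreeF I →ₐ[Rπ] fAlg C := Ideal.Quotient.mkₐ Rπ (rad C)

theorem fmk_surjective : Function.Surjective (fmk C) := Ideal.Quotient.mkₐ_surjective Rπ (rad C)

theorem fmk_eq_zero {x : FreeF I} : fmk C x = 0 ↔ x ∈ rad C := Ideal.Quotient.eq_zero_iff_mem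

/-- The homomorphism from `f` induced by a homomorphism from `'f` that kills the radical. -/
def fLift {A : Type*} [Ring A] [Algebra Rπ A] (g : FreeF I →ₐ[Rπ] A) (hg : ∀ x ∈ rad C, g x = 0) :
    fAlg C →ₐ[Rπ] A :=
  Ideal.Quotient.liftₐ (rad C) g hg

@[simp] theorem fLift_fmk {A : Type*} [Ring A] [Algebra Rπ A] (g : FreeF I →ₐ[Rπ] A)
    (hg : ∀ x ∈ rad C, g x = 0) (x : FreeF I) : fLift C g hg (fmk C x) = g x := rfl

/-- The linear map from `f` induced by a linear map from `'f` that kills the radical. -/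
def fLiftLin {M : Type*} [AddCommGroup M] [Module Rπ M] (g : FreeF I →ₗ[Rπ] M)
    (hg : ∀ x ∈ rad C, g x = 0) : fAlg C →ₗ[Rπ] M where
  toFun := QuotientAddGroup.lift (rad C).toAddSubgroup g.toAddMonoidHom hg
  map_add' x y := map_add _ x y
  map_smul' r x := by
    obtain ⟨x, rfl⟩ := fmk_surjective C x
    exact map_smul g r x

@[simp] theorem fLiftLin_fmk {M : Type*} [AddCommGroup M] [Module Rπ M] (g : FreeF I →ₗ[Rπ] M)
    (hg : ∀ x ∈ rad C, g x = 0) (x : FreeF I) : fLiftLin C g hg (fmk C x) = g x := rfl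

/-- The weight space `f_ν`, the image of `'f_ν`. -/
def fAlgWt (ν : I →₀ ℕ) : Submodule Rπ (fAlg C) := (fwt I ν).map (fmk C).toLinearMap

/-- The bilinear form on `f` induced by the form on `'f`. -/
def fForm : fAlg C →ₗ[Rπ] fAlg C →ₗ[Rπ] Rπ :=
  fLiftLin C (LinearMap.flip (fLiftLin C (form C).flip fun x hx => by
      ext y
      rw [LinearMap.flip_apply, form_symm]; exact hx y))
    fun x hx => by
      ext y
      obtain ⟨y, rfl⟩ := fmk_surjective C y
      exact hx y

theorem fForm_fmk (x y : FreeF I) : fForm C (fmk C x) (fmk C y) = form C x y := rfl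

end Form


/-! ## Restriction of scalars along the bar involution -/

/-- The algebra `A` with scalars acting through the bar involution of `ℚ(q)^π`. -/
def BarTw (A : Type*) : Type _ := A

instance (A : Type*) [Ring A] : Ring (BarTw A) := inferInstanceAs (Ring A)

instance (A : Type*) [Ring A] [Algebra Rπ A] : Algebra Rπ (BarTw A) where
  algebraMap := (algebraMap Rπ A).comp barR
  smul r x := (barR r • (show A from x) : A)
  commutes' r x := Algebra.commutes (A := A) (barR r) x
  smul_def' r x := Algebra.smul_def (A := A) (barR r) x

/-- The identity map. -/
def BarTw.mk {A : Type*} [Ring A] : A →+* BarTw A := RingHom.id A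

/-- The identity map. -/
def BarTw.out {A : Type*} [Ring A] : BarTw A →+* A := RingHom.id A

theorem BarTw.out_smul {A : Type*} [Ring A] [Algebra Rπ A] (r : Rπ) (x : BarTw A) :
    BarTw.out (r • x) = barR r • BarTw.out x := rfl

section

variable {I : Type*} [DecidableEq I] (C : SuperCartanDatum I)

/-- The bar involution of `'f`, as an algebra homomorphism for the twisted scalars. -/
def barFA (I : Type*) : FreeF I →ₐ[Rπ] BarTw (FreeF I) := FreeAlgebra.lift Rπ fun i => BarTw.mk (th i)

/-- The bar involution of `'f`: it fixes the `θ_i` and is semilinear for the bar involution of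
`ℚ(q)^π`. -/
def barF (I : Type*) : FreeF I →ₛₗ[barR] FreeF I where
  toFun x := BarTw.out (barFA I x)
  map_add' x y := by rw [map_add, map_add]
  map_smul' r x := by rw [map_smul]; rfl

theorem barF_one : barF I 1 = 1 := map_one (barFA I)

theorem barF_th (i : I) : barF I (th i) = th i := by
  change BarTw.out (barFA I (th i)) = th i
  rw [barFA, FreeAlgebra.lift_ι_apply]; rfl

theorem barF_mul (x y : FreeF I) : barF I (x * y) = barF I x * barF I y := map_mul (barFA I) x y

theorem barF_barF (x : FreeF I) : barF I (barF I x) = x := by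
  induction x using FreeF.induction_left with
  | h1 => rw [barF_one, barF_one]
  | hadd y y' hx hy => rw [map_add, map_add, hx, hy]
  | hsmul r y hy => rw [LinearMap.map_smulₛₗ, LinearMap.map_smulₛₗ, hy, barR_barR]
  | hmul j x hx => rw [barF_mul, barF_mul, hx, barF_th, barF_th]

/-! ### Stability of the radical -/

/-- The map `x ↦ bar (ᵢr (bar x))`. -/
def irb (i : I) : FreeF I →ₗ[Rπ] FreeF I where
  toFun x := barF I (ir C i (barF I x))
  map_add' x y := by simp only [map_add]
  map_smul' r x := by
    rw [LinearMap.map_smulₛₗ, map_smul, LinearMap.map_smulₛₗ, barR_barR]; rfl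

theorem irb_one (i : I) : irb C i 1 = 0 := by
  change barF I (ir C i (barF I 1)) = 0
  rw [barF_one, ir_one, map_zero]

theorem barR_chiU [C.Consistent] (i j : I) :
    barR (C.chiU i j : Rπ) = (((C.chiU i j)⁻¹ : Rπˣ) : Rπ) := by
  have h : Units.map barR.toMonoidHom (C.chiU i j) = (C.chiU i j)⁻¹ := by
    rw [SuperCartanDatum.chiU, map_mul, map_zpow, map_pow, barR_units_qq, barR_units_piU, mul_zpow,
      piU_zpow_even (C.even_dot i j), one_mul, mul_inv, inv_zpow, ← inv_pow, piU_inv]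
  exact congrArg Units.val h

theorem irb_mul [C.Consistent] (i j : I) (x : FreeF I) : irb C i (th j * x) =
    (if i = j then (1 : Rπ) else 0) • x +
      (((C.chiU i j)⁻¹ : Rπˣ) : Rπ) • (th j * irb C i x) := by
  change barF I (ir C i (barF I (th j * x))) = _
  rw [barF_mul, barF_th, ir_mul, map_add, LinearMap.map_smulₛₗ, LinearMap.map_smulₛₗ, barF_barF,
    barR_chiU, barF_mul, barF_th]
  congr 2
  split_ifs <;> simp

theorem irb_ir [C.Consistent] (i j : I) (x : FreeF I) :
    irb C i (ir C j x) = (C.chiU i j : Rπ) • ir C j (irb C i x) := by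
  induction x using FreeF.induction_left with
  | h1 => rw [ir_one, map_zero, irb_one, map_zero, smul_zero]
  | hadd y y' hx hy => simp only [map_add, hx, hy, smul_add]
  | hsmul r y hy => rw [map_smul, map_smul, map_smul, map_smul, hy, smul_comm]
  | hmul k x hx =>
    have h1 : (if j = k then (1 : Rπ) else 0) =
        C.chiU i j * ((((C.chiU i k)⁻¹ : Rπˣ) : Rπ) * (if j = k then (1 : Rπ) else 0)) := by
      split_ifs with h
      · rw [h, mul_one, Units.mul_inv]
      · simp
    have h2 : (C.chiU j k : Rπ) * (if i = k then (1 : Rπ) else 0) =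
        C.chiU i j * (if i = k then (1 : Rπ) else 0) := by
      split_ifs with h
      · rw [h, C.chiU_comm]
      · simp
    rw [ir_mul, irb_mul]
    simp only [map_add, map_smul, irb_mul, ir_mul, hx, smul_add, smul_smul, mul_smul_comm]
    linear_combination (norm := module) h1 • irb C i x + h2 • ir C j x

theorem eps_ir (i : I) (x : FreeF I) [C.Consistent] : eps I (ir C i x) = eps I (irb C i x) := by
  induction x using FreeF.induction_left with
  | h1 => rw [ir_one, irb_one]
  | hadd y y' hx hy => simp only [map_add, hx, hy]
  | hsmul r y hy => simp only [map_smul, hy]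
  | hmul k x hx => rw [ir_mul, irb_mul]; simp

theorem form_mul_th [C.Consistent] (i : I) (x y : FreeF I) :
    form C x (y * th i) = C.cc i * form C (irb C i x) (tw C i y) := by
  induction y using FreeF.induction_left generalizing x with
  | h1 =>
    have : (1 : FreeF I) * th i = th i * 1 := by rw [one_mul, mul_one]
    rw [this, form_mul_right, form_one_right, tw_one, form_one_right, eps_ir]
  | hadd y y' hx hy => simp only [map_add, add_mul, hx, hy, mul_add]
  | hsmul r y hy => simp only [map_smul, smul_mul_assoc, hy, smul_eq_mul]; ring
  | hmul k y hy =>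
    rw [mul_assoc, form_mul_right, hy, irb_ir, tw_mul, map_smul, map_smul, form_mul_right,
      LinearMap.smul_apply, smul_eq_mul, smul_eq_mul, C.chiU_comm]
    ring

theorem eps_barF (x : FreeF I) : eps I (barF I x) = barR (eps I x) := by
  induction x using FreeF.induction_left with
  | h1 => rw [barF_one, map_one, map_one]
  | hadd y y' hx hy => simp only [map_add, hx, hy]
  | hsmul r y hy => rw [LinearMap.map_smulₛₗ, map_smul, map_smul, hy, smul_eq_mul, smul_eq_mul, map_mul]
  | hmul k x hx => rw [barF_mul, barF_th, eps_mul, eps_mul, map_zero]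

theorem irb_mem_rad [C.Consistent] (i : I) {x : FreeF I} (hx : x ∈ rad C) : irb C i x ∈ rad C := by
  intro y
  obtain ⟨y, rfl⟩ := tw_surjective C i y
  have h := form_mul_th C i x y
  rw [hx] at h
  exact ((C.isUnit_cc i).mul_right_eq_zero).mp h.symm

theorem ir_mem_rad (i : I) {x : FreeF I} (hx : x ∈ rad C) : ir C i x ∈ rad C := by
  intro y
  have h := form_mul_right C i x y
  rw [hx] at h
  exact ((C.isUnit_cc i).mul_right_eq_zero).mp h.symm

theorem barF_mem_rad [C.Consistent] {x : FreeF I} (hx : x ∈ rad C) : barF I x ∈ rad C := by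
  intro y
  induction y using FreeF.induction_left generalizing x with
  | h1 =>
    have h := hx 1
    rw [form_one_right] at h
    rw [form_one_right, eps_barF, h, map_zero]
  | hadd y y' h h' => rw [map_add, h hx, h' hx, add_zero]
  | hsmul r y h => rw [map_smul, h hx, smul_zero]
  | hmul i y h =>
    have := h (irb_mem_rad C i hx)
    change form C (barF I (barF I _)) y = 0 at this
    rw [barF_barF] at this
    rw [form_mul_right, this, mul_zero]

theorem ir_word (i : I) (l : List I) : ir C i (l.map fun i => th i).prod ∈
    Submodule.span Rπ {x : FreeF I | ∃ m : List I, (m.map fun i => Finsupp.single i 1).sum +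
      Finsupp.single i 1 = (l.map fun i => Finsupp.single i 1).sum ∧
      (m.map fun i => th i).prod = x} := by
  induction l with
  | nil => simp only [List.map_nil, List.prod_nil, ir_one]; exact zero_mem _
  | cons j l ih =>
    simp only [List.map_cons, List.prod_cons, ir_mul]
    refine add_mem ?_ (Submodule.smul_mem _ _ ?_)
    · split_ifs with h
      · subst h
        rw [one_smul]
        exact Submodule.subset_span ⟨l, by simp [add_comm], rfl⟩
      · rw [zero_smul]; exact zero_mem _
    · generalize ir C i (l.map fun i => th i).prod = z at ih
      induction ih using Submodule.span_induction with
      | mem x hx =>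
        obtain ⟨m, hm, rfl⟩ := hx
        exact Submodule.subset_span ⟨j :: m, by simp [← hm, add_assoc], by simp⟩
      | zero => rw [mul_zero]; exact zero_mem _
      | add x y _ _ hx hy => rw [mul_add]; exact add_mem hx hy
      | smul r x _ hx => rw [mul_smul_comm]; exact Submodule.smul_mem _ _ hx

theorem form_word_eq_zero (l l' : List I) (h : (l.map fun i => Finsupp.single i 1).sum ≠
    (l'.map fun i => Finsupp.single i 1).sum) :
    form C (l.map fun i => th i).prod (l'.map fun i => th i).prod = 0 := by
  induction l' generalizing l with
  | nil =>
    rw [List.map_nil, List.prod_nil, form_one_right]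
    cases l with
    | nil => exact absurd rfl h
    | cons j l => rw [List.map_cons, List.prod_cons, eps_mul]
  | cons i l' ih =>
    rw [List.map_cons, List.prod_cons, form_mul_right]
    have hz := ir_word C i l
    generalize ir C i (l.map fun i => th i).prod = z at hz
    suffices hz0 : form C z (l'.map fun i => th i).prod = 0 by rw [hz0, mul_zero]
    induction hz using Submodule.span_induction with
    | mem x hx =>
      obtain ⟨m, hm, rfl⟩ := hx
      refine ih m fun he => h ?_
      rw [← hm, he, List.map_cons, List.sum_cons, add_comm]
    | zero => simp
    | add x y _ _ hx hy => rw [map_add, LinearMap.add_apply, hx, hy, add_zero]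
    | smul r x _ hx => rw [map_smul, LinearMap.smul_apply, hx, smul_zero]

theorem form_eq_zero_of_ne {ν μ : I →₀ ℕ} (h : ν ≠ μ) {x y : FreeF I} (hx : x ∈ fwt I ν)
    (hy : y ∈ fwt I μ) : form C x y = 0 := by
  induction hx, hy using Submodule.span_induction₂ with
  | mem_mem a b ha hb =>
    obtain ⟨l, rfl, rfl⟩ := ha
    obtain ⟨l', rfl, rfl⟩ := hb
    exact form_word_eq_zero C l l' h
  | zero_left y hy => simp
  | zero_right y hy => simp
  | add_left x y z _ _ _ h h' => rw [map_add, LinearMap.add_apply, h, h', add_zero]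
  | add_right x y z _ _ _ h h' => rw [map_add, h, h', add_zero]
  | smul_left r x y _ _ h => rw [map_smul, LinearMap.smul_apply, h, smul_zero]
  | smul_right r x y _ _ h => rw [map_smul, h, smul_zero]

/-- The radical is a homogeneous ideal. -/
theorem proj_mem_rad {x : FreeF I} (hx : x ∈ rad C) (ν : I →₀ ℕ) :
    (DirectSum.decompose (fwt I) x ν : FreeF I) ∈ rad C := by
  classical
  intro y
  refine DirectSum.Decomposition.inductionOn (fwt I) (motive := fun y =>
    form C (DirectSum.decompose (fwt I) x ν : FreeF I) y = 0) (by simp) ?_ ?_ y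
  · intro μ y
    by_cases h : ν = μ
    · subst h
      have h1 := hx y
      rw [← DirectSum.sum_support_decompose (fwt I) x, map_sum, LinearMap.sum_apply] at h1
      by_cases hν : ν ∈ (DirectSum.decompose (fwt I) x).support
      · rw [Finset.sum_eq_single_of_mem ν hν fun μ _ hμ =>
          form_eq_zero_of_ne C hμ (SetLike.coe_mem _) y.2] at h1
        exact h1
      · rw [DFinsupp.notMem_support_iff.mp hν]; simp
    · exact form_eq_zero_of_ne C h (SetLike.coe_mem _) y.2
  · intro y y' h h'
    rw [map_add, h, h', add_zero]

/-- An additive map kills the radical as soon as it kills its homogeneous elements. -/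
theorem rad_kill {M : Type*} [AddCommMonoid M] (g : FreeF I →+ M)
    (hg : ∀ (ν : I →₀ ℕ) (x : FreeF I), x ∈ fwt I ν → x ∈ rad C → g x = 0)
    (x : FreeF I) (hx : x ∈ rad C) : g x = 0 := by
  classical
  rw [← DirectSum.sum_support_decompose (fwt I) x, map_sum]
  exact Finset.sum_eq_zero fun ν _ => hg ν _ (SetLike.coe_mem _) (proj_mem_rad C hx ν)

/-! ### `r` descends to `f` -/

/-- The span of the monomials of length less than `n`. -/
def lenLT (I : Type*) (n : ℕ) : Submodule Rπ (FreeF I) :=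
  Submodule.span Rπ {x | ∃ l : List I, l.length < n ∧ (l.map fun i => th i).prod = x}

theorem exists_lenLT (x : FreeF I) : ∃ n, x ∈ lenLT I n := by
  have mono : ∀ {m n : ℕ}, m ≤ n → lenLT I m ≤ lenLT I n := fun h =>
    Submodule.span_mono fun x ⟨l, hl, hx⟩ => ⟨l, hl.trans_le h, hx⟩
  induction x using FreeF.induction_left with
  | h1 => exact ⟨1, Submodule.subset_span ⟨[], by simp, rfl⟩⟩
  | hadd x y hx hy =>
    obtain ⟨m, hm⟩ := hx
    obtain ⟨n, hn⟩ := hy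
    exact ⟨max m n, add_mem (mono (le_max_left _ _) hm) (mono (le_max_right _ _) hn)⟩
  | hsmul r x hx =>
    obtain ⟨m, hm⟩ := hx
    exact ⟨m, Submodule.smul_mem _ _ hm⟩
  | hmul i x hx =>
    obtain ⟨m, hm⟩ := hx
    refine ⟨m + 1, ?_⟩
    induction hm using Submodule.span_induction with
    | mem x hx =>
      obtain ⟨l, hl, rfl⟩ := hx
      exact Submodule.subset_span ⟨i :: l, by simpa using hl, by simp⟩
    | zero => rw [mul_zero]; exact zero_mem _
    | add x y _ _ hx hy => rw [mul_add]; exact add_mem hx hy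
    | smul r x _ hx => rw [mul_smul_comm]; exact Submodule.smul_mem _ _ hx

theorem ir_lenLT (i : I) {n : ℕ} {x : FreeF I} (hx : x ∈ lenLT I (n + 1)) :
    ir C i x ∈ lenLT I n := by
  induction hx using Submodule.span_induction with
  | mem x hx =>
    obtain ⟨l, hl, rfl⟩ := hx
    refine Submodule.span_mono ?_ (ir_word C i l)
    rintro x ⟨m, hm, rfl⟩
    refine ⟨m, ?_, rfl⟩
    have hlen : ∀ l : List I, ((l.map fun i => Finsupp.single i 1).sum : I →₀ ℕ).sum
        (fun _ a => a) = l.length := by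
      intro l
      induction l with
      | nil => simp
      | cons a l ih =>
        rw [List.map_cons, List.sum_cons, Finsupp.sum_add_index' (fun _ => rfl) (fun _ _ _ => rfl), ih]
        simp [add_comm]
    have h := congrArg (fun ν : I →₀ ℕ => ν.sum fun _ a => a) hm
    simp only [Finsupp.sum_add_index' (h := fun _ a => a) (fun _ => rfl) (fun _ _ _ => rfl),
      hlen, Finsupp.sum_single_index] at h
    omega
  | zero => rw [map_zero]; exact zero_mem _
  | add x y _ _ hx hy => rw [map_add]; exact add_mem hx hy
  | smul r x _ hx => rw [map_smul]; exact Submodule.smul_mem _ _ hx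

/-- The composition of `r` with the projection `'f ⊗ 'f → f ⊗ f`. -/
def rbar : FreeF I →ₗ[Rπ] fAlg C ⊗[Rπ] fAlg C :=
  TensorProduct.map (fmk C).toLinearMap (fmk C).toLinearMap ∘ₗ rL C

/-- The maps `ᵢr` and the counit on `f`, taken together. -/
def irEps : fAlg C →ₗ[Rπ] (Option I → fAlg C) :=
  LinearMap.pi fun o => fLiftLin C
    (o.elim ((Algebra.linearMap Rπ (fAlg C)) ∘ₗ (eps I).toLinearMap)
      fun i => (fmk C).toLinearMap ∘ₗ ir C i)
    (fun x hx => by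
      cases o with
      | none =>
        have := hx 1
        rw [form_one_right] at this
        simp [this]
      | some i => exact (fmk_eq_zero C).mpr (ir_mem_rad C i hx))

theorem irEps_none (x : FreeF I) : irEps C (fmk C x) none = algebraMap Rπ (fAlg C) (eps I x) := rfl

theorem irEps_some (i : I) (x : FreeF I) : irEps C (fmk C x) (some i) = fmk C (ir C i x) := rfl

theorem irEps_injective : Function.Injective (irEps C) := by
  rw [injective_iff_map_eq_zero]
  intro x hx
  obtain ⟨x, rfl⟩ := fmk_surjective C x
  have h0 : eps I x = 0 := by
    have h := congrFun hx none
    rw [irEps_none] at h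
    have h1 : fmk C (algebraMap Rπ _ (eps I x)) = 0 := by rw [AlgHom.commutes]; exact h
    have h2 := (fmk_eq_zero C).mp h1 1
    rwa [form_one_right, AlgHom.commutes, Algebra.algebraMap_self, RingHom.id_apply] at h2
  rw [fmk_eq_zero]
  intro y
  induction y using FreeF.induction_left with
  | h1 => rw [form_one_right, h0]
  | hadd y y' h h' => rw [map_add, h, h', add_zero]
  | hsmul r y h => rw [map_smul, h, smul_zero]
  | hmul i y h =>
    have h := congrFun hx (some i)
    rw [irEps_some] at h
    rw [form_mul_right, (fmk_eq_zero C).mp h y, mul_zero]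

theorem rTensor_irEps_none (x : FreeF I) :
    LinearMap.rTensor (fAlg C) (LinearMap.proj none ∘ₗ irEps C) (rbar C x) = 1 ⊗ₜ fmk C x := by
  have key : ∀ z : FreeF I ⊗[Rπ] FreeF I,
      LinearMap.rTensor (fAlg C) (LinearMap.proj none ∘ₗ irEps C)
        (TensorProduct.map (fmk C).toLinearMap (fmk C).toLinearMap z) =
      1 ⊗ₜ fmk C (TensorProduct.lid Rπ (FreeF I)
        (LinearMap.rTensor (FreeF I) (eps I).toLinearMap z)) := by
    intro z
    induction z using TensorProduct.induction_on with
    | zero => simp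
    | add a b ha hb => simp only [map_add, ha, hb, TensorProduct.tmul_add]
    | tmul a b =>
      simp only [TensorProduct.map_tmul, LinearMap.rTensor_tmul, LinearMap.comp_apply,
        LinearMap.proj_apply, AlgHom.toLinearMap_apply, irEps_none, TensorProduct.lid_tmul,
        map_smul, Algebra.algebraMap_eq_smul_one, TensorProduct.smul_tmul]
  rw [rbar, LinearMap.comp_apply, key, counit_left]

theorem rTensor_irEps_some (i : I) (x : FreeF I) :
    LinearMap.rTensor (fAlg C) (LinearMap.proj (some i) ∘ₗ irEps C) (rbar C x) =
      rbar C (ir C i x) := by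
  have key : ∀ z : FreeF I ⊗[Rπ] FreeF I,
      LinearMap.rTensor (fAlg C) (LinearMap.proj (some i) ∘ₗ irEps C)
        (TensorProduct.map (fmk C).toLinearMap (fmk C).toLinearMap z) =
      TensorProduct.map (fmk C).toLinearMap (fmk C).toLinearMap
        (TensorProduct.map (ir C i) LinearMap.id z) := by
    intro z
    induction z using TensorProduct.induction_on with
    | zero => simp
    | add a b ha hb => simp only [map_add, ha, hb]
    | tmul a b =>
      simp only [TensorProduct.map_tmul, LinearMap.rTensor_tmul, LinearMap.comp_apply,
        LinearMap.proj_apply, AlgHom.toLinearMap_apply, irEps_some, LinearMap.id_apply]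
  rw [rbar, LinearMap.comp_apply, LinearMap.comp_apply, key, rL_ir]

/-- `r` maps the radical into the kernel of `'f ⊗ 'f → f ⊗ f`. -/
theorem rbar_eq_zero [Fintype I] {x : FreeF I} (hx : x ∈ rad C) : rbar C x = 0 := by
  obtain ⟨n, hn⟩ := exists_lenLT x
  induction n generalizing x with
  | zero =>
    have : x = 0 := by
      simpa [lenLT] using hn
    rw [this, map_zero]
  | succ n ih =>
    have := flat_of_Rpi (fAlg C)
    have hinj := Module.Flat.rTensor_preserves_injective_linearMap (M := fAlg C) (irEps C)
      (irEps_injective C)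
    apply hinj
    rw [map_zero]
    have hsum : irEps C = ∑ o : Option I, LinearMap.single Rπ (fun _ : Option I => fAlg C) o ∘ₗ
        (LinearMap.proj o ∘ₗ irEps C) := by
      ext z o
      rw [LinearMap.sum_apply, Finset.sum_apply, Finset.sum_eq_single o]
      · simp
      · intro b _ hb
        simp [hb]
      · simp
    have hsum' := congrArg (LinearMap.rTensorHom (fAlg C)) hsum
    rw [map_sum] at hsum'
    have hsum'' := LinearMap.congr_fun hsum' (rbar C x)
    rw [LinearMap.coe_rTensorHom, LinearMap.sum_apply] at hsum''
    rw [hsum'']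
    refine Finset.sum_eq_zero fun o _ => ?_
    have hcomp := LinearMap.rTensor_comp_apply (fAlg C)
      (LinearMap.single Rπ (fun _ : Option I => fAlg C) o) (LinearMap.proj o ∘ₗ irEps C) (rbar C x)
    refine hcomp.trans ?_
    have h0 : LinearMap.rTensor (fAlg C) (LinearMap.proj o ∘ₗ irEps C) (rbar C x) = 0 := by
      cases o with
      | none => rw [rTensor_irEps_none, (fmk_eq_zero C).mpr hx, TensorProduct.tmul_zero]
      | some i => rw [rTensor_irEps_some, ih (ir_mem_rad C i hx) (ir_lenLT C i hn)]
    rw [h0, map_zero]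

/-- If the algebra homomorphisms `P`, `Q` from `'f` kill the radical and satisfy suitable
commutation relations, then so does the algebra homomorphism with `θ_i ↦ P(θ_i) + Q(θ_i)`. -/
theorem sum_kill [Fintype I] {A : Type*} [Ring A] [Algebra Rπ A] (P Q : FreeF I →ₐ[Rπ] A)
    (hP : ∀ x ∈ rad C, P x = 0) (hQ : ∀ x ∈ rad C, Q x = 0)
    (hPQ : ∀ i j, Q (th i) * P (th j) = (C.chiU i j : Rπ) • (P (th j) * Q (th i)))
    (x : FreeF I) (hx : x ∈ rad C) :
    FreeAlgebra.lift Rπ (fun i => P (th i) + Q (th i)) x = 0 := by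
  have hcomm : ∀ (i : I) (y : FreeF I), P (tw C i y) * Q (th i) = Q (th i) * P y := by
    intro i y
    induction y using FreeF.induction_left with
    | h1 => rw [tw_one, map_one, one_mul, mul_one]
    | hadd y y' h h' => rw [map_add, map_add, map_add, add_mul, mul_add, h, h']
    | hsmul r y h => rw [map_smul, map_smul, map_smul, smul_mul_assoc, mul_smul_comm, h]
    | hmul j y h =>
      rw [tw_mul, map_smul, map_mul, map_mul, smul_mul_assoc, mul_assoc, h, ← mul_assoc,
        ← mul_assoc, ← smul_mul_assoc, hPQ]
  let μ : FreeF I ⊗[Rπ] FreeF I →ₗ[Rπ] A :=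
    LinearMap.mul' Rπ A ∘ₗ TensorProduct.map P.toLinearMap Q.toLinearMap
  have h1 : ∀ y, FreeAlgebra.lift Rπ (fun i => P (th i) + Q (th i)) y = μ (rL C y) := by
    intro y
    induction y using FreeF.induction_left with
    | h1 => simp [rL_one, μ]
    | hadd y y' h h' => simp only [map_add, h, h']
    | hsmul r y h => simp only [map_smul, h]
    | hmul j y h =>
      have key : ∀ z : FreeF I ⊗[Rπ] FreeF I, μ
          (TensorProduct.map (LinearMap.mulLeft Rπ (th j)) LinearMap.id z +
            TensorProduct.map (tw C j) (LinearMap.mulLeft Rπ (th j)) z) =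
          (P (th j) + Q (th j)) * μ z := by
        intro z
        induction z using TensorProduct.induction_on with
        | zero => simp
        | add a b ha hb => simp only [map_add, mul_add] at *; rw [← ha, ← hb]; abel
        | tmul a b =>
          simp only [μ, map_add, TensorProduct.map_tmul, LinearMap.comp_apply,
            LinearMap.mul'_apply, AlgHom.toLinearMap_apply, LinearMap.mulLeft_apply,
            LinearMap.id_apply, map_mul]
          rw [← mul_assoc (P (tw C j a)), hcomm]
          noncomm_ring
      rw [rL_mul, key, map_mul, FreeAlgebra.lift_ι_apply, h]
  have h2 : μ = (LinearMap.mul' Rπ A ∘ₗ TensorProduct.map (fLift C P hP).toLinearMap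
      (fLift C Q hQ).toLinearMap) ∘ₗ
      TensorProduct.map (fmk C).toLinearMap (fmk C).toLinearMap := by
    ext a b; rfl
  rw [h1, h2, LinearMap.comp_apply]
  have := rbar_eq_zero C hx
  rw [rbar, LinearMap.comp_apply] at this
  rw [this, map_zero]

end


/-! ## Root data and the algebra `U` -/

/-- A root datum of type `C`: finitely generated free abelian groups `Y` and `X`, a perfect pairing
between them, and linearly independent families `i ∈ Y` (`coroot`) and `i' ∈ X` (`root`) with
`⟨i, j'⟩ = 2 (i · j) / (i · i)`. -/
structure RootDatum {I : Type*} (C : SuperCartanDatum I) (Y X : Type*) [AddCommGroup Y]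
    [AddCommGroup X] where
  free_Y : Module.Free ℤ Y
  finite_Y : Module.Finite ℤ Y
  free_X : Module.Free ℤ X
  finite_X : Module.Finite ℤ X
  pairing : Y →ₗ[ℤ] X →ₗ[ℤ] ℤ
  perfect : pairing.IsPerfPair
  coroot : I → Y
  root : I → X
  pairing_coroot_root : ∀ i j, pairing (coroot i) (root j) * C.dot i i = 2 * C.dot i j
  coroot_linearIndependent : LinearIndependent ℤ coroot
  root_linearIndependent : LinearIndependent ℤ root

/-- The generators of `U`. -/
inductive Gen (I Y : Type*)
  | E (i : I)
  | F (i : I)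
  | J (μ : Y)
  | K (μ : Y)

section

variable {I : Type*} [DecidableEq I] {C : SuperCartanDatum I} {Y X : Type*} [AddCommGroup Y]
  [AddCommGroup X] (D : RootDatum C Y X)

theorem RootDatum.d_mul_pairing (i j : I) :
    D.pairing (C.d i • D.coroot i) (D.root j) = C.dot i j := by
  have h1 := D.pairing_coroot_root i j
  rw [← C.two_mul_d] at h1
  rw [map_smul, LinearMap.smul_apply, smul_eq_mul]
  linarith

/-- The free algebra on the generators of `U`. -/
abbrev UFree (I Y : Type*) : Type _ := FreeAlgebra Rπ (Gen I Y)

/-- A generator, as an element of the free algebra. -/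
abbrev gen {I Y : Type*} (g : Gen I Y) : UFree I Y := FreeAlgebra.ι Rπ g

/-- The homomorphism from `'f` to the free algebra with `θ_i ↦ E_i`. -/
def substE (I Y : Type*) : FreeF I →ₐ[Rπ] UFree I Y := FreeAlgebra.lift Rπ fun i => gen (Gen.E i)

/-- The homomorphism from `'f` to the free algebra with `θ_i ↦ F_i`. -/
def substF (I Y : Type*) : FreeF I →ₐ[Rπ] UFree I Y := FreeAlgebra.lift Rπ fun i => gen (Gen.F i)

/-- The defining relations of `U`. -/
inductive URel : UFree I Y → UFree I Y → Prop
  | K_zero : URel (gen (.K 0)) 1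
  | K_add (μ μ' : Y) : URel (gen (.K μ) * gen (.K μ')) (gen (.K (μ + μ')))
  | J_two (μ : Y) : URel (gen (.J (2 • μ))) 1
  | J_add (μ μ' : Y) : URel (gen (.J μ) * gen (.J μ')) (gen (.J (μ + μ')))
  | J_K (μ μ' : Y) : URel (gen (.J μ) * gen (.K μ')) (gen (.K μ') * gen (.J μ))
  | K_E (μ : Y) (i : I) : URel (gen (.K μ) * gen (.E i))
      (((qq ^ D.pairing μ (D.root i) : Rπˣ) : Rπ) • (gen (.E i) * gen (.K μ)))
  | J_E (μ : Y) (i : I) : URel (gen (.J μ) * gen (.E i))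
      (((piU ^ D.pairing μ (D.root i) : Rπˣ) : Rπ) • (gen (.E i) * gen (.J μ)))
  | K_F (μ : Y) (i : I) : URel (gen (.K μ) * gen (.F i))
      (((qq ^ (-D.pairing μ (D.root i)) : Rπˣ) : Rπ) • (gen (.F i) * gen (.K μ)))
  | J_F (μ : Y) (i : I) : URel (gen (.J μ) * gen (.F i))
      (((piU ^ (-D.pairing μ (D.root i)) : Rπˣ) : Rπ) • (gen (.F i) * gen (.J μ)))
  | E_F (i j : I) : URel
      (gen (.E i) * gen (.F j) - ppi ^ (C.p i * C.p j) • (gen (.F j) * gen (.E i)))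
      (if i = j then C.invDen i • (gen (.J (C.d i • D.coroot i)) * gen (.K (C.d i • D.coroot i)) -
        gen (.K (-(C.d i • D.coroot i)))) else 0)
  | rad_E (x : FreeF I) (hx : x ∈ rad C) : URel (substE I Y x) 0
  | rad_F (x : FreeF I) (hx : x ∈ rad C) : URel (substF I Y x) 0

/-- The quantum covering group `U`. -/
def UAlg : Type _ := RingQuot (URel D)

instance : Ring (UAlg D) := inferInstanceAs (Ring (RingQuot (URel D)))
instance : Algebra Rπ (UAlg D) := inferInstanceAs (Algebra Rπ (RingQuot (URel D)))

/-- The projection from the free algebra onto `U`. -/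
def uMk : UFree I Y →ₐ[Rπ] UAlg D := RingQuot.mkAlgHom Rπ (URel D)

theorem uMk_surjective : Function.Surjective (uMk D) := RingQuot.mkAlgHom_surjective Rπ (URel D)

theorem uMk_rel {a b : UFree I Y} (h : URel D a b) : uMk D a = uMk D b :=
  RingQuot.mkAlgHom_rel Rπ h

/-- The universal property of `U`. -/
def uLift {A : Type*} [Semiring A] [Algebra Rπ A] (g : UFree I Y →ₐ[Rπ] A)
    (hg : ∀ a b, URel D a b → g a = g b) : UAlg D →ₐ[Rπ] A :=
  RingQuot.liftAlgHom Rπ ⟨g, fun {a b} => hg a b⟩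

@[simp] theorem uLift_uMk {A : Type*} [Semiring A] [Algebra Rπ A] (g : UFree I Y →ₐ[Rπ] A)
    (hg : ∀ a b, URel D a b → g a = g b) (x : UFree I Y) : uLift D g hg (uMk D x) = g x :=
  RingQuot.liftAlgHom_mkAlgHom_apply Rπ g (fun {a b} => hg a b) x

/-- The generator `E_i` of `U`. -/
def uE (i : I) : UAlg D := uMk D (gen (.E i))
/-- The generator `F_i` of `U`. -/
def uF (i : I) : UAlg D := uMk D (gen (.F i))
/-- The generator `J_μ` of `U`. -/
def uJ (μ : Y) : UAlg D := uMk D (gen (.J μ))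
/-- The generator `K_μ` of `U`. -/
def uK (μ : Y) : UAlg D := uMk D (gen (.K μ))

theorem uK_zero : uK D 0 = 1 := (uMk_rel D .K_zero).trans (map_one _)

theorem uK_add (μ μ' : Y) : uK D (μ + μ') = uK D μ * uK D μ' :=
  ((map_mul (uMk D) _ _).symm.trans (uMk_rel D (.K_add μ μ'))).symm

theorem uJ_two (μ : Y) : uJ D (2 • μ) = 1 := (uMk_rel D (.J_two μ)).trans (map_one _)

theorem uJ_add (μ μ' : Y) : uJ D (μ + μ') = uJ D μ * uJ D μ' :=
  ((map_mul (uMk D) _ _).symm.trans (uMk_rel D (.J_add μ μ'))).symm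

theorem uJ_zero : uJ D 0 = 1 := by simpa using uJ_two D 0

theorem uJ_uK (μ μ' : Y) : uJ D μ * uK D μ' = uK D μ' * uJ D μ := by
  simpa [uJ, uK] using uMk_rel D (.J_K μ μ')

theorem uK_uE (μ : Y) (i : I) : uK D μ * uE D i =
    ((qq ^ D.pairing μ (D.root i) : Rπˣ) : Rπ) • (uE D i * uK D μ) := by
  simpa only [uK, uE, map_mul, map_smul] using uMk_rel D (.K_E μ i)

theorem uJ_uE (μ : Y) (i : I) : uJ D μ * uE D i =
    ((piU ^ D.pairing μ (D.root i) : Rπˣ) : Rπ) • (uE D i * uJ D μ) := by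
  simpa only [uJ, uE, map_mul, map_smul] using uMk_rel D (.J_E μ i)

theorem uK_uF (μ : Y) (i : I) : uK D μ * uF D i =
    ((qq ^ (-D.pairing μ (D.root i)) : Rπˣ) : Rπ) • (uF D i * uK D μ) := by
  simpa only [uK, uF, map_mul, map_smul] using uMk_rel D (.K_F μ i)

theorem uJ_uF (μ : Y) (i : I) : uJ D μ * uF D i =
    ((piU ^ (-D.pairing μ (D.root i)) : Rπˣ) : Rπ) • (uF D i * uJ D μ) := by
  simpa only [uJ, uF, map_mul, map_smul] using uMk_rel D (.J_F μ i)

theorem uE_uF (i j : I) : uE D i * uF D j - ppi ^ (C.p i * C.p j) • (uF D j * uE D i) =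
    if i = j then C.invDen i • (uJ D (C.d i • D.coroot i) * uK D (C.d i • D.coroot i) -
      uK D (-(C.d i • D.coroot i))) else 0 := by
  have h := uMk_rel D (.E_F i j)
  rw [map_sub, map_mul, map_smul, map_mul] at h
  refine h.trans ?_
  split_ifs
  · simp only [map_smul, map_sub, map_mul]; rfl
  · exact map_zero _

/-- The homomorphism `'f → U` with `θ_i ↦ E_i`. -/
def plusF : FreeF I →ₐ[Rπ] UAlg D := (uMk D).comp (substE I Y)

/-- The homomorphism `'f → U` with `θ_i ↦ F_i`. -/
def minusF : FreeF I →ₐ[Rπ] UAlg D := (uMk D).comp (substF I Y)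

theorem plusF_rad (x : FreeF I) (hx : x ∈ rad C) : plusF D x = 0 :=
  (uMk_rel D (.rad_E x hx)).trans (map_zero _)

theorem minusF_rad (x : FreeF I) (hx : x ∈ rad C) : minusF D x = 0 :=
  (uMk_rel D (.rad_F x hx)).trans (map_zero _)

@[simp] theorem plusF_th (i : I) : plusF D (th i) = uE D i := by
  simp [plusF, substE, uE]

@[simp] theorem minusF_th (i : I) : minusF D (th i) = uF D i := by
  simp [minusF, substF, uF]

/-- The homomorphism `f → U`, `x ↦ x⁺`. -/
def plus : fAlg C →ₐ[Rπ] UAlg D := fLift C (plusF D) (plusF_rad D)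

/-- The homomorphism `f → U`, `x ↦ x⁻`. -/
def minus : fAlg C →ₐ[Rπ] UAlg D := fLift C (minusF D) (minusF_rad D)

/-! ### The parity grading of `U` -/

/-- The parity of a generator of `U`. -/
def gpar (C : SuperCartanDatum I) : Gen I Y → ZMod 2
  | .E i => C.p i
  | .F i => C.p i
  | .J _ => 0
  | .K _ => 0

/-- The subspace of `U` of elements of parity `γ`, spanned by the words of parity `γ`. -/
def upar (γ : ZMod 2) : Submodule Rπ (UAlg D) :=
  wordGr Rπ (fun g : Gen I Y => uMk D (gen g)) (gpar C) γ

/-- The parity grading of the free algebra on the generators of `U`. -/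
abbrev ufpar (Y : Type*) (C : SuperCartanDatum I) (γ : ZMod 2) : Submodule Rπ (UFree I Y) :=
  wordGr Rπ (fun g : Gen I Y => gen g) (gpar C) γ

theorem uMk_mem {γ : ZMod 2} {y : UFree I Y} (hy : y ∈ ufpar Y C γ) : uMk D y ∈ upar D γ := by
  induction hy using Submodule.span_induction with
  | mem y hy =>
    obtain ⟨l, rfl, rfl⟩ := hy
    rw [map_list_prod, List.map_map]
    exact word_mem_wordGr (fun g : Gen I Y => uMk D (gen g)) (gpar C) l
  | zero => rw [map_zero]; exact zero_mem _
  | add x y _ _ hx hy => rw [map_add]; exact add_mem hx hy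
  | smul r x _ hx => rw [map_smul]; exact Submodule.smul_mem _ _ hx

instance : SetLike.GradedMonoid (upar D) :=
  wordGr_gradedMonoid (fun g : Gen I Y => uMk D (gen g)) (gpar C)

/-- The decomposition of elements of the free algebra into homogeneous components in `U`. -/
def uDecFree : UFree I Y →ₐ[Rπ] ⨁ γ, upar D γ :=
  FreeAlgebra.lift Rπ fun g => DirectSum.of (fun γ => upar D γ) (gpar C g)
    ⟨uMk D (gen g), gen_mem_wordGr (fun g : Gen I Y => uMk D (gen g)) (gpar C) g⟩

theorem uDecFree_of_mem {γ : ZMod 2} {y : UFree I Y} (hy : y ∈ ufpar Y C γ) :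
    uDecFree D y = DirectSum.of (fun γ => upar D γ) γ ⟨uMk D y, uMk_mem D hy⟩ := by
  induction hy using Submodule.span_induction with
  | mem y hy =>
    obtain ⟨l, rfl, rfl⟩ := hy
    induction l with
    | nil =>
      simp only [List.map_nil, List.prod_nil, map_one]; rfl
    | cons g l ih =>
      simp only [List.map_cons, List.prod_cons, map_mul]
      rw [ih, uDecFree, FreeAlgebra.lift_ι_apply, DirectSum.of_mul_of]
      rfl
  | zero =>
    rw [map_zero]
    have : (⟨uMk D 0, uMk_mem D (zero_mem (ufpar Y C γ))⟩ : upar D γ) = 0 :=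
      Subtype.ext (map_zero _)
    rw [this, map_zero]
  | add x y hx hy h h' =>
    rw [map_add, h, h', ← map_add]
    congr 1
    exact Subtype.ext (map_add (uMk D) x y).symm
  | smul r x hx h =>
    rw [map_smul, h]
    refine ((DirectSum.lof Rπ (ZMod 2) (fun γ => upar D γ) γ).map_smul r _).symm.trans ?_
    exact congrArg (DirectSum.of (fun γ => upar D γ) γ) (Subtype.ext (map_smul (uMk D) r x).symm)

theorem uDecFree_eq {γ : ZMod 2} {y z : UFree I Y} (hy : y ∈ ufpar Y C γ) (hz : z ∈ ufpar Y C γ)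
    (h : uMk D y = uMk D z) : uDecFree D y = uDecFree D z := by
  rw [uDecFree_of_mem D hy, uDecFree_of_mem D hz]
  congr 1
  exact Subtype.ext h

theorem gen_mem_ufpar (g : Gen I Y) : gen g ∈ ufpar Y C (gpar C g) :=
  gen_mem_wordGr (fun g : Gen I Y => gen g) (gpar C) g

theorem mul_mem_ufpar {γ δ : ZMod 2} {a b : UFree I Y} (ha : a ∈ ufpar Y C γ)
    (hb : b ∈ ufpar Y C δ) : a * b ∈ ufpar Y C (γ + δ) := SetLike.mul_mem_graded ha hb

theorem gen_mul_gen_mem (g g' : Gen I Y) : gen g * gen g' ∈ ufpar Y C (gpar C g + gpar C g') :=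
  mul_mem_ufpar (gen_mem_ufpar g) (gen_mem_ufpar g')

theorem one_mem_ufpar : (1 : UFree I Y) ∈ ufpar Y C 0 := SetLike.GradedOne.one_mem

theorem subst_mem (x : I → Gen I Y) (hx : ∀ i, gpar C (x i) = C.p i) {ν : I →₀ ℕ} {y : FreeF I}
    (hy : y ∈ fwt I ν) :
    FreeAlgebra.lift Rπ (fun i => gen (x i)) y ∈ ufpar Y C (C.pw ν : ZMod 2) := by
  induction hy using Submodule.span_induction with
  | mem y hy =>
    obtain ⟨l, rfl, rfl⟩ := hy
    induction l with
    | nil =>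
      simpa [C.pw_zero] using (one_mem_ufpar (C := C) : (1 : UFree I Y) ∈ _)
    | cons i l ih =>
      rw [List.map_cons, List.map_cons, List.prod_cons, map_mul, FreeAlgebra.lift_ι_apply,
        List.sum_cons, C.pw_add, C.pw_single, Nat.cast_add, ← hx i]
      exact mul_mem_ufpar (gen_mem_ufpar _) ih
  | zero => rw [map_zero]; exact zero_mem _
  | add x y _ _ hx hy => rw [map_add]; exact add_mem hx hy
  | smul r x _ hx => rw [map_smul]; exact Submodule.smul_mem _ _ hx

theorem zmod2_add_self (a : ZMod 2) : a + a = 0 := CharTwo.add_self_eq_zero a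

theorem uDecFree_rel (a b : UFree I Y) (h : URel D a b) : uDecFree D a = uDecFree D b := by
  have hrel := uMk_rel D h
  cases h with
  | K_zero => exact uDecFree_eq D (gen_mem_ufpar (.K 0)) one_mem_ufpar hrel
  | K_add μ μ' =>
    exact uDecFree_eq D (gen_mul_gen_mem (.K μ) (.K μ')) (gen_mem_ufpar (.K (μ + μ'))) hrel
  | J_two μ => exact uDecFree_eq D (gen_mem_ufpar (.J (2 • μ))) one_mem_ufpar hrel
  | J_add μ μ' =>
    exact uDecFree_eq D (gen_mul_gen_mem (.J μ) (.J μ')) (gen_mem_ufpar (.J (μ + μ'))) hrel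
  | J_K μ μ' =>
    exact uDecFree_eq D (gen_mul_gen_mem (.J μ) (.K μ')) (gen_mul_gen_mem (.K μ') (.J μ)) hrel
  | K_E μ i =>
    refine uDecFree_eq D (gen_mul_gen_mem (.K μ) (.E i)) (Submodule.smul_mem _ _ ?_) hrel
    rw [add_comm]; exact gen_mul_gen_mem (.E i) (.K μ)
  | J_E μ i =>
    refine uDecFree_eq D (gen_mul_gen_mem (.J μ) (.E i)) (Submodule.smul_mem _ _ ?_) hrel
    rw [add_comm]; exact gen_mul_gen_mem (.E i) (.J μ)
  | K_F μ i =>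
    refine uDecFree_eq D (gen_mul_gen_mem (.K μ) (.F i)) (Submodule.smul_mem _ _ ?_) hrel
    rw [add_comm]; exact gen_mul_gen_mem (.F i) (.K μ)
  | J_F μ i =>
    refine uDecFree_eq D (gen_mul_gen_mem (.J μ) (.F i)) (Submodule.smul_mem _ _ ?_) hrel
    rw [add_comm]; exact gen_mul_gen_mem (.F i) (.J μ)
  | E_F i j =>
    refine uDecFree_eq D (sub_mem (gen_mul_gen_mem (.E i) (.F j)) (Submodule.smul_mem _ _ ?_)) ?_
      hrel
    · rw [add_comm]; exact gen_mul_gen_mem (.F j) (.E i)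
    · split_ifs with hij
      · subst hij
        have h0 : gpar C (Gen.E i : Gen I Y) + gpar C (Gen.F i : Gen I Y) = 0 := zmod2_add_self _
        rw [h0]
        exact Submodule.smul_mem _ _ (sub_mem (gen_mul_gen_mem (.J _) (.K _))
          (gen_mem_ufpar (.K _)))
      · exact zero_mem _
  | rad_E x hx =>
    rw [map_zero]
    refine rad_kill C ((uDecFree D).comp (substE I Y)).toAddMonoidHom (fun ν y hy hy' => ?_) x hx
    have := uDecFree_eq D (subst_mem (C := C) (fun i => (Gen.E i : Gen I Y)) (fun _ => rfl) hy)
      (zero_mem _) (uMk_rel D (.rad_E y hy'))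
    rw [map_zero] at this
    exact this
  | rad_F x hx =>
    rw [map_zero]
    refine rad_kill C ((uDecFree D).comp (substF I Y)).toAddMonoidHom (fun ν y hy hy' => ?_) x hx
    have := uDecFree_eq D (subst_mem (C := C) (fun i => (Gen.F i : Gen I Y)) (fun _ => rfl) hy)
      (zero_mem _) (uMk_rel D (.rad_F y hy'))
    rw [map_zero] at this
    exact this

theorem uGen_adjoin : Algebra.adjoin Rπ (Set.range fun g : Gen I Y => uMk D (gen g)) = ⊤ := by
  have h := congrArg (Subalgebra.map (uMk D)) (FreeAlgebra.adjoin_range_ι Rπ (Gen I Y))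
  rw [AlgHom.map_adjoin, Algebra.map_top, (AlgHom.range_eq_top _).mpr (uMk_surjective D)] at h
  rw [← h, ← Set.range_comp]
  rfl

instance : GradedAlgebra (upar D) :=
  wordGr_gradedAlgebra _ _ (uGen_adjoin D) (uLift D (uDecFree D) (uDecFree_rel D))
    (fun g => by
      refine (uLift_uMk D (uDecFree D) (uDecFree_rel D) (gen g)).trans ?_
      exact FreeAlgebra.lift_ι_apply _ _)

theorem ppi_pow_congr {m n : ℕ} (h : m % 2 = n % 2) : ppi ^ m = ppi ^ n := by
  rw [← Nat.div_add_mod m 2, ← Nat.div_add_mod n 2, h, pow_add, pow_add, pow_mul, pow_mul, pow_two,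
    ppi_sq, one_pow, one_pow]

/-- The bicharacter `(a, b) ↦ π^{ab}` on `ℤ/2`. -/
def parChi : Bichar (ZMod 2) Rπ where
  toFun a b := ppi ^ (a.val * b.val)
  zero_left b := by simp
  zero_right a := by simp
  add_left a b c := by
    rw [← pow_add]
    exact ppi_pow_congr (by revert a b c; decide)
  add_right a b c := by
    rw [← pow_add]
    exact ppi_pow_congr (by revert a b c; decide)

/-- The superalgebra `U ⊗ U`, with multiplication
`(a ⊗ b)(c ⊗ d) = π^{p(b) p(c)} ac ⊗ bd`. -/
abbrev UU : Type _ := TwistedTensor parChi (upar D)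

/-- The element `a ⊗ b` of `U ⊗ U`. -/
abbrev tU (a b : UAlg D) : UU D := tt parChi (upar D) a b

theorem uE_mem (i : I) : uE D i ∈ upar D (C.p i) := uMk_mem D (gen_mem_ufpar (.E i))
theorem uF_mem (i : I) : uF D i ∈ upar D (C.p i) := uMk_mem D (gen_mem_ufpar (.F i))
theorem uJ_mem (μ : Y) : uJ D μ ∈ upar D 0 := uMk_mem D (gen_mem_ufpar (.J μ))
theorem uK_mem (μ : Y) : uK D μ ∈ upar D 0 := uMk_mem D (gen_mem_ufpar (.K μ))
theorem uOne_mem : (1 : UAlg D) ∈ upar D 0 := SetLike.GradedOne.one_mem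
theorem uJK_mem (μ μ' : Y) : uJ D μ * uK D μ' ∈ upar D 0 := by
  simpa using SetLike.mul_mem_graded (uJ_mem D μ) (uK_mem D μ')

theorem parChi_natCast (i j : I) : parChi.toFun (C.p i : ZMod 2) (C.p j : ZMod 2) =
    ppi ^ (C.p i * C.p j) := by
  have hi := C.p_le_one i
  have hj := C.p_le_one j
  simp only [parChi, ZMod.val_natCast]
  rw [Nat.mod_eq_of_lt (by omega), Nat.mod_eq_of_lt (by omega)]

end


section

variable {I : Type*} [DecidableEq I] {C : SuperCartanDatum I} {Y X : Type*} [AddCommGroup Y]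
  [AddCommGroup X] (D : RootDatum C Y X)

/-! ### The comultiplication of `U` -/

theorem sum_single_add (y : I → Y) (i : I) (ν : I →₀ ℕ) :
    ((Finsupp.single i 1 + ν).sum fun i a => a • y i) = y i + ν.sum fun i a => a • y i := by
  rw [Finsupp.sum_add_index' (h := fun i a => a • y i) (fun _ => zero_smul ℕ _)
    (fun _ _ _ => add_smul _ _ _), Finsupp.sum_single_index (h := fun i a => a • y i) (zero_smul ℕ (y i)), one_smul]

theorem tU_zero_left (b : UAlg D) : tU D 0 b = 0 := tt_zero_left parChi (upar D) b
theorem tU_zero_right (a : UAlg D) : tU D a 0 = 0 := tt_zero_right parChi (upar D) a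
theorem tU_add_left (a a' b : UAlg D) : tU D (a + a') b = tU D a b + tU D a' b :=
  tt_add_left parChi (upar D) a a' b
theorem tU_add_right (a b b' : UAlg D) : tU D a (b + b') = tU D a b + tU D a b' :=
  tt_add_right parChi (upar D) a b b'
theorem tU_sub_left (a a' b : UAlg D) : tU D (a - a') b = tU D a b - tU D a' b :=
  tt_sub_left parChi (upar D) a a' b
theorem tU_sub_right (a b b' : UAlg D) : tU D a (b - b') = tU D a b - tU D a b' :=
  tt_sub_right parChi (upar D) a b b'
theorem tU_smul_left (r : Rπ) (a b : UAlg D) : tU D (r • a) b = r • tU D a b :=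
  tt_smul_left parChi (upar D) r a b
theorem tU_smul_right (r : Rπ) (a b : UAlg D) : tU D a (r • b) = r • tU D a b :=
  tt_smul_right parChi (upar D) r a b

theorem tU_mul_left {b : UAlg D} (hb : b ∈ upar D 0) (a c d : UAlg D) :
    tU D a b * tU D c d = tU D (a * c) (b * d) := by
  refine DirectSum.Decomposition.inductionOn (upar D) (motive := fun c =>
    tU D a b * tU D c d = tU D (a * c) (b * d)) ?_ ?_ ?_ c
  · rw [tU_zero_left D, mul_zero, mul_zero, tU_zero_left D]
  · intro γ c
    rw [tt_mul_tt parChi (upar D) a d hb c.2, parChi.zero_left, one_smul]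
  · intro c c' h h'
    rw [tU_add_left D, mul_add, h, h', mul_add, tU_add_left D]

theorem tU_mul_right {c : UAlg D} (hc : c ∈ upar D 0) (a b d : UAlg D) :
    tU D a b * tU D c d = tU D (a * c) (b * d) := by
  refine DirectSum.Decomposition.inductionOn (upar D) (motive := fun b =>
    tU D a b * tU D c d = tU D (a * c) (b * d)) ?_ ?_ ?_ b
  · rw [tU_zero_right D, zero_mul, zero_mul, tU_zero_right D]
  · intro γ b
    rw [tt_mul_tt parChi (upar D) a d b.2 hc, parChi.zero_right, one_smul]
  · intro c c' h h'
    rw [tU_add_right D, add_mul, h, h', add_mul, tU_add_right D]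

theorem tU_mul_p {i j : I} {b c : UAlg D} (hb : b ∈ upar D (C.p i)) (hc : c ∈ upar D (C.p j))
    (a d : UAlg D) : tU D a b * tU D c d = ppi ^ (C.p i * C.p j) • tU D (a * c) (b * d) := by
  rw [tt_mul_tt parChi (upar D) a d hb hc, parChi_natCast]

/-- `J̃_i K̃_i = J_{d_i i} K_{d_i i}`. -/
def uJKt (i : I) : UAlg D := uJ D (C.d i • D.coroot i) * uK D (C.d i • D.coroot i)

/-- `K̃_{-i} = K_{- d_i i}`. -/
def uKtn (i : I) : UAlg D := uK D (-(C.d i • D.coroot i))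

theorem uJKt_mem (i : I) : uJKt D i ∈ upar D 0 := uJK_mem D _ _
theorem uKtn_mem (i : I) : uKtn D i ∈ upar D 0 := uK_mem D _

theorem uJKt_uE [hC : C.Consistent] (i j : I) :
    uJKt D i * uE D j = ((qq ^ C.dot i j : Rπˣ) : Rπ) • (uE D j * uJKt D i) := by
  rw [uJKt, mul_assoc, uK_uE, mul_smul_comm, ← mul_assoc, uJ_uE, smul_mul_assoc, mul_assoc,
    D.d_mul_pairing, piU_zpow_even (C.even_dot i j), Units.val_one, one_smul]

theorem uJKt_uF [hC : C.Consistent] (i j : I) :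
    uJKt D i * uF D j = ((qq ^ (-C.dot i j) : Rπˣ) : Rπ) • (uF D j * uJKt D i) := by
  rw [uJKt, mul_assoc, uK_uF, mul_smul_comm, ← mul_assoc, uJ_uF, smul_mul_assoc, mul_assoc,
    D.d_mul_pairing, piU_zpow_even (C.even_dot i j).neg, Units.val_one, one_smul]

theorem uKtn_uE (i j : I) :
    uKtn D i * uE D j = ((qq ^ (-C.dot i j) : Rπˣ) : Rπ) • (uE D j * uKtn D i) := by
  rw [uKtn, uK_uE, map_neg, LinearMap.neg_apply, D.d_mul_pairing]

theorem uKtn_uF (i j : I) :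
    uKtn D i * uF D j = ((qq ^ C.dot i j : Rπˣ) : Rπ) • (uF D j * uKtn D i) := by
  rw [uKtn, uK_uF, map_neg, LinearMap.neg_apply, D.d_mul_pairing, neg_neg]

theorem uE_uF' (i j : I) : uE D i * uF D j - ppi ^ (C.p i * C.p j) • (uF D j * uE D i) =
    if i = j then C.invDen i • (uJKt D i - uKtn D i) else 0 := uE_uF D i j

/-- The values of the comultiplication on the generators. -/
def deltaGen : Gen I Y → UU D
  | .E i => tU D (uE D i) 1 + tU D (uJKt D i) (uE D i)
  | .F i => tU D (uF D i) (uKtn D i) + tU D 1 (uF D i)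
  | .J μ => tU D (uJ D μ) (uJ D μ)
  | .K μ => tU D (uK D μ) (uK D μ)

/-- The comultiplication, on the free algebra. -/
def deltaFree : UFree I Y →ₐ[Rπ] UU D := FreeAlgebra.lift Rπ (deltaGen D)

@[simp] theorem deltaFree_gen (g : Gen I Y) : deltaFree D (gen g) = deltaGen D g :=
  FreeAlgebra.lift_ι_apply _ _

theorem deltaGen_E_F [C.Consistent] (i j : I) :
    deltaGen D (.E i) * deltaGen D (.F j) -
      ppi ^ (C.p i * C.p j) • (deltaGen D (.F j) * deltaGen D (.E i)) =
    tU D (uE D i * uF D j - ppi ^ (C.p i * C.p j) • (uF D j * uE D i)) (uKtn D j) +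
      tU D (uJKt D i) (uE D i * uF D j - ppi ^ (C.p i * C.p j) • (uF D j * uE D i)) := by
  have e1 : deltaGen D (.E i) * deltaGen D (.F j) =
      tU D (uE D i * uF D j) (uKtn D j) + tU D (uE D i) (uF D j) +
      (ppi ^ (C.p i * C.p j) • tU D (uJKt D i * uF D j) (uE D i * uKtn D j) +
      tU D (uJKt D i) (uE D i * uF D j)) := by
    rw [deltaGen, deltaGen, add_mul, mul_add, mul_add, tU_mul_left D (uOne_mem D),
      tU_mul_left D (uOne_mem D), tU_mul_p D (uE_mem D i) (uF_mem D j),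
      tU_mul_right D (uOne_mem D), one_mul, one_mul, mul_one, mul_one]
  have e2 : deltaGen D (.F j) * deltaGen D (.E i) =
      tU D (uF D j * uE D i) (uKtn D j) + tU D (uF D j * uJKt D i) (uKtn D j * uE D i) +
      (ppi ^ (C.p i * C.p j) • tU D (uE D i) (uF D j) +
      tU D (uJKt D i) (uF D j * uE D i)) := by
    rw [deltaGen, deltaGen, add_mul, mul_add, mul_add, tU_mul_left D (uKtn_mem D j),
      tU_mul_left D (uKtn_mem D j), tU_mul_p D (uF_mem D j) (uE_mem D i),
      tU_mul_right D (uJKt_mem D i), one_mul, one_mul, mul_one, mul_one, mul_comm (C.p j)]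
  rw [e1, e2, uJKt_uF, uKtn_uE, C.dot_comm j i, tU_smul_left D, tU_smul_right D, tU_sub_left D,
    tU_sub_right D, tU_smul_left D, tU_smul_right D]
  have hs : ppi ^ (C.p i * C.p j) * ppi ^ (C.p i * C.p j) = 1 := ppi_pow_mul_self _
  linear_combination (norm := module) (-hs) • tU D (uE D i) (uF D j)

theorem delta_E_rad [C.Consistent] [Fintype I] (x : FreeF I) (hx : x ∈ rad C) :
    deltaFree D (substE I Y x) = 0 := by
  let P : FreeF I →ₐ[Rπ] UU D := FreeAlgebra.lift Rπ fun i => tU D (uE D i) 1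
  let Q : FreeF I →ₐ[Rπ] UU D := FreeAlgebra.lift Rπ fun i => tU D (uJKt D i) (uE D i)
  have hP : ∀ y, P y = tU D (plusF D y) 1 := by
    intro y
    induction y using FreeF.induction_left with
    | h1 => rw [map_one, map_one]; rfl
    | hadd y y' h h' => rw [map_add, h, h', map_add, tU_add_left D]
    | hsmul r y h => rw [map_smul, h, map_smul, tU_smul_left D]
    | hmul i y h =>
      rw [map_mul, h, map_mul, plusF_th, FreeAlgebra.lift_ι_apply,
        tU_mul_left D (uOne_mem D), one_mul]
  have hQ : ∀ (ν : I →₀ ℕ), ∃ k : UAlg D, ∀ y ∈ fwt I ν, Q y = tU D k (plusF D y) := by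
    intro ν
    refine ⟨uJ D (ν.sum fun i a => a • C.d i • D.coroot i) *
      uK D (ν.sum fun i a => a • C.d i • D.coroot i), fun y hy => ?_⟩
    induction hy using Submodule.span_induction with
    | mem y hy =>
      obtain ⟨l, rfl, rfl⟩ := hy
      induction l with
      | nil => simp [uJ_zero, uK_zero]; rfl
      | cons i l ih =>
        rw [List.map_cons, List.map_cons, List.prod_cons, map_mul, map_mul, List.sum_cons, ih,
          plusF_th, FreeAlgebra.lift_ι_apply, tU_mul_right D (uJK_mem D _ _), uJKt,
          sum_single_add, uJ_add, uK_add]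
        congr 1
        rw [mul_assoc, mul_assoc, ← mul_assoc (uK D _) (uJ D _), ← uJ_uK, mul_assoc]
    | zero => rw [map_zero, map_zero, tU_zero_right D]
    | add y y' _ _ h h' => rw [map_add, h, h', map_add, tU_add_right D]
    | smul r y _ h => rw [map_smul, h, map_smul, tU_smul_right D]
  have key := sum_kill C P Q (fun y hy => by rw [hP, plusF_rad D y hy, tU_zero_left D])
    (rad_kill C Q.toLinearMap.toAddMonoidHom fun ν y hy hy' => by
      obtain ⟨k, hk⟩ := hQ ν
      refine (hk y hy).trans ?_
      rw [plusF_rad D y hy', tU_zero_right D])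
    (fun i j => by
      simp only [P, Q, FreeAlgebra.lift_ι_apply]
      rw [tU_mul_p D (uE_mem D i) (uE_mem D j), tU_mul_left D (uOne_mem D), uJKt_uE, one_mul,
        mul_one, tU_smul_left D, smul_smul, SuperCartanDatum.chiU, mul_comm]
      simp)
    x hx
  rw [← key]
  change ((deltaFree D).comp (substE I Y)) x = _
  congr 1
  ext i
  simp [substE, P, Q, deltaGen]

theorem delta_F_rad [C.Consistent] [Fintype I] (x : FreeF I) (hx : x ∈ rad C) :
    deltaFree D (substF I Y x) = 0 := by
  let P : FreeF I →ₐ[Rπ] UU D := FreeAlgebra.lift Rπ fun i => tU D 1 (uF D i)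
  let Q : FreeF I →ₐ[Rπ] UU D := FreeAlgebra.lift Rπ fun i => tU D (uF D i) (uKtn D i)
  have hP : ∀ y, P y = tU D 1 (minusF D y) := by
    intro y
    induction y using FreeF.induction_left with
    | h1 => rw [map_one, map_one]; rfl
    | hadd y y' h h' => rw [map_add, h, h', map_add, tU_add_right D]
    | hsmul r y h => rw [map_smul, h, map_smul, tU_smul_right D]
    | hmul i y h =>
      rw [map_mul, h, map_mul, minusF_th, FreeAlgebra.lift_ι_apply,
        tU_mul_right D (uOne_mem D), one_mul]
  have hQ : ∀ (ν : I →₀ ℕ), ∃ k : UAlg D, ∀ y ∈ fwt I ν, Q y = tU D (minusF D y) k := by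
    intro ν
    refine ⟨uK D (ν.sum fun i a => a • -(C.d i • D.coroot i)), fun y hy => ?_⟩
    induction hy using Submodule.span_induction with
    | mem y hy =>
      obtain ⟨l, rfl, rfl⟩ := hy
      induction l with
      | nil => simp [uK_zero]; rfl
      | cons i l ih =>
        rw [List.map_cons, List.map_cons, List.prod_cons, map_mul, map_mul, List.sum_cons, ih,
          minusF_th, FreeAlgebra.lift_ι_apply, tU_mul_left D (uKtn_mem D _), uKtn,
          sum_single_add, uK_add]
    | zero => rw [map_zero, map_zero, tU_zero_left D]
    | add y y' _ _ h h' => rw [map_add, h, h', map_add, tU_add_left D]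
    | smul r y _ h => rw [map_smul, h, map_smul, tU_smul_left D]
  have key := sum_kill C P Q (fun y hy => by rw [hP, minusF_rad D y hy, tU_zero_right D])
    (rad_kill C Q.toLinearMap.toAddMonoidHom fun ν y hy hy' => by
      obtain ⟨k, hk⟩ := hQ ν
      refine (hk y hy).trans ?_
      rw [minusF_rad D y hy', tU_zero_left D])
    (fun i j => by
      have hs : ppi ^ (C.p i * C.p j) * ppi ^ (C.p i * C.p j) = 1 := ppi_pow_mul_self _
      simp only [P, Q, FreeAlgebra.lift_ι_apply]
      rw [tU_mul_p D (uF_mem D j) (uF_mem D i), tU_mul_left D (uKtn_mem D i), uKtn_uF, one_mul,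
        mul_one, tU_smul_right D, smul_smul, SuperCartanDatum.chiU, mul_comm (C.p j), Units.val_mul,
        Units.val_pow_eq_pow_val, mul_assoc]
      change _ = (_ * (ppi ^ (C.p i * C.p j) * ppi ^ (C.p i * C.p j))) • _
      rw [hs, mul_one])
    x hx
  rw [← key]
  change ((deltaFree D).comp (substF I Y)) x = _
  congr 1
  ext i
  simp [substF, P, Q, deltaGen, add_comm]

theorem deltaFree_rel [C.Consistent] [Fintype I] (a b : UFree I Y) (h : URel D a b) :
    deltaFree D a = deltaFree D b := by
  cases h with
  | K_zero => simp only [deltaFree_gen, map_one, deltaGen, uK_zero]; rfl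
  | K_add μ μ' =>
    simp only [deltaFree_gen, map_mul, deltaGen, uK_add]
    rw [tU_mul_left D (uK_mem D μ)]
  | J_two μ => simp only [deltaFree_gen, map_one, deltaGen, uJ_two]; rfl
  | J_add μ μ' =>
    simp only [deltaFree_gen, map_mul, deltaGen, uJ_add]
    rw [tU_mul_left D (uJ_mem D μ)]
  | J_K μ μ' =>
    simp only [deltaFree_gen, map_mul, deltaGen]
    rw [tU_mul_left D (uJ_mem D μ), tU_mul_left D (uK_mem D μ'), uJ_uK]
  | K_E μ i =>
    simp only [deltaFree_gen, map_mul, map_smul, deltaGen, mul_add, add_mul]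
    rw [tU_mul_left D (uK_mem D μ), tU_mul_left D (uK_mem D μ), tU_mul_right D (uK_mem D μ),
      tU_mul_right D (uK_mem D μ), uK_uE, tU_smul_left D, tU_smul_right D, one_mul, mul_one, smul_add,
      uJKt, mul_assoc, ← uK_add, ← mul_assoc, ← uJ_uK, mul_assoc, ← uK_add, add_comm μ]
  | J_E μ i =>
    simp only [deltaFree_gen, map_mul, map_smul, deltaGen, mul_add, add_mul]
    rw [tU_mul_left D (uJ_mem D μ), tU_mul_left D (uJ_mem D μ), tU_mul_right D (uJ_mem D μ),
      tU_mul_right D (uJ_mem D μ), uJ_uE, tU_smul_left D, tU_smul_right D, one_mul, mul_one, smul_add,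
      uJKt, mul_assoc, ← uJ_uK, ← mul_assoc, ← mul_assoc, ← uJ_add, ← uJ_add, add_comm μ]
  | K_F μ i =>
    simp only [deltaFree_gen, map_mul, map_smul, deltaGen, mul_add, add_mul]
    rw [tU_mul_left D (uK_mem D μ), tU_mul_left D (uK_mem D μ), tU_mul_right D (uK_mem D μ),
      tU_mul_right D (uK_mem D μ), uK_uF, tU_smul_left D, tU_smul_right D, one_mul, mul_one, smul_add,
      uKtn, ← uK_add, ← uK_add, add_comm μ]
  | J_F μ i =>
    simp only [deltaFree_gen, map_mul, map_smul, deltaGen, mul_add, add_mul]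
    rw [tU_mul_left D (uJ_mem D μ), tU_mul_left D (uJ_mem D μ), tU_mul_right D (uJ_mem D μ),
      tU_mul_right D (uJ_mem D μ), uJ_uF, tU_smul_left D, tU_smul_right D, one_mul, mul_one, smul_add,
      uKtn, uJ_uK]
  | E_F i j =>
    rw [map_sub, map_mul, map_smul, map_mul]
    simp only [deltaFree_gen]
    rw [deltaGen_E_F, uE_uF']
    split_ifs with h
    · subst h
      simp only [map_sub, map_smul, map_mul, deltaFree_gen, deltaGen]
      rw [tU_mul_left D (uJ_mem D _), tU_smul_left D, tU_smul_right D, ← smul_add, tU_sub_left D,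
        tU_sub_right D, ← uKtn, ← uJKt]
      congr 1
      abel
    · rw [map_zero, tU_zero_left D, tU_zero_right D, add_zero]
  | rad_E x hx => rw [map_zero, delta_E_rad D x hx]
  | rad_F x hx => rw [map_zero, delta_F_rad D x hx]

/-- The comultiplication of `U`. -/
def delta [C.Consistent] [Fintype I] : UAlg D →ₐ[Rπ] UU D :=
  uLift D (deltaFree D) (deltaFree_rel D)

/-! ### The bar involution of `U` -/

/-- The values of the bar involution on the generators. -/
def barGen : Gen I Y → UAlg D
  | .E i => uE D i
  | .F i => uF D i
  | .J μ => uJ D μ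
  | .K μ => uJ D μ * uK D (-μ)

/-- The bar involution, on the free algebra. -/
def barFree : UFree I Y →ₐ[Rπ] BarTw (UAlg D) :=
  FreeAlgebra.lift Rπ fun g => BarTw.mk (barGen D g)

theorem out_barFree_gen (g : Gen I Y) : BarTw.out (barFree D (gen g)) = barGen D g := by
  rw [barFree, FreeAlgebra.lift_ι_apply]; rfl

theorem uJ_neg (μ : Y) : uJ D (-μ) = uJ D μ := by
  have h1 : uJ D μ * uJ D μ = 1 := by rw [← uJ_add, ← two_nsmul, uJ_two]
  have h2 : uJ D (-μ) * uJ D μ = 1 := by rw [← uJ_add, neg_add_cancel, uJ_zero]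
  calc uJ D (-μ) = uJ D (-μ) * (uJ D μ * uJ D μ) := by rw [h1, mul_one]
    _ = uJ D μ := by rw [← mul_assoc, h2, one_mul]

theorem uJ_mul_self (μ : Y) : uJ D μ * uJ D μ = 1 := by rw [← uJ_add, ← two_nsmul, uJ_two]

theorem barR_qq_zpow (n : ℤ) :
    barR ((qq ^ n : Rπˣ) : Rπ) = ((piU ^ n * qq ^ (-n) : Rπˣ) : Rπ) := by
  have h : Units.map barR.toMonoidHom (qq ^ n) = piU ^ n * qq ^ (-n) := by
    rw [map_zpow, barR_units_qq, mul_zpow, inv_zpow, zpow_neg]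
  exact congrArg Units.val h

theorem barR_piU_zpow (n : ℤ) : barR ((piU ^ n : Rπˣ) : Rπ) = ((piU ^ n : Rπˣ) : Rπ) := by
  have h : Units.map barR.toMonoidHom (piU ^ n) = piU ^ n := by
    rw [map_zpow, barR_units_piU]
  exact congrArg Units.val h

theorem piU_zpow_neg (n : ℤ) : piU ^ (-n) = piU ^ n := by rw [zpow_neg, ← inv_zpow, piU_inv]

theorem piU_zpow_d [hC : C.Consistent] (i : I) : ((piU ^ C.d i : Rπˣ) : Rπ) = C.pii i := by
  have h := hC.d_modEq i
  obtain ⟨k, hk⟩ := h.symm.dvd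
  have : C.d i = (C.p i : ℕ) + 2 * k := by linarith
  rw [this, zpow_add, piU_zpow_even (even_two_mul k), mul_one, zpow_natCast]
  rfl

theorem barR_invDen [hC : C.Consistent] (i : I) : barR (C.invDen i) = -C.invDen i := by
  have hp : C.pii i * C.pii i = 1 := ppi_pow_mul_self _
  have h1 : barR (C.pii i * C.qi i - (((C.qi i)⁻¹ : Rπˣ) : Rπ)) =
      -(C.pii i * C.qi i - (((C.qi i)⁻¹ : Rπˣ) : Rπ)) := by
    rw [map_sub, map_mul, SuperCartanDatum.qi, ← zpow_neg, barR_qq_zpow, barR_qq_zpow,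
      piU_zpow_neg, neg_neg, Units.val_mul, Units.val_mul, piU_zpow_d, SuperCartanDatum.pii, map_pow,
      barR_ppi]
    rw [SuperCartanDatum.pii] at hp
    linear_combination ((qq ^ (-C.d i) : Rπˣ) : Rπ) * hp
  have hu := C.isUnit_den i
  have h2 : (C.pii i * C.qi i - (((C.qi i)⁻¹ : Rπˣ) : Rπ)) * C.invDen i = 1 :=
    Ring.mul_inverse_cancel _ hu
  refine hu.mul_left_cancel ?_
  have h3 := congrArg barR h2
  rw [map_mul, h1, map_one] at h3
  linear_combination -h3 + h2

theorem barFree_substE (x : FreeF I) :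
    BarTw.out (barFree D (substE I Y x)) = plusF D (barF I x) := by
  induction x using FreeF.induction_left with
  | h1 => simp only [map_one, barF_one]
  | hadd x y h h' => simp only [map_add, h, h']
  | hsmul r x h => rw [map_smul, map_smul, BarTw.out_smul, h, LinearMap.map_smulₛₗ, map_smul]
  | hmul i x h =>
    have h1 : substE I Y (th i) = gen (Gen.E i) := FreeAlgebra.lift_ι_apply _ _
    rw [map_mul, map_mul, map_mul, h, barF_mul, map_mul, barF_th, plusF_th, h1, out_barFree_gen]
    rfl

theorem barFree_substF (x : FreeF I) :
    BarTw.out (barFree D (substF I Y x)) = minusF D (barF I x) := by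
  induction x using FreeF.induction_left with
  | h1 => simp only [map_one, barF_one]
  | hadd x y h h' => simp only [map_add, h, h']
  | hsmul r x h => rw [map_smul, map_smul, BarTw.out_smul, h, LinearMap.map_smulₛₗ, map_smul]
  | hmul i x h =>
    have h1 : substF I Y (th i) = gen (Gen.F i) := FreeAlgebra.lift_ι_apply _ _
    rw [map_mul, map_mul, map_mul, h, barF_mul, map_mul, barF_th, minusF_th, h1, out_barFree_gen]
    rfl

theorem barFree_rel [C.Consistent] (a b : UFree I Y) (h : URel D a b) :
    barFree D a = barFree D b := by
  change BarTw.out (barFree D a) = BarTw.out (barFree D b)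
  cases h with
  | K_zero => rw [out_barFree_gen, map_one, map_one, barGen, neg_zero, uJ_zero, uK_zero, one_mul]
  | K_add μ μ' =>
    rw [map_mul, map_mul, out_barFree_gen, out_barFree_gen, out_barFree_gen, barGen, barGen, barGen,
      neg_add, uJ_add, uK_add, mul_assoc, mul_assoc, ← mul_assoc (uK D _) (uJ D _), ← uJ_uK,
      mul_assoc]
  | J_two μ => rw [out_barFree_gen, map_one, map_one, barGen, uJ_two]
  | J_add μ μ' =>
    rw [map_mul, map_mul, out_barFree_gen, out_barFree_gen, out_barFree_gen, barGen, barGen, barGen,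
      uJ_add]
  | J_K μ μ' =>
    rw [map_mul, map_mul, map_mul, map_mul, out_barFree_gen, out_barFree_gen, barGen, barGen,
      mul_assoc, ← uJ_uK, ← mul_assoc, ← mul_assoc, ← uJ_add, ← uJ_add, add_comm]
  | K_E μ i =>
    rw [map_smul, BarTw.out_smul, map_mul, map_mul, map_mul, map_mul, out_barFree_gen,
      out_barFree_gen, barGen, barGen, mul_assoc, uK_uE, mul_smul_comm, ← mul_assoc, uJ_uE,
      smul_mul_assoc, mul_assoc, smul_smul, barR_qq_zpow, map_neg, LinearMap.neg_apply,
      Units.val_mul, mul_comm]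
  | J_E μ i =>
    rw [map_smul, BarTw.out_smul, map_mul, map_mul, map_mul, map_mul, out_barFree_gen,
      out_barFree_gen, barGen, barGen, uJ_uE, barR_piU_zpow]
  | K_F μ i =>
    rw [map_smul, BarTw.out_smul, map_mul, map_mul, map_mul, map_mul, out_barFree_gen,
      out_barFree_gen, barGen, barGen, mul_assoc, uK_uF, mul_smul_comm, ← mul_assoc, uJ_uF,
      smul_mul_assoc, mul_assoc, smul_smul, barR_qq_zpow, map_neg, LinearMap.neg_apply,
      Units.val_mul, mul_comm]
  | J_F μ i =>
    rw [map_smul, BarTw.out_smul, map_mul, map_mul, map_mul, map_mul, out_barFree_gen,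
      out_barFree_gen, barGen, barGen, uJ_uF, barR_piU_zpow]
  | E_F i j =>
    rw [map_sub, map_sub, map_smul, BarTw.out_smul, map_mul, map_mul, map_mul, map_mul,
      out_barFree_gen, out_barFree_gen, barGen, barGen, map_pow, barR_ppi, uE_uF]
    split_ifs with h
    · rw [map_smul, BarTw.out_smul, map_sub, map_sub, map_mul, map_mul, out_barFree_gen,
        out_barFree_gen, out_barFree_gen, barGen, barGen, barGen, barR_invDen, neg_neg, uJ_neg,
        ← mul_assoc, uJ_mul_self, one_mul, neg_smul, smul_sub, smul_sub, neg_sub]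
    · rw [map_zero, map_zero]
  | rad_E x hx => rw [map_zero, map_zero, barFree_substE, plusF_rad D _ (barF_mem_rad C hx)]
  | rad_F x hx => rw [map_zero, map_zero, barFree_substF, minusF_rad D _ (barF_mem_rad C hx)]

/-- The bar involution of `U`: it is semilinear for the bar involution of `ℚ(q)^π`, it fixes
`E_i`, `F_i`, `J_μ`, and it sends `K_μ` to `J_μ K_{-μ}`. -/
def barU [C.Consistent] : UAlg D →ₛₗ[barR] UAlg D where
  toFun x := BarTw.out (uLift D (barFree D) (barFree_rel D) x)
  map_add' x y := by rw [map_add, map_add]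
  map_smul' r x := by rw [map_smul]; rfl

theorem barU_mul [C.Consistent] (x y : UAlg D) : barU D (x * y) = barU D x * barU D y :=
  map_mul (uLift D (barFree D) (barFree_rel D)) x y

theorem barU_one [C.Consistent] : barU D 1 = 1 := map_one (uLift D (barFree D) (barFree_rel D))

theorem barU_gen [C.Consistent] (g : Gen I Y) : barU D (uMk D (gen g)) = barGen D g :=
  (congrArg BarTw.out (uLift_uMk D (barFree D) (barFree_rel D) (gen g))).trans
    (out_barFree_gen D g)

/-- The map `bar ⊗ bar` on `U ⊗ U`. -/
def barUU [C.Consistent] : UU D →ₛₗ[barR] UU D :=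
  (TensorProduct.map (barU D) (barU D) :
    UAlg D ⊗[Rπ] UAlg D →ₛₗ[barR] UAlg D ⊗[Rπ] UAlg D)

theorem barUU_tU [C.Consistent] (a b : UAlg D) : barUU D (tU D a b) = tU D (barU D a) (barU D b) :=
  rfl

/-- The map `Δ̄`, with `Δ̄(u)` the image under bar of `Δ` of the image of `u` under bar. -/
def deltaBar [C.Consistent] [Fintype I] (u : UAlg D) : UU D := barUU D (delta D (barU D u))

end


/-! ## Left ideals in algebras with a triangular decomposition -/

section Triangular

variable {R : Type*} [CommRing R] {A : Type*} [Ring A] [Algebra R A] {I : Type*}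

/-- The span of the words of length at least `n` in the elements `x i`. -/
def wordGE (R : Type*) [CommRing R] {A : Type*} [Ring A] [Algebra R A] {I : Type*} (x : I → A)
    (n : ℕ) : Submodule R A :=
  Submodule.span R {a | ∃ l : List I, n ≤ l.length ∧ (l.map x).prod = a}

theorem word_mem_wordGE (x : I → A) {n : ℕ} (l : List I) (hl : n ≤ l.length) :
    (l.map x).prod ∈ wordGE R x n := Submodule.subset_span ⟨l, hl, rfl⟩

theorem wordGE_anti (x : I → A) {m n : ℕ} (h : m ≤ n) : wordGE R x n ≤ wordGE R x m :=
  Submodule.span_mono fun _ ⟨l, hl, hx⟩ => ⟨l, h.trans hl, hx⟩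

theorem wordGE_mul (x : I → A) (m n : ℕ) : wordGE R x m * wordGE R x n ≤ wordGE R x (m + n) := by
  rw [wordGE, wordGE, Submodule.span_mul_span, Submodule.span_le]
  rintro _ ⟨_, ⟨l, hl, rfl⟩, _, ⟨l', hl', rfl⟩, rfl⟩
  refine Submodule.subset_span ⟨l ++ l', ?_, by simp⟩
  rw [List.length_append]; omega

theorem one_mem_wordGE (x : I → A) : (1 : A) ∈ wordGE R x 0 :=
  Submodule.subset_span ⟨[], le_rfl, rfl⟩

theorem gen_mem_wordGE (x : I → A) (i : I) : x i ∈ wordGE R x 1 := by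
  simpa using word_mem_wordGE (R := R) x (n := 1) [i] le_rfl

theorem mul_wordGE_le (x : I → A) (T : Subalgebra R A)
    (h : ∀ t ∈ T, ∀ i, ∃ t' ∈ T, t * x i = x i * t') (n : ℕ) :
    Subalgebra.toSubmodule T * wordGE R x n ≤ wordGE R x n * Subalgebra.toSubmodule T := by
  rw [Submodule.mul_le]
  intro t ht w hw
  induction hw using Submodule.span_induction with
  | mem w hw =>
    obtain ⟨l, hl, rfl⟩ := hw
    have : ∀ l : List I, ∀ t ∈ T, ∃ t' ∈ T, t * (l.map x).prod = (l.map x).prod * t' := by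
      intro l
      induction l with
      | nil => exact fun t ht => ⟨t, ht, by simp⟩
      | cons i l ih =>
        intro t ht
        obtain ⟨t', ht', e⟩ := h t ht i
        obtain ⟨t'', ht'', e'⟩ := ih t' ht'
        exact ⟨t'', ht'', by rw [List.map_cons, List.prod_cons, ← mul_assoc, e, mul_assoc, e',
          mul_assoc]⟩
    obtain ⟨t', ht', e⟩ := this l t ht
    rw [e]
    exact Submodule.mul_mem_mul (word_mem_wordGE x l hl) ht'
  | zero => rw [mul_zero]; exact zero_mem _
  | add a b _ _ ha hb => rw [mul_add]; exact add_mem ha hb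
  | smul r a _ ha => rw [mul_smul_comm]; exact Submodule.smul_mem _ _ ha

theorem wordGE_mul_le (x : I → A) (T : Subalgebra R A)
    (h : ∀ t ∈ T, ∀ i, ∃ t' ∈ T, x i * t = t' * x i) (n : ℕ) :
    wordGE R x n * Subalgebra.toSubmodule T ≤ Subalgebra.toSubmodule T * wordGE R x n := by
  rw [Submodule.mul_le]
  intro w hw t ht
  induction hw using Submodule.span_induction with
  | mem w hw =>
    obtain ⟨l, hl, rfl⟩ := hw
    have : ∀ l : List I, ∀ t ∈ T, ∃ t' ∈ T, (l.map x).prod * t = t' * (l.map x).prod := by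
      intro l
      induction l with
      | nil => exact fun t ht => ⟨t, ht, by simp⟩
      | cons i l ih =>
        intro t ht
        obtain ⟨t', ht', e⟩ := ih t ht
        obtain ⟨t'', ht'', e'⟩ := h t' ht' i
        exact ⟨t'', ht'', by rw [List.map_cons, List.prod_cons, mul_assoc, e, ← mul_assoc, e',
          mul_assoc]⟩
    obtain ⟨t', ht', e⟩ := this l t ht
    rw [e]
    exact Submodule.mul_mem_mul ht' (word_mem_wordGE x l hl)
  | zero => rw [zero_mul]; exact zero_mem _
  | add a b _ _ ha hb => rw [add_mul]; exact add_mem ha hb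
  | smul r a _ ha => rw [smul_mul_assoc]; exact Submodule.smul_mem _ _ ha

/-- The span of the products of a word in the `e i`, an element of `T`, and a word of length
at least `n` in the `f i`. -/
def triL (e f : I → A) (T : Subalgebra R A) (n : ℕ) : Submodule R A :=
  wordGE R e 0 * Subalgebra.toSubmodule T * wordGE R f n

theorem mul_mono' {P Q P' Q' : Submodule R A} (h : P ≤ P') (h' : Q ≤ Q') : P * Q ≤ P' * Q' :=
  Submodule.mul_le.mpr fun _ ha _ hb => Submodule.mul_mem_mul (h ha) (h' hb)

theorem triL_anti (e f : I → A) (T : Subalgebra R A) {m n : ℕ} (h : m ≤ n) :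
    triL e f T n ≤ triL e f T m := mul_mono' le_rfl (wordGE_anti f h)

/-- The commutation relations behind a triangular decomposition. -/
structure Tri (e f : I → A) (T : Subalgebra R A) : Prop where
  te : ∀ t ∈ T, ∀ i, ∃ t' ∈ T, t * e i = e i * t'
  ft : ∀ t ∈ T, ∀ i, ∃ t' ∈ T, f i * t = t' * f i
  fe : ∀ i j, ∃ s : R, ∃ t ∈ T, f i * e j = s • (e j * f i) + t
  gen : Algebra.adjoin R (Set.range e ∪ Set.range f ∪ T) = ⊤

theorem T_mul_T (T : Subalgebra R A) :
    Subalgebra.toSubmodule T * Subalgebra.toSubmodule T ≤ Subalgebra.toSubmodule T :=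
  Submodule.mul_le.mpr fun _ ha _ hb => T.mul_mem ha hb

namespace Tri

variable {e f : I → A} {T : Subalgebra R A}

theorem mul_word (e f : I → A) (T : Subalgebra R A) (m n : ℕ) :
    triL e f T m * wordGE R f n ≤ triL e f T (m + n) := by
  rw [triL, mul_assoc]
  exact mul_mono' le_rfl (wordGE_mul f m n)

theorem mul_gen (e f : I → A) (T : Subalgebra R A) (n : ℕ) (i : I) {x : A}
    (hx : x ∈ triL e f T n) : x * f i ∈ triL e f T (n + 1) :=
  mul_word e f T n 1 (Submodule.mul_mem_mul hx (gen_mem_wordGE f i))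

theorem one_mem (e f : I → A) (T : Subalgebra R A) : (1 : A) ∈ triL e f T 0 := by
  have := Submodule.mul_mem_mul (Submodule.mul_mem_mul (one_mem_wordGE (R := R) e)
    (show (1 : A) ∈ Subalgebra.toSubmodule T from T.one_mem)) (one_mem_wordGE (R := R) f)
  rwa [mul_one, mul_one] at this

theorem word_mul (e f : I → A) (T : Subalgebra R A) (n : ℕ) :
    wordGE R e 0 * triL e f T n ≤ triL e f T n := by
  rw [triL, ← mul_assoc, ← mul_assoc]
  exact mul_mono' (mul_mono' (wordGE_mul e 0 0) le_rfl) le_rfl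

theorem T_mul (H : Tri e f T) (n : ℕ) : Subalgebra.toSubmodule T * triL e f T n ≤ triL e f T n := by
  rw [triL, ← mul_assoc, ← mul_assoc]
  refine mul_mono' ((mul_mono' (mul_wordGE_le e T H.te 0) le_rfl).trans ?_) le_rfl
  rw [mul_assoc]
  exact mul_mono' le_rfl (T_mul_T T)

theorem mul_T (H : Tri e f T) (n : ℕ) : triL e f T n * Subalgebra.toSubmodule T ≤ triL e f T n := by
  rw [triL, mul_assoc]
  refine (mul_mono' le_rfl (wordGE_mul_le f T H.ft n)).trans ?_
  rw [← mul_assoc, mul_assoc (wordGE R e 0)]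
  exact mul_mono' (mul_mono' le_rfl (T_mul_T T)) le_rfl

theorem f_mul_word (H : Tri e f T) (i : I) {w : A} (hw : w ∈ wordGE R e 0) : f i * w ∈ triL e f T 0 := by
  have h1 : wordGE R e 0 ≤ triL e f T 0 := fun x hx => by
    simpa using word_mul e f T 0 (Submodule.mul_mem_mul hx (one_mem e f T))
  induction hw using Submodule.span_induction with
  | mem w hw =>
    obtain ⟨l, -, rfl⟩ := hw
    induction l with
    | nil =>
      rw [List.map_nil, List.prod_nil, mul_one]
      exact triL_anti e f T (Nat.zero_le _) (by simpa using mul_gen e f T 0 i (one_mem e f T))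
    | cons j l ih =>
      obtain ⟨s, t, ht, h⟩ := H.fe i j
      rw [List.map_cons, List.prod_cons, ← mul_assoc, h, add_mul, smul_mul_assoc, mul_assoc]
      refine add_mem (Submodule.smul_mem _ _ ?_) ?_
      · exact word_mul e f T 0 (Submodule.mul_mem_mul
          (wordGE_anti e (Nat.zero_le 1) (gen_mem_wordGE e j)) ih)
      · exact H.T_mul 0 (Submodule.mul_mem_mul ht (h1 (word_mem_wordGE e l (Nat.zero_le _))))
  | zero => rw [mul_zero]; exact zero_mem _
  | add a b _ _ ha hb => rw [mul_add]; exact add_mem ha hb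
  | smul r a _ ha => rw [mul_smul_comm]; exact Submodule.smul_mem _ _ ha

theorem mul_mem (H : Tri e f T) (n : ℕ) (a : A) {x : A} (hx : x ∈ triL e f T n) : a * x ∈ triL e f T n := by
  have ha : a ∈ Algebra.adjoin R (Set.range e ∪ Set.range f ∪ T) := by rw [H.gen]; trivial
  induction ha using Algebra.adjoin_induction generalizing x with
  | mem a ha =>
    rcases ha with (⟨i, rfl⟩ | ⟨i, rfl⟩) | ht
    · exact word_mul e f T n (Submodule.mul_mem_mul
        (wordGE_anti e (Nat.zero_le 1) (gen_mem_wordGE e i)) hx)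
    · rw [triL, mul_assoc] at hx
      refine Submodule.mul_induction_on hx (fun w hw v hv => ?_) (fun a b ha hb => ?_)
      · rw [← mul_assoc]
        have h2 := Submodule.mul_mem_mul (H.f_mul_word i hw) hv
        rw [← mul_assoc] at h2
        have h3 := mul_word e f T 0 n (mul_mono' (H.mul_T 0) le_rfl h2)
        rwa [zero_add] at h3
      · rw [mul_add]; exact add_mem ha hb
    · exact H.T_mul n (Submodule.mul_mem_mul ht hx)
  | algebraMap r => rw [← Algebra.smul_def]; exact Submodule.smul_mem _ _ hx
  | add a b _ _ ha hb => rw [add_mul]; exact add_mem (ha hx) (hb hx)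
  | mul a b _ _ ha hb => rw [mul_assoc]; exact ha (hb hx)

theorem word_mem (e f : I → A) (T : Subalgebra R A) (n : ℕ) {x : A} (hx : x ∈ wordGE R f n) : x ∈ triL e f T n := by
  simpa using mul_word e f T 0 n (Submodule.mul_mem_mul (one_mem e f T) hx)

theorem word_mul_e (H : Tri e f T) (i : I) (l : List I) : ∀ n, n + 1 ≤ l.length →
    (l.map f).prod * e i ∈ triL e f T n := by
  induction l using List.reverseRecOn with
  | nil => intro n hn; simp at hn
  | append_singleton l j ih =>
    intro n hn
    have hl : n ≤ l.length := by simpa using hn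
    obtain ⟨s, t, ht, h⟩ := H.fe j i
    rw [List.map_append, List.prod_append, List.map_singleton, List.prod_singleton, mul_assoc, h,
      mul_add, mul_smul_comm, ← mul_assoc]
    refine add_mem (Submodule.smul_mem _ _ ?_) ?_
    · cases n with
      | zero => simpa using H.mul_mem 0 ((l.map f).prod * e i * f j) (one_mem e f T)
      | succ m => exact mul_gen e f T m j (ih m hl)
    · exact H.mul_T n (Submodule.mul_mem_mul (word_mem e f T n (word_mem_wordGE f l hl)) ht)

theorem exists_mul_mem (H : Tri e f T) (a : A) : ∃ r, ∀ n, ∀ x ∈ triL e f T (n + r), x * a ∈ triL e f T n := by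
  have ha : a ∈ Algebra.adjoin R (Set.range e ∪ Set.range f ∪ T) := by rw [H.gen]; trivial
  induction ha using Algebra.adjoin_induction with
  | mem a ha =>
    rcases ha with (⟨i, rfl⟩ | ⟨i, rfl⟩) | ht
    · refine ⟨1, fun n x hx => ?_⟩
      rw [triL] at hx
      refine Submodule.mul_induction_on hx (fun w hw v hv => ?_) (fun a b ha hb => ?_)
      · rw [mul_assoc]
        refine H.mul_mem n w ?_
        induction hv using Submodule.span_induction with
        | mem v hv =>
          obtain ⟨l, hl, rfl⟩ := hv
          exact H.word_mul_e i l n hl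
        | zero => rw [zero_mul]; exact zero_mem _
        | add a b _ _ ha hb => rw [add_mul]; exact add_mem ha hb
        | smul r a _ ha => rw [smul_mul_assoc]; exact Submodule.smul_mem _ _ ha
      · rw [add_mul]; exact add_mem ha hb
    · exact ⟨0, fun n x hx => triL_anti e f T (Nat.le_succ n) (mul_gen e f T n i hx)⟩
    · exact ⟨0, fun n x hx => H.mul_T n (Submodule.mul_mem_mul hx ht)⟩
  | algebraMap r =>
    refine ⟨0, fun n x hx => ?_⟩
    rw [← Algebra.commutes, ← Algebra.smul_def]
    exact Submodule.smul_mem _ _ hx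
  | add a b _ _ ha hb =>
    obtain ⟨r, hr⟩ := ha
    obtain ⟨r', hr'⟩ := hb
    refine ⟨max r r', fun n x hx => ?_⟩
    rw [mul_add]
    exact add_mem (hr n x (triL_anti e f T (by omega) hx)) (hr' n x (triL_anti e f T (by omega) hx))
  | mul a b _ _ ha hb =>
    obtain ⟨r, hr⟩ := ha
    obtain ⟨r', hr'⟩ := hb
    refine ⟨r' + r, fun n x hx => ?_⟩
    rw [← mul_assoc]
    exact hr' n _ (hr (n + r') x (by rwa [← add_assoc] at hx))

end Tri

end Triangular


section

variable {I : Type*} [DecidableEq I] {C : SuperCartanDatum I} {Y X : Type*} [AddCommGroup Y]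
  [AddCommGroup X] (D : RootDatum C Y X)

/-! ### The subspaces `H_N` of `U ⊗ U` -/

/-- The subspace `U⁺` of `U`, the image of `f` under `x ↦ x⁺`. -/
def uPlus : Submodule Rπ (UAlg D) := LinearMap.range (plus D).toLinearMap

/-- The subspace `U⁻` of `U`, the image of `f` under `x ↦ x⁻`. -/
def uMinus : Submodule Rπ (UAlg D) := LinearMap.range (minus D).toLinearMap

/-- The subalgebra `U⁰` of `U`, generated by the `J_μ` and the `K_μ`. -/
def uZero : Subalgebra Rπ (UAlg D) :=
  Algebra.adjoin Rπ (Set.range (uJ D) ∪ Set.range (uK D))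

/-- The subspace `U⁺_ν`, the image of `f_ν` under `x ↦ x⁺`. -/
def uPlusWt (ν : I →₀ ℕ) : Submodule Rπ (UAlg D) := (fAlgWt C ν).map (plus D).toLinearMap

/-- The subspace `U⁻_ν`, the image of `f_ν` under `x ↦ x⁻`. -/
def uMinusWt (ν : I →₀ ℕ) : Submodule Rπ (UAlg D) := (fAlgWt C ν).map (minus D).toLinearMap

/-- `U⁺ U⁰ (∑_{ht ν ≥ N} U⁻_ν)`. -/
def uPM (N : ℕ) : Submodule Rπ (UAlg D) :=
  uPlus D * Subalgebra.toSubmodule (uZero D) *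
    ⨆ (ν : I →₀ ℕ) (_ : N ≤ SuperCartanDatum.ht ν), uMinusWt D ν

/-- `U⁻ U⁰ (∑_{ht ν ≥ N} U⁺_ν)`. -/
def uMP (N : ℕ) : Submodule Rπ (UAlg D) :=
  uMinus D * Subalgebra.toSubmodule (uZero D) *
    ⨆ (ν : I →₀ ℕ) (_ : N ≤ SuperCartanDatum.ht ν), uPlusWt D ν

/-- The subspace
`H_N = U⁺ U⁰ (∑_{ht ν ≥ N} U⁻_ν) ⊗ U + U ⊗ U⁻ U⁰ (∑_{ht ν ≥ N} U⁺_ν)` of `U ⊗ U`. -/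
def HN (N : ℕ) : Submodule Rπ (UU D) :=
  Submodule.span Rπ {x | ∃ a ∈ uPM D N, ∃ b, x = tU D a b} ⊔
    Submodule.span Rπ {x | ∃ a, ∃ b ∈ uMP D N, x = tU D a b}

theorem ht_word (l : List I) :
    SuperCartanDatum.ht (l.map fun i => Finsupp.single i 1).sum = l.length := by
  induction l with
  | nil => simp [SuperCartanDatum.ht]
  | cons i l ih =>
    rw [List.map_cons, List.sum_cons, SuperCartanDatum.ht,
      Finsupp.sum_add_index' (h := fun _ a => a) (fun _ => rfl) (fun _ _ _ => rfl),
      Finsupp.sum_single_index rfl]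
    rw [SuperCartanDatum.ht] at ih
    rw [ih, List.length_cons, add_comm]

theorem map_word (g : fAlg C →ₐ[Rπ] UAlg D) (x : I → UAlg D) (hg : ∀ i, g (fmk C (th i)) = x i)
    (l : List I) : g (fmk C (l.map fun i => th i).prod) = (l.map x).prod := by
  rw [map_list_prod, map_list_prod, List.map_map, List.map_map]
  congr 1
  exact List.map_congr_left fun i _ => hg i

theorem iSup_wt_eq (g : fAlg C →ₐ[Rπ] UAlg D) (x : I → UAlg D)
    (hg : ∀ i, g (fmk C (th i)) = x i) (N : ℕ) :
    ⨆ (ν : I →₀ ℕ) (_ : N ≤ SuperCartanDatum.ht ν), (fAlgWt C ν).map g.toLinearMap =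
      wordGE Rπ x N := by
  refine le_antisymm (iSup₂_le fun ν hν => ?_) ?_
  · rintro _ ⟨_, ⟨y, hy, rfl⟩, rfl⟩
    change g (fmk C y) ∈ _
    induction hy using Submodule.span_induction with
    | mem y hy =>
      obtain ⟨l, rfl, rfl⟩ := hy
      rw [map_word D g x hg]
      exact word_mem_wordGE x l (by rwa [ht_word] at hν)
    | zero => rw [map_zero, map_zero]; exact zero_mem _
    | add x y _ _ hx hy => rw [map_add, map_add]; exact add_mem hx hy
    | smul r x _ hx => rw [map_smul, map_smul]; exact Submodule.smul_mem _ _ hx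
  · rw [wordGE, Submodule.span_le]
    rintro _ ⟨l, hl, rfl⟩
    refine (le_iSup₂ (f := fun (ν : I →₀ ℕ) (_ : N ≤ SuperCartanDatum.ht ν) =>
      (fAlgWt C ν).map g.toLinearMap) (l.map fun i => Finsupp.single i 1).sum
      (by rwa [ht_word])) ?_
    exact ⟨fmk C (l.map fun i => th i).prod, ⟨_, word_mem_wordGr (fun i : I => th i)
      (fun i => Finsupp.single i 1) l, rfl⟩, map_word D g x hg l⟩

theorem range_eq (g : fAlg C →ₐ[Rπ] UAlg D) (x : I → UAlg D)
    (hg : ∀ i, g (fmk C (th i)) = x i) : LinearMap.range g.toLinearMap = wordGE Rπ x 0 := by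
  refine le_antisymm ?_ ?_
  · rintro _ ⟨y, rfl⟩
    obtain ⟨y, rfl⟩ := fmk_surjective C y
    change g (fmk C y) ∈ _
    induction y using FreeF.induction_left with
    | h1 => rw [map_one, map_one]; exact one_mem_wordGE x
    | hadd y y' h h' => rw [map_add, map_add]; exact add_mem h h'
    | hsmul r y h => rw [map_smul, map_smul]; exact Submodule.smul_mem _ _ h
    | hmul i y h =>
      rw [map_mul, map_mul, hg]
      exact wordGE_anti x (Nat.zero_le _)
        (wordGE_mul x 1 0 (Submodule.mul_mem_mul (gen_mem_wordGE x i) h))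
  · rw [wordGE, Submodule.span_le]
    rintro _ ⟨l, hl, rfl⟩
    exact ⟨_, map_word D g x hg l⟩

theorem plus_fmk_th (i : I) : plus D (fmk C (th i)) = uE D i := plusF_th D i
theorem minus_fmk_th (i : I) : minus D (fmk C (th i)) = uF D i := minusF_th D i

theorem uPM_eq (N : ℕ) : uPM D N = triL (uE D) (uF D) (uZero D) N := by
  rw [uPM, uPlus, range_eq D _ _ (plus_fmk_th D), triL]
  exact congrArg _ (iSup_wt_eq D _ _ (minus_fmk_th D) N)

theorem uMP_eq (N : ℕ) : uMP D N = triL (uF D) (uE D) (uZero D) N := by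
  rw [uMP, uMinus, range_eq D _ _ (minus_fmk_th D), triL]
  exact congrArg _ (iSup_wt_eq D _ _ (plus_fmk_th D) N)

theorem uJ_mem_uZero (μ : Y) : uJ D μ ∈ uZero D :=
  Algebra.subset_adjoin (Set.mem_union_left _ (Set.mem_range_self μ))

theorem uK_mem_uZero (μ : Y) : uK D μ ∈ uZero D :=
  Algebra.subset_adjoin (Set.mem_union_right _ (Set.mem_range_self μ))

theorem uZero_right {x : UAlg D}
    (hJ : ∀ μ, ∃ s : Rπˣ, uJ D μ * x = (s : Rπ) • (x * uJ D μ))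
    (hK : ∀ μ, ∃ s : Rπˣ, uK D μ * x = (s : Rπ) • (x * uK D μ)) :
    ∀ t ∈ uZero D, ∃ t' ∈ uZero D, t * x = x * t' := by
  intro t ht
  induction ht using Algebra.adjoin_induction with
  | mem t ht =>
    rcases ht with ⟨μ, rfl⟩ | ⟨μ, rfl⟩
    · obtain ⟨s, hs⟩ := hJ μ
      exact ⟨(s : Rπ) • uJ D μ, Subalgebra.smul_mem _ (uJ_mem_uZero D μ) _,
        by rw [hs, mul_smul_comm]⟩
    · obtain ⟨s, hs⟩ := hK μ
      exact ⟨(s : Rπ) • uK D μ, Subalgebra.smul_mem _ (uK_mem_uZero D μ) _,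
        by rw [hs, mul_smul_comm]⟩
  | algebraMap r => exact ⟨_, Subalgebra.algebraMap_mem _ r, Algebra.commutes r x⟩
  | add a b _ _ ha hb =>
    obtain ⟨a', ha', ea⟩ := ha
    obtain ⟨b', hb', eb⟩ := hb
    exact ⟨_, add_mem ha' hb', by rw [add_mul, ea, eb, mul_add]⟩
  | mul a b _ _ ha hb =>
    obtain ⟨a', ha', ea⟩ := ha
    obtain ⟨b', hb', eb⟩ := hb
    exact ⟨_, mul_mem ha' hb', by rw [mul_assoc, eb, ← mul_assoc, ea, mul_assoc]⟩

theorem uZero_left {x : UAlg D}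
    (hJ : ∀ μ, ∃ s : Rπˣ, uJ D μ * x = (s : Rπ) • (x * uJ D μ))
    (hK : ∀ μ, ∃ s : Rπˣ, uK D μ * x = (s : Rπ) • (x * uK D μ)) :
    ∀ t ∈ uZero D, ∃ t' ∈ uZero D, x * t = t' * x := by
  intro t ht
  induction ht using Algebra.adjoin_induction with
  | mem t ht =>
    rcases ht with ⟨μ, rfl⟩ | ⟨μ, rfl⟩
    · obtain ⟨s, hs⟩ := hJ μ
      exact ⟨((s⁻¹ : Rπˣ) : Rπ) • uJ D μ,
        Subalgebra.smul_mem _ (uJ_mem_uZero D μ) _,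
        by rw [smul_mul_assoc, hs, smul_smul, Units.inv_mul, one_smul]⟩
    · obtain ⟨s, hs⟩ := hK μ
      exact ⟨((s⁻¹ : Rπˣ) : Rπ) • uK D μ,
        Subalgebra.smul_mem _ (uK_mem_uZero D μ) _,
        by rw [smul_mul_assoc, hs, smul_smul, Units.inv_mul, one_smul]⟩
  | algebraMap r => exact ⟨_, Subalgebra.algebraMap_mem _ r, (Algebra.commutes r x).symm⟩
  | add a b _ _ ha hb =>
    obtain ⟨a', ha', ea⟩ := ha
    obtain ⟨b', hb', eb⟩ := hb
    exact ⟨_, add_mem ha' hb', by rw [mul_add, ea, eb, add_mul]⟩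
  | mul a b _ _ ha hb =>
    obtain ⟨a', ha', ea⟩ := ha
    obtain ⟨b', hb', eb⟩ := hb
    exact ⟨_, mul_mem ha' hb', by rw [← mul_assoc, ea, mul_assoc, eb, ← mul_assoc]⟩

theorem comm_mem (i j : I) : (if i = j then C.invDen i • (uJKt D i - uKtn D i) else 0) ∈ uZero D := by
  split_ifs
  · exact Subalgebra.smul_mem _ (sub_mem (mul_mem (uJ_mem_uZero D _) (uK_mem_uZero D _))
      (uK_mem_uZero D _)) _
  · exact zero_mem _

theorem tri_gen : Algebra.adjoin Rπ (Set.range (uE D) ∪ Set.range (uF D) ∪ uZero D) = ⊤ := by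
  rw [eq_top_iff, ← uGen_adjoin D, Algebra.adjoin_le_iff]
  rintro _ ⟨g, rfl⟩
  apply Algebra.subset_adjoin
  cases g with
  | E i => exact Or.inl (Or.inl ⟨i, rfl⟩)
  | F i => exact Or.inl (Or.inr ⟨i, rfl⟩)
  | J μ => exact Or.inr (uJ_mem_uZero D μ)
  | K μ => exact Or.inr (uK_mem_uZero D μ)

theorem tri_EF : Tri (R := Rπ) (uE D) (uF D) (uZero D) where
  te t ht i := uZero_right D (fun μ => ⟨_, uJ_uE D μ i⟩) (fun μ => ⟨_, uK_uE D μ i⟩) t ht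
  ft t ht i := uZero_left D (fun μ => ⟨_, uJ_uF D μ i⟩) (fun μ => ⟨_, uK_uF D μ i⟩) t ht
  fe i j := by
    refine ⟨ppi ^ (C.p j * C.p i), _, Subalgebra.smul_mem _ (comm_mem D j i)
      (-ppi ^ (C.p j * C.p i)), ?_⟩
    have hs : ppi ^ (C.p j * C.p i) * ppi ^ (C.p j * C.p i) = 1 := ppi_pow_mul_self _
    rw [← uE_uF']
    linear_combination (norm := module) (-hs) • (uF D i * uE D j)
  gen := tri_gen D

theorem tri_FE : Tri (R := Rπ) (uF D) (uE D) (uZero D) where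
  te t ht i := uZero_right D (fun μ => ⟨_, uJ_uF D μ i⟩) (fun μ => ⟨_, uK_uF D μ i⟩) t ht
  ft t ht i := uZero_left D (fun μ => ⟨_, uJ_uE D μ i⟩) (fun μ => ⟨_, uK_uE D μ i⟩) t ht
  fe i j := by
    refine ⟨ppi ^ (C.p i * C.p j), _, comm_mem D i j, ?_⟩
    rw [← uE_uF']
    module
  gen := by rw [Set.union_comm (Set.range (uF D))]; exact tri_gen D

/-! ### The parity twist -/

/-- The automorphism `a ↦ π^{γ p(a)} a` of `U`. -/
abbrev ptw (γ : ZMod 2) : UAlg D →ₗ[Rπ] UAlg D := twist parChi (upar D) γ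

theorem ptw_of_mem (γ : ZMod 2) {δ : ZMod 2} {x : UAlg D} (hx : x ∈ upar D δ) :
    ptw D γ x = parChi.toFun γ δ • x := twist_of_mem parChi (upar D) γ hx

theorem ptw_mul (γ : ZMod 2) (a b : UAlg D) : ptw D γ (a * b) = ptw D γ a * ptw D γ b := by
  refine DirectSum.Decomposition.inductionOn (upar D) (motive := fun a =>
    ptw D γ (a * b) = ptw D γ a * ptw D γ b) ?_ ?_ ?_ a
  · rw [zero_mul, map_zero, zero_mul]
  · intro δ a
    refine DirectSum.Decomposition.inductionOn (upar D) (motive := fun b =>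
      ptw D γ (a * b) = ptw D γ a * ptw D γ b) ?_ ?_ ?_ b
    · rw [mul_zero, map_zero, mul_zero]
    · intro ε b
      rw [ptw_of_mem D γ (SetLike.mul_mem_graded a.2 b.2), ptw_of_mem D γ a.2, ptw_of_mem D γ b.2,
        parChi.add_right, smul_mul_smul_comm]
    · intro b b' h h'
      rw [mul_add, map_add, h, h', map_add, mul_add]
  · intro b b' h h'
    rw [add_mul, map_add, h, h', map_add, add_mul]

theorem ptw_wordGE (γ : ZMod 2) (x : I → UAlg D) (hx : ∀ i, x i ∈ upar D (C.p i)) (n : ℕ)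
    {w : UAlg D} (hw : w ∈ wordGE Rπ x n) : ptw D γ w ∈ wordGE Rπ x n := by
  induction hw using Submodule.span_induction with
  | mem w hw =>
    obtain ⟨l, hl, rfl⟩ := hw
    have : ∃ δ, (l.map x).prod ∈ upar D δ := by
      clear hl
      induction l with
      | nil => exact ⟨0, uOne_mem D⟩
      | cons i l ih =>
        obtain ⟨δ, hδ⟩ := ih
        exact ⟨_, by rw [List.map_cons, List.prod_cons]; exact SetLike.mul_mem_graded (hx i) hδ⟩
    obtain ⟨δ, hδ⟩ := this
    rw [ptw_of_mem D γ hδ]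
    exact Submodule.smul_mem _ _ (word_mem_wordGE x l hl)
  | zero => rw [map_zero]; exact zero_mem _
  | add a b _ _ ha hb => rw [map_add]; exact add_mem ha hb
  | smul r a _ ha => rw [map_smul]; exact Submodule.smul_mem _ _ ha

theorem uZero_mem {t : UAlg D} (ht : t ∈ uZero D) : t ∈ upar D 0 := by
  induction ht using Algebra.adjoin_induction with
  | mem t ht =>
    rcases ht with ⟨μ, rfl⟩ | ⟨μ, rfl⟩
    · exact uJ_mem D μ
    · exact uK_mem D μ
  | algebraMap r => rw [Algebra.algebraMap_eq_smul_one]; exact Submodule.smul_mem _ _ (uOne_mem D)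
  | add a b _ _ ha hb => exact add_mem ha hb
  | mul a b _ _ ha hb => simpa using SetLike.mul_mem_graded ha hb

theorem ptw_triL (γ : ZMod 2) (x y : I → UAlg D) (hx : ∀ i, x i ∈ upar D (C.p i))
    (hy : ∀ i, y i ∈ upar D (C.p i)) (n : ℕ) {a : UAlg D} (ha : a ∈ triL x y (uZero D) n) :
    ptw D γ a ∈ triL x y (uZero D) n := by
  refine Submodule.mul_induction_on ha (fun a ha v hv => ?_) (fun a b ha hb => ?_)
  · rw [ptw_mul]
    refine Submodule.mul_mem_mul ?_ (ptw_wordGE D γ y hy n hv)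
    refine Submodule.mul_induction_on ha (fun w hw t ht => ?_) (fun a b ha hb => ?_)
    · rw [ptw_mul, ptw_of_mem D γ (uZero_mem D ht), parChi.zero_right, one_smul]
      exact Submodule.mul_mem_mul (ptw_wordGE D γ x hx 0 hw) ht
    · rw [map_add]; exact add_mem ha hb
  · rw [map_add]; exact add_mem ha hb

theorem tU_mul_of_left {δ : ZMod 2} {d : UAlg D} (hd : d ∈ upar D δ) (c a b : UAlg D) :
    tU D c d * tU D a b = tU D (c * ptw D δ a) (d * b) := by
  refine DirectSum.Decomposition.inductionOn (upar D) (motive := fun a =>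
    tU D c d * tU D a b = tU D (c * ptw D δ a) (d * b)) ?_ ?_ ?_ a
  · rw [tU_zero_left, mul_zero, map_zero, mul_zero, tU_zero_left]
  · intro γ a
    rw [tt_mul_tt parChi (upar D) c b hd a.2, ptw_of_mem D δ a.2, mul_smul_comm, tU_smul_left]
  · intro a a' h h'
    rw [tU_add_left, mul_add, h, h', map_add, mul_add, tU_add_left]

theorem parChi_comm (a b : ZMod 2) : parChi.toFun a b = parChi.toFun b a := by
  simp only [parChi, mul_comm]

theorem tU_mul_of_right {γ : ZMod 2} {c : UAlg D} (hc : c ∈ upar D γ) (a b d : UAlg D) :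
    tU D a b * tU D c d = tU D (a * c) (ptw D γ b * d) := by
  refine DirectSum.Decomposition.inductionOn (upar D) (motive := fun b =>
    tU D a b * tU D c d = tU D (a * c) (ptw D γ b * d)) ?_ ?_ ?_ b
  · rw [tU_zero_right, zero_mul, map_zero, zero_mul, tU_zero_right]
  · intro β b
    rw [tt_mul_tt parChi (upar D) a d b.2 hc, ptw_of_mem D γ b.2, smul_mul_assoc, tU_smul_right,
      parChi_comm]
  · intro a a' h h'
    rw [tU_add_right, add_mul, h, h', map_add, add_mul, tU_add_right]

theorem HN_left_mem {N : ℕ} {a : UAlg D} (ha : a ∈ uPM D N) (b : UAlg D) : tU D a b ∈ HN D N :=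
  Submodule.mem_sup_left (Submodule.subset_span ⟨a, ha, b, rfl⟩)

theorem HN_right_mem {N : ℕ} (a : UAlg D) {b : UAlg D} (hb : b ∈ uMP D N) : tU D a b ∈ HN D N :=
  Submodule.mem_sup_right (Submodule.subset_span ⟨a, b, hb, rfl⟩)

theorem HN_induction {N : ℕ} {P : UU D → Prop} (h0 : P 0) (hadd : ∀ x y, P x → P y → P (x + y))
    (hsmul : ∀ (r : Rπ) x, P x → P (r • x)) (hl : ∀ a ∈ uPM D N, ∀ b, P (tU D a b))
    (hr : ∀ a, ∀ b ∈ uMP D N, P (tU D a b)) {x : UU D} (hx : x ∈ HN D N) : P x := by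
  rw [HN, ← Submodule.span_union] at hx
  induction hx using Submodule.span_induction with
  | mem x hx =>
    rcases hx with ⟨a, ha, b, rfl⟩ | ⟨a, b, hb, rfl⟩
    · exact hl a ha b
    · exact hr a b hb
  | zero => exact h0
  | add x y _ _ h h' => exact hadd x y h h'
  | smul r x _ h => exact hsmul r x h

theorem HN_anti {M N : ℕ} (h : M ≤ N) : HN D N ≤ HN D M := by
  have h1 : uPM D N ≤ uPM D M := by rw [uPM_eq, uPM_eq]; exact triL_anti _ _ _ h
  have h2 : uMP D N ≤ uMP D M := by rw [uMP_eq, uMP_eq]; exact triL_anti _ _ _ h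
  intro x hx
  exact HN_induction D (zero_mem _) (fun _ _ => add_mem) (fun r _ => Submodule.smul_mem _ r)
    (fun a ha b => HN_left_mem D (h1 ha) b) (fun a b hb => HN_right_mem D a (h2 hb)) hx

/-- `H_N` is a left ideal. -/
theorem mul_mem_HN {N : ℕ} (u : UU D) {x : UU D} (hx : x ∈ HN D N) : u * x ∈ HN D N := by
  induction u using tt_induction with
  | h0 => rw [zero_mul]; exact zero_mem _
  | hadd u u' h h' => rw [add_mul]; exact add_mem h h'
  | h γ δ c d hc hd =>
    refine HN_induction D (P := fun x => tU D c d * x ∈ HN D N) ?_ ?_ ?_ ?_ ?_ hx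
    · rw [mul_zero]; exact zero_mem _
    · intro x y h h'; rw [mul_add]; exact add_mem h h'
    · intro r x h; rw [mul_smul_comm]; exact Submodule.smul_mem _ _ h
    · intro a ha b
      rw [tU_mul_of_left D hd]
      rw [uPM_eq] at ha
      refine HN_left_mem D ?_ _
      rw [uPM_eq]
      exact (tri_EF D).mul_mem N c (ptw_triL D δ _ _ (uE_mem D) (uF_mem D) N ha)
    · intro a b hb
      rw [tU_mul_of_left D hd]
      rw [uMP_eq] at hb
      refine HN_right_mem D _ ?_
      rw [uMP_eq]
      exact (tri_FE D).mul_mem N d hb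

/-- For any `u ∈ U ⊗ U` there is an `r` with `H_{N+r} u ⊆ H_N` for all `N`. -/
theorem exists_HN_mul (u : UU D) : ∃ r, ∀ N, ∀ x ∈ HN D (N + r), x * u ∈ HN D N := by
  induction u using tt_induction with
  | h0 => exact ⟨0, fun N x _ => by rw [mul_zero]; exact zero_mem _⟩
  | hadd u u' h h' =>
    obtain ⟨r, hr⟩ := h
    obtain ⟨r', hr'⟩ := h'
    refine ⟨max r r', fun n x hx => ?_⟩
    rw [mul_add]
    exact add_mem (hr n x (HN_anti D (by omega) hx)) (hr' n x (HN_anti D (by omega) hx))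
  | h γ δ c d hc hd =>
    obtain ⟨r, hr⟩ := (tri_EF D).exists_mul_mem c
    obtain ⟨r', hr'⟩ := (tri_FE D).exists_mul_mem d
    refine ⟨max r r', fun N x hx => ?_⟩
    refine HN_induction D (P := fun x => x * tU D c d ∈ HN D N) ?_ ?_ ?_ ?_ ?_ hx
    · rw [zero_mul]; exact zero_mem _
    · intro x y h h'; rw [add_mul]; exact add_mem h h'
    · intro r x h; rw [smul_mul_assoc]; exact Submodule.smul_mem _ _ h
    · intro a ha b
      rw [tU_mul_of_right D hc]
      rw [uPM_eq] at ha
      refine HN_left_mem D ?_ _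
      rw [uPM_eq]
      exact hr N a (triL_anti _ _ _ (by omega) ha)
    · intro a b hb
      rw [tU_mul_of_right D hc]
      rw [uMP_eq] at hb
      refine HN_right_mem D _ ?_
      rw [uMP_eq]
      exact hr' N _ (ptw_triL D γ _ _ (uF_mem D) (uE_mem D) _ (triL_anti _ _ _ (by omega) hb))

/-! ### The completion of `U ⊗ U` -/

theorem HN_basis : RingSubgroupsBasis fun N : ℕ => (HN D N).toAddSubgroup where
  inter i j := ⟨max i j, fun _ hx => ⟨HN_anti D (le_max_left i j) hx,
    HN_anti D (le_max_right i j) hx⟩⟩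
  mul i := ⟨i, by
    rintro _ ⟨a, -, b, hb, rfl⟩
    exact mul_mem_HN D a hb⟩
  leftMul x i := ⟨i, fun y hy => mul_mem_HN D x hy⟩
  rightMul x i := by
    obtain ⟨r, hr⟩ := exists_HN_mul D x
    exact ⟨i + r, fun y hy => hr i y hy⟩

/-- The topology of `U ⊗ U` for which the `H_N` are a basis of neighbourhoods of `0`. -/
instance : TopologicalSpace (UU D) := (HN_basis D).topology

theorem HN_hasBasis : (nhds (0 : UU D)).HasBasis (fun _ : ℕ => True) fun N => (HN D N : Set (UU D)) :=
  (HN_basis D).hasBasis_nhds_zero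

instance : IsTopologicalRing (UU D) :=
  (HN_basis D).toRingFilterBasis.isTopologicalRing

instance : UniformSpace (UU D) := IsTopologicalAddGroup.rightUniformSpace (UU D)

instance : IsUniformAddGroup (UU D) := isUniformAddGroup_of_addCommGroup

/-- The completion `(U ⊗ U)^` of `U ⊗ U`, the inverse limit of the quotients `(U ⊗ U) / H_N`, with
the multiplication that extends the one of `U ⊗ U` by continuity. -/
abbrev UUhat : Type _ := UniformSpace.Completion (UU D)

end


/-! ## The quasi-R-matrix -/

section

variable {I : Type*} [DecidableEq I] (C : SuperCartanDatum I)

/-- `e(ν) = ∑_{a < b} p(i_a) p(i_b)` where `ν = i_1 + ⋯ + i_n`: the second elementary symmetric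
function of the multiset `p(i_1), …, p(i_n)`. -/
def SuperCartanDatum.e (ν : I →₀ ℕ) : ℕ := ((Finsupp.toMultiset ν).map C.p).esymm 2

/-- `q_ν = ∏_i q_i ^ ν_i`. -/
def SuperCartanDatum.qν (ν : I →₀ ℕ) : Rπ := ν.prod fun i a => (C.qi i : Rπ) ^ a

/-- `π_ν = ∏_i π_i ^ ν_i`. -/
def SuperCartanDatum.pν (ν : I →₀ ℕ) : Rπ := ν.prod fun i a => C.pii i ^ a

theorem SuperCartanDatum.e_zero : C.e 0 = 0 := by
  simp [SuperCartanDatum.e, Multiset.esymm, Multiset.powersetCard_zero_right]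

theorem SuperCartanDatum.e_single_add (i : I) (ν : I →₀ ℕ) :
    C.e (Finsupp.single i 1 + ν) = C.e ν + C.p i * C.pw ν := by
  have h : ((Finsupp.toMultiset ν).map C.p).sum = C.pw ν := by
    clear i
    induction ν using Finsupp.induction_linear with
    | zero => simp [C.pw_zero]
    | add a b ha hb => rw [map_add, Multiset.map_add, Multiset.sum_add, ha, hb, C.pw_add]
    | single i n => simp [SuperCartanDatum.pw, Multiset.map_nsmul, Multiset.sum_nsmul]
  simp only [SuperCartanDatum.e, map_add, Finsupp.toMultiset_single, one_smul,
    Multiset.singleton_add, Multiset.map_cons, Multiset.esymm, Multiset.powersetCard_cons,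
    Multiset.map_add, Multiset.sum_add, Multiset.map_map, Function.comp_def, Multiset.prod_cons]
  rw [Multiset.sum_map_mul_left, Multiset.powersetCard_one, Multiset.map_map]
  simp [h]

/-- `bs` is the basis of `f_ν` dual, for the bilinear form, to the subset `S` of `f_ν`. -/
structure IsDualBasis (ν : I →₀ ℕ) (S : Set (fAlg C)) (bs : S → fAlg C) : Prop where
  linearIndependent : LinearIndependent Rπ bs
  span_range : Submodule.span Rπ (Set.range bs) = fAlgWt C ν
  form_self : ∀ b : S, fForm C b (bs b) = 1
  form_ne : ∀ b b' : S, b ≠ b' → fForm C b (bs b') = 0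

variable {C} {Y X : Type*} [AddCommGroup Y] [AddCommGroup X] (D : RootDatum C Y X)

/-- The subspace `U⁻_ν ⊗ U⁺_ν` of `U ⊗ U`. -/
def uMinusPlus (ν : I →₀ ℕ) : Submodule Rπ (UU D) :=
  Submodule.span Rπ {x | ∃ a ∈ uMinusWt D ν, ∃ b ∈ uPlusWt D ν, x = tU D a b}

/-- The element `Θ = ∑_ν Θ_ν` of `(U ⊗ U)^` exists and has the defining properties of the
quasi-R-matrix. -/
structure IsQuasiR [Fintype I] [C.Consistent] (Θ : (I →₀ ℕ) → UU D) : Prop where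
  mem : ∀ ν, Θ ν ∈ uMinusPlus D ν
  zero : Θ 0 = tU D 1 1
  intertwines : ∃ T : UUhat D, HasSum (fun ν => (Θ ν : UUhat D)) T ∧
    ∀ u : UAlg D, (delta D u : UUhat D) * T = T * (deltaBar D u : UUhat D)

end

end QCov

end

open scoped TensorProduct DirectSum Polynomial

set_option linter.unusedSectionVars false

noncomputable section

namespace QCov

/-! ## Right skew derivations and the reversal of `'f` -/

section

variable {I : Type*} [DecidableEq I] (C : SuperCartanDatum I)

/-! The form on a weight space `f_ν` is nondegenerate and symmetric, and `ℚ(q)^π` is a semisimple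
ring, so the form is perfect on `f_ν` (`form_surjective_of_nondeg`). Hence there is a canonical
element of `f_ν ⊗ f_ν`, computable from any pair of dual families (`canon`, `canon_eq`), whether or
not `f_ν` is free. The solution is `qR`: the image of the canonical element in `U⁻ ⊗ U⁺`, times the
scalar of (b). Part (b) is then the remark that a basis of `f_ν` and its dual basis form such a pair
of families.

Existence. The commutator of `E_i` with `x⁻` is expressed by the two skew derivations `ᵢr(x)` and
`bar (ᵢr (bar x))` with torus coefficients (`uE_mul_minus`). Up to scalars these derivations are
adjoint to left and right multiplication by `θ_i`, and adjoint maps have the same effect on the two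
sides of the canonical elements (`map_canon_left`). So the commutator of `E_i ⊗ 1` with `Θ_{ν+i}`
can be compared with the remaining terms of the relation, which multiply the second factor of `Θ_ν`
by `E_i` on the left and on the right. They cancel exactly when the scalars satisfy the recursion
`sc_add` (`qR_E`). The case of `F_i` is parallel with the factors exchanged (`qR_F`), the torus
commutes with each `Θ_ν` by weights, and `Θ_ν ∈ H_{ht ν}` gives convergence (`isQuasiR_qR`).

Uniqueness. The difference `f` of two solutions intertwines `Δ` and `Δ̄` and has `f 0 = 0`. It must
vanish in `U ⊗ U` itself, although neither the injectivity of `f → U^±` nor the separatedness of the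
topology is available. Matrix coefficients serve as test functionals: `U` acts on `f` as a lowest
weight module of weight `0` and as a highest weight module of any weight `λ` (`isRep_low`,
`isRep_high`). On these modules `F_i`, respectively `E_i`, acts by a multiple of the adjoint of
right multiplication by `θ_i`. The coefficient `(x⁻ z, 1)` on the first, and `(x⁺ z, 1)` on the
second, is therefore a unit times `(z, x)`, and a product of two coefficients kills `H_N` for large
`N` (`exists_pairF_eq_zero`), so it may be applied to a relation in the completion.

For `ν` of minimal height among the weights not yet known to satisfy `f ν = 0`, the relation for
`F_i` then isolates the commutator of `1 ⊗ F_i` with `f ν`. If `Y` is a contraction of `f ν` in its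
first factor, this says that `q^{λ_i} bar (ᵢr (bar Y))` and `q^{-λ_i} ᵢr(Y)` have the same pairings
with everything. Two values of `λ` force `ᵢr(Y) = 0` for all `i`, hence `Y = 0`, and `f ν = 0`
follows (`eq_zero_of_intertwines`). -/

/-- The twisted derivation `r_i`, adjoint to right multiplication by `θ_i`. -/
def rr (i : I) : FreeF I →ₗ[Rπ] FreeF I := tw C i ∘ₗ irb C i

theorem rr_apply (i : I) (x : FreeF I) : rr C i x = tw C i (irb C i x) := rfl

theorem rr_one (i : I) : rr C i 1 = 0 := by rw [rr_apply, irb_one, map_zero]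

/-- Composing with `tw C i` removes the scalar in front of `th j * irb C i x` and twists the other
term instead. In this normalisation the Leibniz rule is the mirror image of `ir_mul_th`. -/
theorem rr_mul [C.Consistent] (i j : I) (x : FreeF I) : rr C i (th j * x) =
    (if i = j then (1 : Rπ) else 0) • tw C i x + th j * rr C i x := by
  rw [rr_apply, irb_mul, map_add, map_smul, map_smul, tw_mul, smul_smul, Units.inv_mul, one_smul,
    rr_apply]

theorem form_mul_th_rr [C.Consistent] (i : I) (x y : FreeF I) :
    form C x (y * th i) = C.cc i * form C (rr C i x) y := by
  rw [form_mul_th, ← form_tw, rr_apply]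

theorem ir_mul_th (i j : I) (x : FreeF I) : ir C i (x * th j) =
    ir C i x * th j + (if i = j then (1 : Rπ) else 0) • tw C i x := by
  induction x using FreeF.induction_left with
  | h1 =>
    have := ir_mul C i j 1
    rw [mul_one, ir_one, mul_zero, smul_zero, add_zero] at this
    rw [one_mul, this, ir_one, zero_mul, zero_add, tw_one]
  | hadd x y hx hy => simp only [map_add, add_mul, hx, hy, smul_add]; abel
  | hsmul r x hx => simp only [map_smul, smul_mul_assoc, hx, smul_add, smul_comm r]
  | hmul k x hx =>
    rw [mul_assoc, ir_mul, ir_mul, hx, tw_mul, add_mul, mul_add, smul_add, smul_mul_assoc,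
      smul_mul_assoc, mul_smul_comm, smul_comm (C.chiU i k : Rπ) (if i = j then (1 : Rπ) else 0),
      mul_assoc, add_assoc]

theorem star_th (i : I) : star (th i : FreeF I) = th i := FreeAlgebra.star_ι i

theorem star_smul' (r : Rπ) (x : FreeF I) : star (r • x) = r • star x := by
  rw [Algebra.smul_def, Algebra.smul_def, star_mul, FreeAlgebra.star_algebraMap, Algebra.commutes]

/-- The rule for `ir` on a product ending in a generator and the rule for `rr` on a product
beginning with one are mirror images, so both sides obey the same recursion. -/
theorem ir_star [C.Consistent] (i : I) (x : FreeF I) : ir C i (star x) = star (rr C i x) := by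
  have htw : ∀ y : FreeF I, tw C i (star y) = star (tw C i y) := by
    intro y
    have hr : ∀ (j : I) (y : FreeF I), tw C i (y * th j) = (C.chiU i j : Rπ) • (tw C i y * th j) := by
      intro j y
      induction y using FreeF.induction_left with
      | h1 =>
        have := tw_mul C i j 1
        rw [mul_one, tw_one, mul_one] at this
        rw [one_mul, this, tw_one, one_mul]
      | hadd x y hx hy => simp only [map_add, add_mul, hx, hy, smul_add]
      | hsmul r x hx => simp only [map_smul, smul_mul_assoc, hx, smul_comm r]
      | hmul k x hx =>
        rw [mul_assoc, tw_mul, hx, tw_mul, mul_smul_comm, smul_mul_assoc, mul_assoc, smul_comm]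
    induction y using FreeF.induction_left with
    | h1 => rw [star_one, tw_one, star_one]
    | hadd x y hx hy => simp only [map_add, star_add, hx, hy]
    | hsmul r x hx => simp only [map_smul, star_smul', hx]
    | hmul k x hx => rw [star_mul, star_th, hr, hx, tw_mul, star_smul', star_mul, star_th]
  induction x using FreeF.induction_left with
  | h1 => rw [star_one, ir_one, rr_one, star_zero]
  | hadd x y hx hy => simp only [map_add, star_add, hx, hy]
  | hsmul r x hx => simp only [map_smul, star_smul', hx]
  | hmul k x hx =>
    rw [star_mul, star_th, ir_mul_th, hx, rr_mul, star_add, star_smul', star_mul, star_th, htw,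
      add_comm]

theorem rr_mul_th [C.Consistent] (i j : I) (x : FreeF I) : rr C i (x * th j) =
    (if i = j then (1 : Rπ) else 0) • x + (C.chiU i j : Rπ) • (rr C i x * th j) := by
  have h : ∀ y, rr C i y = star (ir C i (star y)) := fun y => by rw [ir_star, star_star]
  rw [h, star_mul, star_th, ir_mul, star_add, star_smul', star_smul', star_mul, star_th, star_star,
    ← h]

theorem eps_star (x : FreeF I) : eps I (star x) = eps I x := by
  induction x using FreeF.induction_left with
  | h1 => rw [star_one]
  | hadd x y hx hy => simp only [map_add, star_add, hx, hy]
  | hsmul r x hx => simp only [map_smul, star_smul', hx]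
  | hmul k x hx => rw [star_mul, star_th, map_mul, eps_mul]; simp [eps]

/-- The reversal exchanges left and right multiplication by `θ_k`, and `ir_star` says that it
exchanges their adjoints, with the same constant `C.cc k`. The purpose is `star_mem_rad`: right
multiplications satisfy the relations of `f` only because reversed relations are again relations. -/
theorem form_star [C.Consistent] (x y : FreeF I) : form C (star x) (star y) = form C x y := by
  induction y using FreeF.induction_left generalizing x with
  | h1 => rw [star_one, form_one_right, form_one_right, eps_star]
  | hadd y y' hx hy => simp only [map_add, star_add, hx, hy]
  | hsmul r y hy => simp only [map_smul, star_smul', hy]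
  | hmul k y hy =>
    have h : rr C k (star x) = star (ir C k x) := by
      conv_rhs => rw [← star_star x, ir_star, star_star]
    rw [star_mul, star_th, form_mul_th_rr, form_mul_right, h, hy]

theorem star_mem_rad [C.Consistent] {x : FreeF I} (hx : x ∈ rad C) : star x ∈ rad C := fun y => by
  rw [← star_star y, form_star]; exact hx _

/-! ### Weights -/

theorem ir_mem_fwt (i : I) {ν : I →₀ ℕ} {x : FreeF I} (hx : x ∈ fwt I (ν + Finsupp.single i 1)) :
    ir C i x ∈ fwt I ν := by
  induction hx using Submodule.span_induction with
  | mem x hx =>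
    obtain ⟨l, hl, rfl⟩ := hx
    refine Submodule.span_mono ?_ (ir_word C i l)
    rintro _ ⟨m, hm, rfl⟩
    exact ⟨m, add_right_cancel (hm.trans hl), rfl⟩
  | zero => rw [map_zero]; exact zero_mem _
  | add x y _ _ hx hy => rw [map_add]; exact add_mem hx hy
  | smul r x _ hx => rw [map_smul]; exact Submodule.smul_mem _ _ hx

theorem ir_eq_zero (i : I) {ν : I →₀ ℕ} (hν : ν i = 0) {x : FreeF I} (hx : x ∈ fwt I ν) :
    ir C i x = 0 := by
  induction hx using Submodule.span_induction with
  | mem x hx =>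
    obtain ⟨l, hl, rfl⟩ := hx
    have h := ir_word C i l
    rw [hl] at h
    have : {x : FreeF I | ∃ m : List I, (m.map fun i => Finsupp.single i 1).sum +
      Finsupp.single i 1 = ν ∧ (m.map fun i => th i).prod = x} = ∅ := by
      refine Set.eq_empty_of_forall_notMem ?_
      rintro _ ⟨m, hm, -⟩
      rw [← hm] at hν
      simp at hν
    rwa [this, Submodule.span_empty, Submodule.mem_bot] at h
  | zero => rw [map_zero]
  | add x y _ _ hx hy => rw [map_add, hx, hy, add_zero]
  | smul r x _ hx => rw [map_smul, hx, smul_zero]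

theorem barF_word (l : List I) : barF I (l.map fun i => th i).prod = (l.map fun i => th i).prod := by
  induction l with
  | nil => exact barF_one
  | cons i l ih => rw [List.map_cons, List.prod_cons, barF_mul, barF_th, ih]

/-- Semilinearity is harmless here because the bar involution fixes every word. The set `S` is later
cut out by a weight or by a bound on the length. -/
theorem barF_mem_span {S : Set (List I)} {x : FreeF I}
    (hx : x ∈ Submodule.span Rπ ((fun l : List I => (l.map fun i => th i).prod) '' S)) :
    barF I x ∈ Submodule.span Rπ ((fun l : List I => (l.map fun i => th i).prod) '' S) := by
  induction hx using Submodule.span_induction with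
  | mem x hx =>
    obtain ⟨l, hl, rfl⟩ := hx
    rw [barF_word]
    exact Submodule.subset_span ⟨l, hl, rfl⟩
  | zero => rw [map_zero]; exact zero_mem _
  | add x y _ _ hx hy => rw [map_add]; exact add_mem hx hy
  | smul r x _ hx => rw [LinearMap.map_smulₛₗ]; exact Submodule.smul_mem _ _ hx

theorem barF_mem_fwt {ν : I →₀ ℕ} {x : FreeF I} (hx : x ∈ fwt I ν) : barF I x ∈ fwt I ν :=
  barF_mem_span (S := {l : List I | (l.map fun i => Finsupp.single i 1).sum = ν}) hx

theorem barF_mem_lenLT {n : ℕ} {x : FreeF I} (hx : x ∈ lenLT I n) : barF I x ∈ lenLT I n :=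
  barF_mem_span (S := {l : List I | l.length < n}) hx

theorem irb_mem_fwt (i : I) {ν : I →₀ ℕ} {x : FreeF I} (hx : x ∈ fwt I (ν + Finsupp.single i 1)) :
    irb C i x ∈ fwt I ν := barF_mem_fwt (ir_mem_fwt C i (barF_mem_fwt hx))

theorem irb_eq_zero (i : I) {ν : I →₀ ℕ} (hν : ν i = 0) {x : FreeF I} (hx : x ∈ fwt I ν) :
    irb C i x = 0 := by
  change barF I (ir C i (barF I x)) = 0
  rw [ir_eq_zero C i hν (barF_mem_fwt hx), map_zero]

theorem rr_mem_fwt (i : I) {ν : I →₀ ℕ} {x : FreeF I} (hx : x ∈ fwt I (ν + Finsupp.single i 1)) :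
    rr C i x ∈ fwt I ν := by
  rw [rr_apply, twist_of_mem C.chi (fwt I) _ (irb_mem_fwt C i hx)]
  exact Submodule.smul_mem _ _ (irb_mem_fwt C i hx)

theorem rr_eq_zero (i : I) {ν : I →₀ ℕ} (hν : ν i = 0) {x : FreeF I} (hx : x ∈ fwt I ν) :
    rr C i x = 0 := by rw [rr_apply, irb_eq_zero C i hν hx, map_zero]

theorem tw_mem_lenLT (i : I) {n : ℕ} {x : FreeF I} (hx : x ∈ lenLT I n) : tw C i x ∈ lenLT I n := by
  induction hx using Submodule.span_induction with
  | mem x hx =>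
    obtain ⟨l, hl, rfl⟩ := hx
    rw [twist_of_mem C.chi (fwt I) _ (word_mem_wordGr (fun i : I => th i) _ l)]
    exact Submodule.smul_mem _ _ (Submodule.subset_span ⟨l, hl, rfl⟩)
  | zero => rw [map_zero]; exact zero_mem _
  | add x y _ _ hx hy => rw [map_add]; exact add_mem hx hy
  | smul r x _ hx => rw [map_smul]; exact Submodule.smul_mem _ _ hx

theorem rr_lenLT (i : I) {n : ℕ} {x : FreeF I} (hx : x ∈ lenLT I (n + 1)) : rr C i x ∈ lenLT I n :=
  tw_mem_lenLT C i (barF_mem_lenLT (ir_lenLT C i (barF_mem_lenLT hx)))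

theorem rr_mem_rad [C.Consistent] (i : I) {x : FreeF I} (hx : x ∈ rad C) : rr C i x ∈ rad C := by
  intro y
  have h := form_mul_th_rr C i x y
  rw [hx] at h
  exact ((C.isUnit_cc i).mul_right_eq_zero).mp h.symm

/-! ### Operators on `f` -/

theorem fwt_sum_induction {P : FreeF I → Prop} (hadd : ∀ x y, P x → P y → P (x + y))
    (h : ∀ (ν : I →₀ ℕ) (x : FreeF I), x ∈ fwt I ν → P x) (x : FreeF I) : P x :=
  DirectSum.Decomposition.inductionOn (fwt I) (h 0 0 (zero_mem _)) (fun {ν} x => h ν x x.2) hadd x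

/-- The endomorphism of `f` induced by an endomorphism of `'f` that preserves the radical. -/
def descend (g : Module.End Rπ (FreeF I)) (hg : ∀ x ∈ rad C, g x ∈ rad C) : Module.End Rπ (fAlg C) :=
  fLiftLin C ((fmk C).toLinearMap ∘ₗ g) fun x hx => (fmk_eq_zero C).mpr (hg x hx)

theorem fmk_mem {ν : I →₀ ℕ} {x : FreeF I} (hx : x ∈ fwt I ν) : fmk C x ∈ fAlgWt C ν :=
  ⟨x, hx, rfl⟩

theorem fForm_symm (x y : fAlg C) : fForm C x y = fForm C y x := by
  obtain ⟨x, rfl⟩ := fmk_surjective C x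
  obtain ⟨y, rfl⟩ := fmk_surjective C y
  exact form_symm C x y

theorem fForm_nondeg {x : fAlg C} (h : ∀ y, fForm C x y = 0) : x = 0 := by
  obtain ⟨x, rfl⟩ := fmk_surjective C x
  exact (fmk_eq_zero C).mpr fun y => h (fmk C y)

theorem fForm_eq_zero_of_ne {ν μ : I →₀ ℕ} (h : ν ≠ μ) {x y : fAlg C} (hx : x ∈ fAlgWt C ν)
    (hy : y ∈ fAlgWt C μ) : fForm C x y = 0 := by
  obtain ⟨x, hx, rfl⟩ := hx
  obtain ⟨y, hy, rfl⟩ := hy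
  exact form_eq_zero_of_ne C h hx hy

theorem fAlg_sum_induction {P : fAlg C → Prop} (hadd : ∀ x y, P x → P y → P (x + y))
    (h : ∀ (ν : I →₀ ℕ) (x : fAlg C), x ∈ fAlgWt C ν → P x) (x : fAlg C) : P x := by
  obtain ⟨x, rfl⟩ := fmk_surjective C x
  refine fwt_sum_induction (P := fun x => P (fmk C x)) (fun x y hx hy => ?_)
    (fun ν x hx => h ν _ (fmk_mem C hx)) x
  rw [map_add]; exact hadd _ _ hx hy

/-- The form is nondegenerate on every weight space. -/
theorem fForm_nondeg_wt {ν : I →₀ ℕ} {x : fAlg C} (hx : x ∈ fAlgWt C ν)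
    (h : ∀ y ∈ fAlgWt C ν, fForm C x y = 0) : x = 0 := by
  refine fForm_nondeg C fun y => ?_
  refine fAlg_sum_induction C (P := fun y => fForm C x y = 0) (fun y z hy hz => ?_)
    (fun μ y hy => ?_) y
  · rw [map_add, hy, hz, add_zero]
  · by_cases hμ : ν = μ
    · subst hμ; exact h y hy
    · exact fForm_eq_zero_of_ne C hμ hx hy

/-- The generator `θ_i` of `f`. -/
def thA (i : I) : fAlg C := fmk C (th i)

theorem thA_mul_mem (i : I) {ν : I →₀ ℕ} {x : fAlg C} (hx : x ∈ fAlgWt C ν) :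
    thA C i * x ∈ fAlgWt C (ν + Finsupp.single i 1) := by
  obtain ⟨x, hx, rfl⟩ := hx
  rw [add_comm]
  exact ⟨th i * x, SetLike.mul_mem_graded (th_mem i) hx, map_mul (fmk C) _ _⟩

theorem mul_thA_mem (i : I) {ν : I →₀ ℕ} {x : fAlg C} (hx : x ∈ fAlgWt C ν) :
    x * thA C i ∈ fAlgWt C (ν + Finsupp.single i 1) := by
  obtain ⟨x, hx, rfl⟩ := hx
  exact ⟨x * th i, SetLike.mul_mem_graded hx (th_mem i), map_mul (fmk C) _ _⟩

/-- The map on `f` induced by `ᵢr`. -/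
def irA (i : I) : Module.End Rπ (fAlg C) := descend C (ir C i) fun _ => ir_mem_rad C i

/-- The map on `f` induced by `x ↦ bar (ᵢr (bar x))`. -/
def irbA [C.Consistent] (i : I) : Module.End Rπ (fAlg C) :=
  descend C (irb C i) fun _ => irb_mem_rad C i

theorem irA_mem (i : I) {ν : I →₀ ℕ} {x : fAlg C} (hx : x ∈ fAlgWt C (ν + Finsupp.single i 1)) :
    irA C i x ∈ fAlgWt C ν := by
  obtain ⟨x, hx, rfl⟩ := hx
  exact fmk_mem C (ir_mem_fwt C i hx)

theorem irbA_mem [C.Consistent] (i : I) {ν : I →₀ ℕ} {x : fAlg C}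
    (hx : x ∈ fAlgWt C (ν + Finsupp.single i 1)) : irbA C i x ∈ fAlgWt C ν := by
  obtain ⟨x, hx, rfl⟩ := hx
  exact fmk_mem C (irb_mem_fwt C i hx)

theorem irA_eq_zero (i : I) {ν : I →₀ ℕ} (hν : ν i = 0) {x : fAlg C} (hx : x ∈ fAlgWt C ν) :
    irA C i x = 0 := by
  obtain ⟨x, hx, rfl⟩ := hx
  exact (congrArg (fmk C) (ir_eq_zero C i hν hx)).trans (map_zero _)

theorem irbA_eq_zero [C.Consistent] (i : I) {ν : I →₀ ℕ} (hν : ν i = 0) {x : fAlg C}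
    (hx : x ∈ fAlgWt C ν) : irbA C i x = 0 := by
  obtain ⟨x, hx, rfl⟩ := hx
  exact (congrArg (fmk C) (irb_eq_zero C i hν hx)).trans (map_zero _)

theorem fForm_thA_mul (i : I) (x y : fAlg C) :
    fForm C x (thA C i * y) = C.cc i * fForm C (irA C i x) y := by
  obtain ⟨x, rfl⟩ := fmk_surjective C x
  obtain ⟨y, rfl⟩ := fmk_surjective C y
  exact form_mul_right C i x y

/-- The value of the bicharacter is what `tw C i` becomes on a vector of weight `ν`. The adjoint is
stated with `irbA`, and not with `rrA`, because `irbA` is the map that occurs in the commutator of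
`E_i` with `U⁻`. -/
theorem fForm_mul_thA [C.Consistent] (i : I) {ν : I →₀ ℕ} (x : fAlg C) {y : fAlg C}
    (hy : y ∈ fAlgWt C ν) : fForm C x (y * thA C i) =
      C.cc i * C.chi.toFun (Finsupp.single i 1) ν * fForm C (irbA C i x) y := by
  obtain ⟨x, rfl⟩ := fmk_surjective C x
  obtain ⟨y, hy, rfl⟩ := hy
  refine (form_mul_th C i x y).trans ?_
  rw [twist_of_mem C.chi (fwt I) _ hy, map_smul, smul_eq_mul, mul_assoc]
  rfl

/-- An element of `f` of nonzero weight killed by all `ᵢr` vanishes. -/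
theorem eq_zero_of_irA {ν : I →₀ ℕ} (hν : ν ≠ 0) {x : fAlg C} (hx : x ∈ fAlgWt C ν)
    (h : ∀ i, irA C i x = 0) : x = 0 := by
  refine fForm_nondeg C fun y => ?_
  obtain ⟨y, rfl⟩ := fmk_surjective C y
  induction y using FreeF.induction_left with
  | h1 => exact fForm_eq_zero_of_ne C hν hx (fmk_mem C SetLike.GradedOne.one_mem)
  | hadd y y' h h' => rw [map_add, map_add, h, h', add_zero]
  | hsmul r y h => rw [map_smul, map_smul, h, smul_zero]
  | hmul i y _ =>
    rw [map_mul]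
    refine (fForm_thA_mul C i x _).trans ?_
    rw [h, map_zero, LinearMap.zero_apply, mul_zero]

end

/-! ## Perfect pairings and canonical elements -/

section

/-- A nondegenerate symmetric bilinear form on a finitely generated module over `ℚ(q)^π` is
perfect. -/
theorem form_surjective_of_nondeg {M : Type*} [AddCommGroup M] [Module Rπ M] [Module.Finite Rπ M]
    (B : M →ₗ[Rπ] M →ₗ[Rπ] Rπ) (hs : ∀ x y, B x y = B y x)
    (hB : ∀ x, (∀ y, B x y = 0) → x = 0) : Function.Surjective B := by
  have := Module.projective_of_isSemisimpleRing Rπ M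
  have := Module.injective_of_isSemisimpleRing Rπ M
  have hinj : Function.Injective B := (injective_iff_map_eq_zero B).mpr fun x hx =>
    hB x fun y => by rw [hx, LinearMap.zero_apply]
  -- `M` is an injective module, so its identity extends along the embedding `B` to a retraction `g`
  -- of the dual onto `M`.
  obtain ⟨g, hg⟩ := Module.Injective.out B hinj LinearMap.id
  intro φ
  -- `M` is reflexive, so the functional `φ ∘ g` on the dual is evaluation at some `m`. At `B x`
  -- this reads `B x m = φ (g (B x)) = φ x`.
  obtain ⟨m, hm⟩ := (Module.bijective_dual_eval Rπ M).2 (φ ∘ₗ g)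
  refine ⟨m, LinearMap.ext fun x => ?_⟩
  have h := LinearMap.congr_fun hm (B x)
  rw [Module.Dual.eval_apply, LinearMap.comp_apply, hg, LinearMap.id_apply] at h
  rw [hs, h]

variable {I : Type*} [DecidableEq I] (C : SuperCartanDatum I)

/-- A word of weight `ν` has length `ht ν`, and there are finitely many words of a given length. -/
instance fAlgWt_finite [Finite I] (ν : I →₀ ℕ) : Module.Finite Rπ (fAlgWt C ν) := by
  refine Module.Finite.iff_fg.mpr (Submodule.FG.map _ ?_)
  refine Submodule.fg_span (Set.Finite.image _ (s := {l : List I |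
    (l.map fun i => Finsupp.single i 1).sum = ν}) ?_)
  refine (List.finite_length_eq I (SuperCartanDatum.ht ν)).subset ?_
  rintro l rfl
  exact (ht_word l).symm

/-- A linear functional on a weight space of `f` is given by the form. -/
theorem exists_fForm_eq [Finite I] (ν : I →₀ ℕ) (φ : fAlgWt C ν →ₗ[Rπ] Rπ) :
    ∃ n ∈ fAlgWt C ν, ∀ z : fAlgWt C ν, fForm C n z = φ z := by
  obtain ⟨n, hn⟩ := form_surjective_of_nondeg
    ((fForm C).compl₁₂ (fAlgWt C ν).subtype (fAlgWt C ν).subtype)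
    (fun x y => fForm_symm C _ _)
    (fun x hx => Subtype.ext (fForm_nondeg_wt C x.2 fun y hy => hx ⟨y, hy⟩)) φ
  exact ⟨n, n.2, fun z => LinearMap.congr_fun hn z⟩

/-- Families in `f_ν` that are dual to each other for the bilinear form. -/
structure IsDualFamily (ν : I →₀ ℕ) {κ : Type*} [Fintype κ] (m n : κ → fAlg C) : Prop where
  left_mem : ∀ k, m k ∈ fAlgWt C ν
  right_mem : ∀ k, n k ∈ fAlgWt C ν
  sum_left : ∀ z ∈ fAlgWt C ν, ∑ k, fForm C (n k) z • m k = z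
  sum_right : ∀ z ∈ fAlgWt C ν, ∑ k, fForm C (m k) z • n k = z

namespace IsDualFamily

variable {C} {ν : I →₀ ℕ} {κ : Type*} [Fintype κ] {m n : κ → fAlg C}

/-- Pairing the left expansion of `y` with `z` shows, by symmetry of the form, that `z` and its
right expansion have the same pairing with every `y` of weight `ν`. Nondegeneracy on the weight
space finishes. -/
theorem of_left (hm : ∀ k, m k ∈ fAlgWt C ν) (hn : ∀ k, n k ∈ fAlgWt C ν)
    (h : ∀ z ∈ fAlgWt C ν, ∑ k, fForm C (n k) z • m k = z) : IsDualFamily C ν m n := by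
  refine ⟨hm, hn, h, fun z hz => ?_⟩
  refine sub_eq_zero.mp (fForm_nondeg_wt C
    (sub_mem (Submodule.sum_mem _ fun k _ => Submodule.smul_mem _ _ (hn k)) hz) fun y hy => ?_)
  have h1 := congrArg (fForm C z) (h y hy)
  simp only [map_sum, map_smul, smul_eq_mul] at h1
  rw [map_sub, LinearMap.sub_apply, sub_eq_zero, ← h1]
  simp only [map_sum, map_smul, LinearMap.sum_apply, LinearMap.smul_apply, smul_eq_mul]
  exact Finset.sum_congr rfl fun k _ => by rw [fForm_symm C (m k) z, mul_comm]

theorem symm (h : IsDualFamily C ν m n) : IsDualFamily C ν n m :=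
  ⟨h.right_mem, h.left_mem, h.sum_right, h.sum_left⟩

/-- Adjoint maps between weight spaces have the same effect on the two factors of the canonical
elements. -/
theorem adjoint {μ : I →₀ ℕ} {κ' : Type*} [Fintype κ'] {m' n' : κ' → fAlg C}
    (h : IsDualFamily C ν m n) (h' : IsDualFamily C μ m' n') (f g : Module.End Rπ (fAlg C))
    (hf : ∀ x ∈ fAlgWt C ν, f x ∈ fAlgWt C μ) (hg : ∀ x ∈ fAlgWt C μ, g x ∈ fAlgWt C ν)
    (hfg : ∀ x ∈ fAlgWt C ν, ∀ y ∈ fAlgWt C μ, fForm C (f x) y = fForm C x (g y)) :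
    ∑ k, f (m k) ⊗ₜ[Rπ] n k = ∑ k, m' k ⊗ₜ[Rπ] g (n' k) := by
  have e1 : ∀ k, f (m k) ⊗ₜ[Rπ] n k =
      ∑ l, m' l ⊗ₜ[Rπ] (fForm C (m k) (g (n' l)) • n k) := by
    intro k
    conv_lhs => rw [← h'.sum_left (f (m k)) (hf _ (h.left_mem k)), TensorProduct.sum_tmul]
    refine Finset.sum_congr rfl fun l _ => ?_
    rw [TensorProduct.smul_tmul, fForm_symm, hfg _ (h.left_mem k) _ (h'.right_mem l)]
  simp only [e1]
  rw [Finset.sum_comm]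
  refine Finset.sum_congr rfl fun l _ => ?_
  rw [← TensorProduct.tmul_sum, h.sum_right _ (hg _ (h'.right_mem l))]

end IsDualFamily

/-- A weight space is finitely generated and projective, hence a direct summand of a free module of
rank `k`. The images of the standard vectors serve as `m`, and the elements that represent the
coordinates of the splitting serve as `n`. No freeness is needed. -/
theorem exists_isDualFamily [Finite I] (ν : I →₀ ℕ) :
    ∃ (k : ℕ) (m n : Fin k → fAlg C), IsDualFamily C ν m n := by
  have := Module.projective_of_isSemisimpleRing Rπ (fAlgWt C ν)
  obtain ⟨k, f, g, -, -, hfg⟩ := Module.Finite.exists_comp_eq_id_of_projective Rπ (fAlgWt C ν)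
  choose n hn hn' using fun j : Fin k => exists_fForm_eq C ν (LinearMap.proj j ∘ₗ g)
  refine ⟨k, fun j => f (Pi.single j 1), n, .of_left (fun j => (f _).2) hn fun z hz => ?_⟩
  have h1 : f (g ⟨z, hz⟩) = ⟨z, hz⟩ := LinearMap.congr_fun hfg ⟨z, hz⟩
  have h2 : g ⟨z, hz⟩ = ∑ j, g ⟨z, hz⟩ j • (Pi.single j 1 : Fin k → Rπ) := by
    ext j
    simp [Pi.single_apply]
  rw [h2, map_sum] at h1
  have h3 := congrArg Subtype.val h1
  rw [AddSubmonoidClass.coe_finsetSum] at h3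
  refine Eq.trans (Finset.sum_congr rfl fun j _ => ?_) h3
  rw [map_smul, hn' j ⟨z, hz⟩]
  rfl

/-- The canonical element of `f_ν ⊗ f_ν`. -/
def canon [Finite I] (ν : I →₀ ℕ) : fAlg C ⊗[Rπ] fAlg C :=
  ∑ k, (exists_isDualFamily C ν).choose_spec.choose k ⊗ₜ[Rπ]
    (exists_isDualFamily C ν).choose_spec.choose_spec.choose k

/-- Independence of the chosen family is the case of identity maps in `IsDualFamily.adjoint`. -/
theorem canon_eq [Finite I] {ν : I →₀ ℕ} {κ : Type*} [Fintype κ] {m n : κ → fAlg C}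
    (h : IsDualFamily C ν m n) : canon C ν = ∑ k, m k ⊗ₜ[Rπ] n k :=
  ((exists_isDualFamily C ν).choose_spec.choose_spec.choose_spec.adjoint h LinearMap.id
    LinearMap.id (fun _ h => h) (fun _ h => h) fun _ _ _ _ => rfl)

/-- This turns the adjunctions between multiplications and skew derivations into identities between
the canonical elements of neighbouring weights. -/
theorem map_canon_left [Finite I] {ν μ : I →₀ ℕ} (f g : Module.End Rπ (fAlg C))
    (hf : ∀ x ∈ fAlgWt C ν, f x ∈ fAlgWt C μ) (hg : ∀ x ∈ fAlgWt C μ, g x ∈ fAlgWt C ν)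
    (hfg : ∀ x ∈ fAlgWt C ν, ∀ y ∈ fAlgWt C μ, fForm C (f x) y = fForm C x (g y)) :
    TensorProduct.map f LinearMap.id (canon C ν) = TensorProduct.map LinearMap.id g (canon C μ) := by
  obtain ⟨k, m, n, h⟩ := exists_isDualFamily C ν
  obtain ⟨k', m', n', h'⟩ := exists_isDualFamily C μ
  rw [canon_eq C h, canon_eq C h', map_sum, map_sum]
  exact h.adjoint h' f g hf hg hfg

/-- Exchanging the two members of a dual pair gives a dual pair. Every identity in one tensor factor
thereby yields one in the other, which is how the formulas for `F_i` follow from those for `E_i`. -/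
theorem comm_canon [Finite I] (ν : I →₀ ℕ) :
    TensorProduct.comm Rπ _ _ (canon C ν) = canon C ν := by
  obtain ⟨k, m, n, h⟩ := exists_isDualFamily C ν
  rw [canon_eq C h, map_sum, ← canon_eq C h, canon_eq C h.symm]
  rfl

theorem canon_zero [Finite I] : canon C 0 = 1 ⊗ₜ 1 := by
  have h : IsDualFamily C 0 (fun _ : Unit => 1) (fun _ : Unit => 1) := by
    have h1 : (1 : fAlg C) ∈ fAlgWt C 0 := ⟨1, SetLike.GradedOne.one_mem, map_one (fmk C)⟩
    refine .of_left (fun _ => h1) (fun _ => h1) ?_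
    rintro _ ⟨z, hz, rfl⟩
    rw [Finset.univ_unique, Finset.sum_singleton]
    induction hz using Submodule.span_induction with
    | mem z hz =>
      obtain ⟨l, hl, rfl⟩ := hz
      have hl0 : l = [] := by
        rw [← List.length_eq_zero_iff, ← ht_word, hl]
        simp [SuperCartanDatum.ht]
      subst hl0
      have : fForm C 1 1 = 1 := (form_characterization C).1
      rw [List.map_nil, List.prod_nil]
      change fForm C 1 (fmk C 1) • (1 : fAlg C) = fmk C 1
      rw [map_one (fmk C), this, one_smul]
    | zero => simp
    | add x y _ _ hx hy => rw [map_add, map_add, add_smul, hx, hy]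
    | smul r x _ hx => rw [map_smul, map_smul, smul_eq_mul, mul_smul, hx]
  rw [canon_eq C h, Finset.univ_unique, Finset.sum_singleton]

end

/-! ## Commutation of `E_i` with `U⁻` and of `F_i` with `U⁺` -/

section

variable {I : Type*} [DecidableEq I] {C : SuperCartanDatum I} {Y X : Type*} [AddCommGroup Y]
  [AddCommGroup X] (D : RootDatum C Y X)

theorem minusF_mem {ν : I →₀ ℕ} {x : FreeF I} (hx : x ∈ fwt I ν) :
    minusF D x ∈ upar D (C.pw ν : ZMod 2) :=
  uMk_mem D (subst_mem (fun i => (Gen.F i : Gen I Y)) (fun _ => rfl) hx)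

theorem plusF_mem {ν : I →₀ ℕ} {x : FreeF I} (hx : x ∈ fwt I ν) :
    plusF D x ∈ upar D (C.pw ν : ZMod 2) :=
  uMk_mem D (subst_mem (fun i => (Gen.E i : Gen I Y)) (fun _ => rfl) hx)

theorem minus_mem {ν : I →₀ ℕ} {x : fAlg C} (hx : x ∈ fAlgWt C ν) :
    minus D x ∈ upar D (C.pw ν : ZMod 2) := by
  obtain ⟨x, hx, rfl⟩ := hx
  exact minusF_mem D hx

theorem plus_mem {ν : I →₀ ℕ} {x : fAlg C} (hx : x ∈ fAlgWt C ν) :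
    plus D x ∈ upar D (C.pw ν : ZMod 2) := by
  obtain ⟨x, hx, rfl⟩ := hx
  exact plusF_mem D hx

theorem parChi_cast (m n : ℕ) : parChi.toFun (m : ZMod 2) (n : ZMod 2) = ppi ^ (m * n) := by
  refine ppi_pow_congr ?_
  rw [ZMod.val_natCast, ZMod.val_natCast, Nat.mul_mod m n]

theorem ptw_uF (i j : I) : ptw D (C.p i) (uF D j) = ppi ^ (C.p i * C.p j) • uF D j := by
  rw [ptw_of_mem D _ (uF_mem D j), parChi_cast]

theorem ptw_uE (i j : I) : ptw D (C.p i) (uE D j) = ppi ^ (C.p i * C.p j) • uE D j := by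
  rw [ptw_of_mem D _ (uE_mem D j), parChi_cast]

theorem ptw_one (γ : ZMod 2) : ptw D γ 1 = 1 := by
  rw [ptw_of_mem D _ (uOne_mem D), parChi.zero_right, one_smul]

theorem chiU_inv_val (i j : I) : (((C.chiU i j)⁻¹ : Rπˣ) : Rπ) =
    ((qq ^ (-C.dot i j) : Rπˣ) : Rπ) * ppi ^ (C.p i * C.p j) := by
  rw [SuperCartanDatum.chiU, mul_inv, ← zpow_neg, ← inv_pow, piU_inv, Units.val_mul,
    Units.val_pow_eq_pow_val, piU_val]

theorem chiU_val (i j : I) : (C.chiU i j : Rπ) =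
    ((qq ^ C.dot i j : Rπˣ) : Rπ) * ppi ^ (C.p i * C.p j) := by
  rw [SuperCartanDatum.chiU, Units.val_mul, Units.val_pow_eq_pow_val, piU_val]

theorem uF_uJKt [C.Consistent] (i j : I) :
    uF D j * uJKt D i = ((qq ^ C.dot i j : Rπˣ) : Rπ) • (uJKt D i * uF D j) := by
  rw [uJKt_uF, smul_smul, ← Units.val_mul, ← zpow_add, add_neg_cancel, zpow_zero, Units.val_one,
    one_smul]

theorem uF_uKtn (i j : I) :
    uF D j * uKtn D i = ((qq ^ (-C.dot i j) : Rπˣ) : Rπ) • (uKtn D i * uF D j) := by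
  rw [uKtn_uF, smul_smul, ← Units.val_mul, ← zpow_add, neg_add_cancel, zpow_zero, Units.val_one,
    one_smul]

theorem uE_uJKt [C.Consistent] (i j : I) :
    uE D j * uJKt D i = ((qq ^ (-C.dot i j) : Rπˣ) : Rπ) • (uJKt D i * uE D j) := by
  rw [uJKt_uE, smul_smul, ← Units.val_mul, ← zpow_add, neg_add_cancel, zpow_zero, Units.val_one,
    one_smul]

theorem uE_uKtn (i j : I) :
    uE D j * uKtn D i = ((qq ^ C.dot i j : Rπˣ) : Rπ) • (uKtn D i * uE D j) := by
  rw [uKtn_uE, smul_smul, ← Units.val_mul, ← zpow_add, add_neg_cancel, zpow_zero, Units.val_one,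
    one_smul]

/-- Induction on the first letter `θ_j` of `x`. The relation between `E_i` and `F_j` contributes the
terms with `i = j`. In the other terms `E_i` passes `F_j` with the sign `π^{p(i)p(j)}`, and pulling
the torus elements to the left past `F_j` costs `q^{i·j}` or `q^{-i·j}`. The products of these
factors are `χ(i,j)` and its inverse, so the two coefficients obey the recursions of `ir` and of
`irb`. -/
theorem uE_mul_minusF [C.Consistent] (i : I) (x : FreeF I) :
    uE D i * minusF D x = ptw D (C.p i) (minusF D x) * uE D i +
      C.invDen i • (uJKt D i * minusF D (ir C i x) - uKtn D i * minusF D (irb C i x)) := by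
  induction x using FreeF.induction_left with
  | h1 => simp [ir_one, irb_one, ptw_one]
  | hadd x y hx hy =>
    simp only [map_add, mul_add, add_mul, hx, hy]
    module
  | hsmul r x hx =>
    simp only [map_smul, mul_smul_comm, smul_mul_assoc, hx]
    module
  | hmul j x hx =>
    have hEF : uE D i * uF D j = ppi ^ (C.p i * C.p j) • (uF D j * uE D i) +
        if i = j then C.invDen i • (uJKt D i - uKtn D i) else 0 := by
      rw [← uE_uF']; abel
    rw [ir_mul, irb_mul]
    simp only [map_add, map_smul, map_mul, minusF_th, ptw_mul, ptw_uF]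
    rw [← mul_assoc, hEF, add_mul, smul_mul_assoc, mul_assoc, hx, chiU_val, chiU_inv_val]
    simp only [mul_add, mul_sub, smul_mul_assoc, mul_smul_comm]
    rw [← mul_assoc (uF D j) (uJKt D i), ← mul_assoc (uF D j) (uKtn D i), uF_uJKt, uF_uKtn]
    split_ifs with h
    · simp only [smul_mul_assoc, sub_mul, mul_assoc]
      module
    · simp only [smul_mul_assoc, zero_mul, mul_assoc]
      module

/-- Counterpart of `uE_mul_minusF`. A torus element picks up the inverse power of `q` when it passes
`E_j`, so `irb` and `ir` exchange their places. -/
theorem plusF_mul_uF [C.Consistent] (i : I) (x : FreeF I) :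
    plusF D x * uF D i = uF D i * ptw D (C.p i) (plusF D x) +
      C.invDen i • (uJKt D i * ptw D (C.p i) (plusF D (irb C i x)) -
        uKtn D i * ptw D (C.p i) (plusF D (ir C i x))) := by
  induction x using FreeF.induction_left with
  | h1 => simp [ir_one, irb_one, ptw_one]
  | hadd x y hx hy =>
    simp only [map_add, mul_add, add_mul, hx, hy]
    module
  | hsmul r x hx =>
    simp only [map_smul, mul_smul_comm, smul_mul_assoc, hx]
    module
  | hmul j x hx =>
    have hEF : uE D j * uF D i = ppi ^ (C.p i * C.p j) • (uF D i * uE D j) +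
        if i = j then C.invDen i • (uJKt D i - uKtn D i) else 0 := by
      have h := uE_uF' D j i
      rw [mul_comm (C.p j)] at h
      rw [← sub_eq_iff_eq_add', h]
      by_cases hij : i = j
      · subst hij; rfl
      · rw [if_neg hij, if_neg (Ne.symm hij)]
    have hs : ppi ^ (C.p i * C.p j) * ppi ^ (C.p i * C.p j) = 1 := ppi_pow_mul_self _
    rw [ir_mul, irb_mul]
    simp only [map_add, map_smul, map_mul, plusF_th, ptw_mul, ptw_uE]
    rw [mul_assoc, hx, chiU_val, chiU_inv_val]
    simp only [mul_add, mul_sub, smul_mul_assoc, mul_smul_comm]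
    rw [← mul_assoc (uE D j) (uF D i), ← mul_assoc (uE D j) (uJKt D i),
      ← mul_assoc (uE D j) (uKtn D i), uE_uJKt, uE_uKtn, hEF]
    -- The sign contained in `chiU` cancels the sign produced by the parity twist of the new letter
    -- `E_j`. Only the power of `q` survives, as it should.
    have e1 : ∀ (a : Rπ) (v : UAlg D), (a * ppi ^ (C.p i * C.p j)) • ppi ^ (C.p i * C.p j) • v =
        a • v := fun a v => by rw [smul_smul, mul_assoc, hs, mul_one]
    rw [e1, e1]
    split_ifs with h
    · simp only [smul_mul_assoc, sub_mul, add_mul, mul_assoc]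
      module
    · simp only [smul_mul_assoc, add_mul, zero_mul, mul_assoc]
      module

theorem ptw_minus {ν : I →₀ ℕ} {x : fAlg C} (hx : x ∈ fAlgWt C ν) (i : I) :
    ptw D (C.p i) (minus D x) = ppi ^ (C.p i * C.pw ν) • minus D x := by
  rw [ptw_of_mem D _ (minus_mem D hx), parChi_cast]

theorem ptw_plus {ν : I →₀ ℕ} {x : fAlg C} (hx : x ∈ fAlgWt C ν) (i : I) :
    ptw D (C.p i) (plus D x) = ppi ^ (C.p i * C.pw ν) • plus D x := by
  rw [ptw_of_mem D _ (plus_mem D hx), parChi_cast]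

theorem uE_mul_minus [C.Consistent] (i : I) (x : fAlg C) :
    uE D i * minus D x = ptw D (C.p i) (minus D x) * uE D i +
      C.invDen i • (uJKt D i * minus D (irA C i x) - uKtn D i * minus D (irbA C i x)) := by
  obtain ⟨x, rfl⟩ := fmk_surjective C x
  exact uE_mul_minusF D i x

theorem plus_mul_uF [C.Consistent] (i : I) (x : fAlg C) :
    plus D x * uF D i = uF D i * ptw D (C.p i) (plus D x) +
      C.invDen i • (uJKt D i * ptw D (C.p i) (plus D (irbA C i x)) -
        uKtn D i * ptw D (C.p i) (plus D (irA C i x))) := by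
  obtain ⟨x, rfl⟩ := fmk_surjective C x
  exact plusF_mul_uF D i x

/-! ### Commutation of the torus with `U⁺` and `U⁻` -/

/-- The pairing of `μ ∈ Y` with the element of `X` given by `ν`. -/
def wtp (μ : Y) (ν : I →₀ ℕ) : ℤ := ν.sum fun i a => a * D.pairing μ (D.root i)

theorem wtp_zero (μ : Y) : wtp D μ 0 = 0 := Finsupp.sum_zero_index

theorem wtp_add (μ : Y) (ν ν' : I →₀ ℕ) : wtp D μ (ν + ν') = wtp D μ ν + wtp D μ ν' :=
  Finsupp.sum_add_index' (by simp) (by intros; push_cast; ring)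

theorem wtp_single (μ : Y) (i : I) : wtp D μ (Finsupp.single i 1) = D.pairing μ (D.root i) := by
  simp [wtp]

theorem wtp_add_left (μ μ' : Y) (ν : I →₀ ℕ) : wtp D (μ + μ') ν = wtp D μ ν + wtp D μ' ν := by
  simp only [wtp, map_add, LinearMap.add_apply, mul_add, Finsupp.sum_add]

theorem wtp_neg_left (μ : Y) (ν : I →₀ ℕ) : wtp D (-μ) ν = -wtp D μ ν := by
  rw [eq_neg_iff_add_eq_zero, ← wtp_add_left, neg_add_cancel]
  simp [wtp]

theorem wtp_zero_left (ν : I →₀ ℕ) : wtp D 0 ν = 0 := by simp [wtp]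

theorem wtp_coroot (i : I) (ν : I →₀ ℕ) :
    wtp D (C.d i • D.coroot i) ν = C.dotw (Finsupp.single i 1) ν := by
  induction ν using Finsupp.induction_linear with
  | zero => rw [wtp_zero, C.dotw_zero_right]
  | add a b ha hb => rw [wtp_add, C.dotw_add_right, ha, hb]
  | single j n =>
    simp only [wtp, D.d_mul_pairing, SuperCartanDatum.dotw]
    rw [Finsupp.sum_single_index (by simp), Finsupp.sum_single_index (by simp),
      Finsupp.sum_single_index (by simp)]
    ring

/-- Because of this evenness `J̃_i`, whose action is a power of `π` with exponent `i · ν`, commutes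
with everything. -/
theorem even_dotw_single [C.Consistent] (i : I) (ν : I →₀ ℕ) :
    Even (C.dotw (Finsupp.single i 1) ν) := by
  induction ν using Finsupp.induction_linear with
  | zero => rw [C.dotw_zero_right]; exact Even.zero
  | add a b ha hb => rw [C.dotw_add_right]; exact ha.add hb
  | single j n =>
    simp only [SuperCartanDatum.dotw]
    rw [Finsupp.sum_single_index (by simp), Finsupp.sum_single_index (by simp)]
    exact (C.even_dot i j).mul_left _

theorem torus_mul_word (s : Rπˣ) (t : UAlg D) (x : I → UAlg D) (a : I → ℤ)
    (h : ∀ i, t * x i = ((s ^ a i : Rπˣ) : Rπ) • (x i * t)) (l : List I) :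
    t * (l.map x).prod = ((s ^ (l.map a).sum : Rπˣ) : Rπ) • ((l.map x).prod * t) := by
  induction l with
  | nil => simp
  | cons i l ih =>
    simp only [List.map_cons, List.prod_cons, List.sum_cons]
    rw [← mul_assoc, h, smul_mul_assoc, mul_assoc, ih, mul_smul_comm, smul_smul, zpow_add,
      Units.val_mul, mul_assoc]

/-- The exponent is any additive function of the weight and the base any unit, so that one argument
serves `K_μ` and `J_μ` on both `U⁺` and `U⁻`. -/
theorem torus_mul_fAlg (g : fAlg C →ₐ[Rπ] UAlg D) (x : I → UAlg D)
    (hg : ∀ i, g (fmk C (th i)) = x i) (s : Rπˣ) (t : UAlg D) (a : (I →₀ ℕ) →+ ℤ)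
    (h : ∀ i, t * x i = ((s ^ a (Finsupp.single i 1) : Rπˣ) : Rπ) • (x i * t)) {ν : I →₀ ℕ}
    {y : fAlg C} (hy : y ∈ fAlgWt C ν) : t * g y = ((s ^ a ν : Rπˣ) : Rπ) • (g y * t) := by
  obtain ⟨y, hy, rfl⟩ := hy
  induction hy using Submodule.span_induction with
  | mem y hy =>
    obtain ⟨l, rfl, rfl⟩ := hy
    change t * g (fmk C _) = _ • (g (fmk C _) * t)
    rw [map_word D g x hg, torus_mul_word D s t x _ h, map_list_sum, List.map_map]
    rfl
  | zero => simp
  | add a b _ _ ha hb => simp only [map_add, mul_add, add_mul, ha, hb, smul_add]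
  | smul r a _ ha => simp only [map_smul, mul_smul_comm, smul_mul_assoc, ha, smul_comm r]

/-- `ν ↦ ⟨μ, ν'⟩` as a homomorphism. -/
def wtpHom (μ : Y) : (I →₀ ℕ) →+ ℤ where
  toFun := wtp D μ
  map_zero' := wtp_zero D μ
  map_add' := wtp_add D μ

theorem uK_plus (μ : Y) {ν : I →₀ ℕ} {y : fAlg C} (hy : y ∈ fAlgWt C ν) :
    uK D μ * plus D y = ((qq ^ wtp D μ ν : Rπˣ) : Rπ) • (plus D y * uK D μ) :=
  torus_mul_fAlg D (plus D) _ (plus_fmk_th D) qq _ (wtpHom D μ)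
    (fun i => (uK_uE D μ i).trans (by rw [← wtp_single]; rfl)) hy

theorem uJ_plus (μ : Y) {ν : I →₀ ℕ} {y : fAlg C} (hy : y ∈ fAlgWt C ν) :
    uJ D μ * plus D y = ((piU ^ wtp D μ ν : Rπˣ) : Rπ) • (plus D y * uJ D μ) :=
  torus_mul_fAlg D (plus D) _ (plus_fmk_th D) piU _ (wtpHom D μ)
    (fun i => (uJ_uE D μ i).trans (by rw [← wtp_single]; rfl)) hy

theorem uK_minus (μ : Y) {ν : I →₀ ℕ} {y : fAlg C} (hy : y ∈ fAlgWt C ν) :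
    uK D μ * minus D y = ((qq ^ (-wtp D μ ν) : Rπˣ) : Rπ) • (minus D y * uK D μ) :=
  torus_mul_fAlg D (minus D) _ (minus_fmk_th D) qq _ (-wtpHom D μ)
    (fun i => (uK_uF D μ i).trans (by rw [← wtp_single]; rfl)) hy

theorem uJ_minus (μ : Y) {ν : I →₀ ℕ} {y : fAlg C} (hy : y ∈ fAlgWt C ν) :
    uJ D μ * minus D y = ((piU ^ (-wtp D μ ν) : Rπˣ) : Rπ) • (minus D y * uJ D μ) :=
  torus_mul_fAlg D (minus D) _ (minus_fmk_th D) piU _ (-wtpHom D μ)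
    (fun i => (uJ_uF D μ i).trans (by rw [← wtp_single]; rfl)) hy

theorem minus_uKtn (i : I) {ν : I →₀ ℕ} {y : fAlg C} (hy : y ∈ fAlgWt C ν) :
    minus D y * uKtn D i = ((qq ^ (-C.dotw (Finsupp.single i 1) ν) : Rπˣ) : Rπ) •
      (uKtn D i * minus D y) := by
  rw [uKtn, uK_minus D _ hy, wtp_neg_left, wtp_coroot, neg_neg, smul_smul, ← Units.val_mul,
    ← zpow_add, neg_add_cancel, zpow_zero, Units.val_one, one_smul]

theorem plus_uJKt [C.Consistent] (i : I) {ν : I →₀ ℕ} {y : fAlg C} (hy : y ∈ fAlgWt C ν) :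
    plus D y * uJKt D i = ((qq ^ (-C.dotw (Finsupp.single i 1) ν) : Rπˣ) : Rπ) •
      (uJKt D i * plus D y) := by
  rw [uJKt, mul_assoc (uJ D _), uK_plus D _ hy, mul_smul_comm,
    ← mul_assoc (uJ D _) (plus D y), uJ_plus D _ hy,
    wtp_coroot, piU_zpow_even (even_dotw_single i ν), Units.val_one, one_smul, smul_smul,
    ← Units.val_mul, ← zpow_add, neg_add_cancel, zpow_zero, Units.val_one, one_smul, mul_assoc]

end

/-! ## The bar involution on `U ⊗ U` -/

section

variable {I : Type*} [DecidableEq I] {C : SuperCartanDatum I} {Y X : Type*} [AddCommGroup Y]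
  [AddCommGroup X] (D : RootDatum C Y X)

theorem barGen_mem (g : Gen I Y) : barGen D g ∈ upar D (gpar C g) := by
  cases g with
  | E i => exact uE_mem D i
  | F i => exact uF_mem D i
  | J μ => exact uJ_mem D μ
  | K μ => exact uJK_mem D μ (-μ)

theorem barU_mem [C.Consistent] {γ : ZMod 2} {x : UAlg D} (hx : x ∈ upar D γ) :
    barU D x ∈ upar D γ := by
  induction hx using Submodule.span_induction with
  | mem x hx =>
    obtain ⟨l, rfl, rfl⟩ := hx
    induction l with
    | nil =>
      simp only [List.map_nil, List.prod_nil, List.sum_nil, barU_one]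
      exact uOne_mem D
    | cons g l ih =>
      simp only [List.map_cons, List.prod_cons, List.sum_cons, barU_mul, barU_gen]
      exact SetLike.mul_mem_graded (barGen_mem D g) ih
  | zero => rw [map_zero]; exact zero_mem _
  | add x y _ _ hx hy => rw [map_add]; exact add_mem hx hy
  | smul r x _ hx => rw [LinearMap.map_smulₛₗ]; exact Submodule.smul_mem _ _ hx

/-- The bar involution preserves parities and fixes `π`, so the sign in the product of `U ⊗ U`
passes through it. With this `deltaBar` is a ring homomorphism, and the intertwining relation need
only be tested on generators. -/
theorem barUU_mul [C.Consistent] (x y : UU D) : barUU D (x * y) = barUU D x * barUU D y := by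
  induction x using tt_induction with
  | h0 => rw [zero_mul, map_zero, zero_mul]
  | hadd x x' h h' => rw [add_mul, map_add, map_add, add_mul, h, h']
  | h γ δ a b ha hb =>
    induction y using tt_induction with
    | h0 => rw [mul_zero, map_zero, mul_zero]
    | hadd x x' h h' => rw [mul_add, map_add, map_add, mul_add, h, h']
    | h γ' δ' c d hc hd =>
      have hp : barR (parChi.toFun δ γ') = parChi.toFun δ γ' := by
        simp only [parChi, map_pow, barR_ppi]
      rw [tt_mul_tt parChi (upar D) a d hb hc, LinearMap.map_smulₛₗ, barUU_tU, barUU_tU, barUU_tU,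
        tt_mul_tt parChi (upar D) _ _ (barU_mem D hb) (barU_mem D hc), barU_mul, barU_mul, hp]

theorem deltaBar_mul [C.Consistent] [Fintype I] (u v : UAlg D) :
    deltaBar D (u * v) = deltaBar D u * deltaBar D v := by
  rw [deltaBar, barU_mul, map_mul, barUU_mul]; rfl

theorem deltaBar_add [C.Consistent] [Fintype I] (u v : UAlg D) :
    deltaBar D (u + v) = deltaBar D u + deltaBar D v := by
  rw [deltaBar, map_add, map_add, map_add]; rfl

theorem barUU_one [C.Consistent] : barUU D 1 = 1 :=
  congrArg₂ (tU D) (barU_one D) (barU_one D)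

theorem deltaBar_algebraMap [C.Consistent] [Fintype I] (r : Rπ) :
    deltaBar D (algebraMap Rπ _ r) = algebraMap Rπ _ r := by
  rw [deltaBar, Algebra.algebraMap_eq_smul_one, LinearMap.map_smulₛₗ, barU_one, map_smul, map_one,
    LinearMap.map_smulₛₗ, barR_barR, barUU_one, Algebra.algebraMap_eq_smul_one]

theorem delta_gen [C.Consistent] [Fintype I] (g : Gen I Y) :
    delta D (uMk D (gen g)) = deltaGen D g :=
  (uLift_uMk D _ _ _).trans (deltaFree_gen D g)

theorem barU_uJ [C.Consistent] (μ : Y) : barU D (uJ D μ) = uJ D μ := barU_gen D (.J μ)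

theorem barU_uK [C.Consistent] (μ : Y) : barU D (uK D μ) = uJ D μ * uK D (-μ) :=
  barU_gen D (.K μ)

theorem barU_uJKt [C.Consistent] (i : I) : barU D (uJKt D i) = uKtn D i := by
  rw [uJKt, barU_mul, barU_uJ, barU_uK, ← mul_assoc, uJ_mul_self, one_mul, uKtn]

theorem barU_uKtn [C.Consistent] (i : I) : barU D (uKtn D i) = uJKt D i := by
  rw [uKtn, barU_uK, neg_neg, uJ_neg, uJKt]

theorem delta_uE [C.Consistent] [Fintype I] (i : I) :
    delta D (uE D i) = tU D (uE D i) 1 + tU D (uJKt D i) (uE D i) := delta_gen D (.E i)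

theorem delta_uF [C.Consistent] [Fintype I] (i : I) :
    delta D (uF D i) = tU D (uF D i) (uKtn D i) + tU D 1 (uF D i) := delta_gen D (.F i)

/-- The bar involution exchanges `J̃_i K̃_i` and `K̃_{-i}`. On the generators of `U` this
replacement is the only difference between `Δ` and `Δ̄`. -/
theorem deltaBar_uE [C.Consistent] [Fintype I] (i : I) :
    deltaBar D (uE D i) = tU D (uE D i) 1 + tU D (uKtn D i) (uE D i) := by
  have h : barU D (uE D i) = uE D i := barU_gen D (.E i)
  rw [deltaBar, h, delta_uE, map_add, barUU_tU, barUU_tU, h, barU_one, barU_uJKt]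

theorem deltaBar_uF [C.Consistent] [Fintype I] (i : I) :
    deltaBar D (uF D i) = tU D (uF D i) (uJKt D i) + tU D 1 (uF D i) := by
  have h : barU D (uF D i) = uF D i := barU_gen D (.F i)
  rw [deltaBar, h, delta_uF, map_add, barUU_tU, barUU_tU, h, barU_one, barU_uKtn]

theorem deltaBar_uJ [C.Consistent] [Fintype I] (μ : Y) :
    deltaBar D (uJ D μ) = tU D (uJ D μ) (uJ D μ) := by
  have h : delta D (uJ D μ) = tU D (uJ D μ) (uJ D μ) := delta_gen D (.J μ)
  rw [deltaBar, barU_uJ, h, barUU_tU, barU_uJ]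

theorem deltaBar_uK [C.Consistent] [Fintype I] (μ : Y) :
    deltaBar D (uK D μ) = tU D (uK D μ) (uK D μ) := by
  have h : ∀ μ, delta D (uJ D μ) = tU D (uJ D μ) (uJ D μ) := fun μ => delta_gen D (.J μ)
  have h' : ∀ μ, delta D (uK D μ) = tU D (uK D μ) (uK D μ) := fun μ => delta_gen D (.K μ)
  have h2 : barU D (uJ D μ * uK D (-μ)) = uK D μ := by
    rw [barU_mul, barU_uJ, barU_uK, neg_neg, uJ_neg, ← mul_assoc, uJ_mul_self, one_mul]
  rw [deltaBar, barU_uK, map_mul, h, h', tU_mul_left D (uJ_mem D μ), barUU_tU, h2]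

/-! ## Existence of the quasi-R-matrix -/

/-- The map `x ⊗ y ↦ x⁻ ⊗ y⁺`. -/
def mp : fAlg C ⊗[Rπ] fAlg C →ₗ[Rπ] UU D :=
  (TensorProduct.map (minus D).toLinearMap (plus D).toLinearMap :
    fAlg C ⊗[Rπ] fAlg C →ₗ[Rπ] UAlg D ⊗[Rπ] UAlg D)

theorem mp_tmul (x y : fAlg C) : mp D (x ⊗ₜ y) = tU D (minus D x) (plus D y) := rfl

/-- Two linear maps agree on the canonical element when they agree on homogeneous tensors. -/
theorem canon_ext [Finite I] {M : Type*} [AddCommMonoid M] [Module Rπ M] (ν : I →₀ ℕ)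
    (f g : fAlg C ⊗[Rπ] fAlg C →ₗ[Rπ] M)
    (h : ∀ x ∈ fAlgWt C ν, ∀ y ∈ fAlgWt C ν, f (x ⊗ₜ y) = g (x ⊗ₜ y)) :
    f (canon C ν) = g (canon C ν) := by
  obtain ⟨k, m, n, hmn⟩ := exists_isDualFamily C ν
  rw [canon_eq C hmn, map_sum, map_sum]
  exact Finset.sum_congr rfl fun j _ => h _ (hmn.left_mem j) _ (hmn.right_mem j)

variable (C) in
/-- The scalar `(-1)^{ht ν} π^{e(ν)} π_ν q_ν`. -/
def sc (ν : I →₀ ℕ) : Rπ :=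
  (-1) ^ SuperCartanDatum.ht ν * ppi ^ C.e ν * C.pν ν * C.qν ν

variable (C) in
theorem sc_zero : sc C 0 = 1 := by
  simp [sc, SuperCartanDatum.ht, C.e_zero, SuperCartanDatum.pν, SuperCartanDatum.qν]

-- Adding a letter `i` to `ν` raises `e(ν)` by `p(i) p(ν)`. This recursion and `sc_zero` are all
-- that the existence proof uses of the scalar, and the cancellation in `qR_E` dictates its form.
variable (C) in
theorem sc_add (i : I) (ν : I →₀ ℕ) : sc C (ν + Finsupp.single i 1) =
    -(ppi ^ (C.p i * C.pw ν) * C.pii i * C.qi i * sc C ν) := by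
  have h1 : SuperCartanDatum.ht (ν + Finsupp.single i 1) = SuperCartanDatum.ht ν + 1 := by
    rw [SuperCartanDatum.ht, Finsupp.sum_add_index' (fun _ => rfl) (fun _ _ _ => rfl),
      Finsupp.sum_single_index rfl]; rfl
  have h2 : C.pν (ν + Finsupp.single i 1) = C.pν ν * C.pii i := by
    rw [SuperCartanDatum.pν, Finsupp.prod_add_index' (fun _ => pow_zero _)
      (fun _ _ _ => pow_add _ _ _)]
    refine congrArg _ ?_
    rw [Finsupp.prod_single_index (h := fun i a => C.pii i ^ a) (pow_zero _), pow_one]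
  have h3 : C.qν (ν + Finsupp.single i 1) = C.qν ν * C.qi i := by
    rw [SuperCartanDatum.qν, Finsupp.prod_add_index' (fun _ => pow_zero _)
      (fun _ _ _ => pow_add _ _ _)]
    refine congrArg _ ?_
    rw [Finsupp.prod_single_index (h := fun i a => (C.qi i : Rπ) ^ a) (pow_zero _), pow_one]
  have h4 : C.e (ν + Finsupp.single i 1) = C.e ν + C.p i * C.pw ν := by
    rw [add_comm, C.e_single_add]
  rw [sc, sc, h1, h2, h3, h4, pow_add, pow_succ]
  ring

-- `1 - π_i q_i⁻² = π_i q_i⁻¹ (π_i q_i - q_i⁻¹)` and `π_i² = 1`. This links the normalisation of the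
-- form to the denominator in the relation between `E_i` and `F_i`.
variable (C) in
theorem cc_eq (i : I) : C.cc i = C.pii i * C.qi i * C.invDen i := by
  have hp : C.pii i * C.pii i = 1 := ppi_pow_mul_self _
  have hq : ((C.qi i : Rπˣ) : Rπ) * (((C.qi i)⁻¹ : Rπˣ) : Rπ) = 1 := Units.mul_inv _
  have e : ((C.qi i ^ (-2 : ℤ) : Rπˣ) : Rπ) = (((C.qi i)⁻¹ : Rπˣ) : Rπ) ^ 2 := by
    rw [zpow_neg, ← inv_zpow]; norm_cast
  have h1 : (1 - C.pii i * ((C.qi i ^ (-2 : ℤ) : Rπˣ) : Rπ)) * C.cc i = 1 :=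
    Ring.mul_inverse_cancel _ (C.isUnit_form_den i)
  have h2 : (C.pii i * C.qi i - (((C.qi i)⁻¹ : Rπˣ) : Rπ)) * C.invDen i = 1 :=
    Ring.mul_inverse_cancel _ (C.isUnit_den i)
  refine (C.isUnit_form_den i).mul_left_cancel ?_
  rw [h1, e]
  linear_combination -h2 + (C.invDen i * (((C.qi i)⁻¹ : Rπˣ) : Rπ)) * hp +
    C.invDen i * C.pii i * C.pii i * (((C.qi i)⁻¹ : Rπˣ) : Rπ) * hq

/-- The component of weight `ν` of the quasi-R-matrix. -/
def qR [Finite I] (ν : I →₀ ℕ) : UU D := sc C ν • mp D (canon C ν)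

/-- Left multiplication by `θ_i` and `C.cc i • irA C i` are adjoint, so `map_canon_left` applies.
The three lemmas that follow are its analogues for right multiplication and for the exchanged
factors. -/
theorem smul_canon_irA [Finite I] (i : I) (ν : I →₀ ℕ) :
    TensorProduct.map LinearMap.id (LinearMap.mulLeft Rπ (thA C i)) (canon C ν) =
      C.cc i • TensorProduct.map (irA C i) LinearMap.id (canon C (ν + Finsupp.single i 1)) := by
  rw [← LinearMap.smul_apply, ← TensorProduct.map_smul_left]
  refine (map_canon_left C _ _ (fun x hx => Submodule.smul_mem _ _ (irA_mem C i hx))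
    (fun x hx => thA_mul_mem C i hx) fun x _ y _ => ?_).symm
  rw [LinearMap.smul_apply, map_smul, LinearMap.smul_apply, LinearMap.mulLeft_apply, fForm_thA_mul,
    smul_eq_mul]

theorem smul_canon_irA' [Finite I] (i : I) (ν : I →₀ ℕ) :
    TensorProduct.map (LinearMap.mulLeft Rπ (thA C i)) LinearMap.id (canon C ν) =
      C.cc i • TensorProduct.map LinearMap.id (irA C i) (canon C (ν + Finsupp.single i 1)) := by
  rw [← comm_canon C ν, ← comm_canon C (ν + Finsupp.single i 1), TensorProduct.map_comm,
    TensorProduct.map_comm, smul_canon_irA, map_smul]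

theorem smul_canon_irbA [C.Consistent] [Finite I] (i : I) (ν : I →₀ ℕ) :
    TensorProduct.map LinearMap.id (LinearMap.mulRight Rπ (thA C i)) (canon C ν) =
      (C.cc i * C.chi.toFun (Finsupp.single i 1) ν) •
        TensorProduct.map (irbA C i) LinearMap.id (canon C (ν + Finsupp.single i 1)) := by
  rw [← LinearMap.smul_apply, ← TensorProduct.map_smul_left]
  refine (map_canon_left C _ _ (fun x hx => Submodule.smul_mem _ _ (irbA_mem C i hx))
    (fun x hx => mul_thA_mem C i hx) fun x _ y hy => ?_).symm
  rw [LinearMap.smul_apply, map_smul, LinearMap.smul_apply, LinearMap.mulRight_apply,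
    fForm_mul_thA C i x hy, smul_eq_mul]

theorem smul_canon_irbA' [C.Consistent] [Finite I] (i : I) (ν : I →₀ ℕ) :
    TensorProduct.map (LinearMap.mulRight Rπ (thA C i)) LinearMap.id (canon C ν) =
      (C.cc i * C.chi.toFun (Finsupp.single i 1) ν) •
        TensorProduct.map LinearMap.id (irbA C i) (canon C (ν + Finsupp.single i 1)) := by
  rw [← comm_canon C ν, ← comm_canon C (ν + Finsupp.single i 1), TensorProduct.map_comm,
    TensorProduct.map_comm, smul_canon_irbA, map_smul]

/-- Moving `E_i ⊗ 1` past `y⁺` and moving `E_i` past `x⁻` produce the same sign, since `x` and `y`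
have the same weight. The terms ending in `E_i` cancel and only the derivatives of `x` remain. -/
theorem commE_mp [C.Consistent] (i : I) {ν : I →₀ ℕ} {x y : fAlg C} (hx : x ∈ fAlgWt C ν)
    (hy : y ∈ fAlgWt C ν) :
    tU D (uE D i) 1 * mp D (x ⊗ₜ y) - mp D (x ⊗ₜ y) * tU D (uE D i) 1 =
      C.invDen i • (tU D (uJKt D i) 1 * mp D (irA C i x ⊗ₜ y) -
        tU D (uKtn D i) 1 * mp D (irbA C i x ⊗ₜ y)) := by
  simp only [mp_tmul]
  rw [tU_mul_left D (uOne_mem D), tU_mul_left D (uOne_mem D), tU_mul_left D (uOne_mem D),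
    tU_mul_of_right D (uE_mem D i), uE_mul_minus, ptw_minus D hx, ptw_plus D hy]
  simp only [one_mul, mul_one, tU_add_left, tU_smul_left, tU_smul_right, tU_sub_left,
    smul_mul_assoc]
  module

/-- The torus elements are pulled to the far left, to allow a term by term comparison with
`commE_mp`. -/
theorem mulE_mp [C.Consistent] (i : I) {ν : I →₀ ℕ} {x y : fAlg C} (hx : x ∈ fAlgWt C ν) :
    tU D (uJKt D i) (uE D i) * mp D (x ⊗ₜ y) - mp D (x ⊗ₜ y) * tU D (uKtn D i) (uE D i) =
      ppi ^ (C.p i * C.pw ν) • (tU D (uJKt D i) 1 * mp D (x ⊗ₜ (thA C i * y))) -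
        ((qq ^ (-C.dotw (Finsupp.single i 1) ν) : Rπˣ) : Rπ) •
          (tU D (uKtn D i) 1 * mp D (x ⊗ₜ (y * thA C i))) := by
  simp only [mp_tmul, map_mul]
  rw [tU_mul_of_left D (uE_mem D i), tU_mul_right D (uKtn_mem D i), ptw_minus D hx,
    tU_mul_left D (uOne_mem D), tU_mul_left D (uOne_mem D), minus_uKtn D i hx, thA, plus_fmk_th]
  simp only [one_mul, tU_smul_left, mul_smul_comm]

theorem commF_mp [C.Consistent] (i : I) {ν : I →₀ ℕ} {x y : fAlg C} (hx : x ∈ fAlgWt C ν)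
    (hy : y ∈ fAlgWt C ν) :
    tU D 1 (uF D i) * mp D (x ⊗ₜ y) - mp D (x ⊗ₜ y) * tU D 1 (uF D i) =
      -C.invDen i • (tU D (minus D x) (uJKt D i * ptw D (C.p i) (plus D (irbA C i y))) -
        tU D (minus D x) (uKtn D i * ptw D (C.p i) (plus D (irA C i y)))) := by
  simp only [mp_tmul]
  rw [tU_mul_of_left D (uF_mem D i), tU_mul_right D (uOne_mem D), plus_mul_uF, ptw_minus D hx,
    ptw_plus D hy]
  simp only [one_mul, mul_one, tU_add_right, tU_smul_left, tU_smul_right, tU_sub_right,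
    mul_smul_comm]
  module

/-- The derivatives of `y` have weight `ν`, which evaluates the parity twist. In `commF_mp` the
twist is left unevaluated so that the formula also covers weights in which `i` does not occur. -/
theorem commF_mp_add [C.Consistent] (i : I) {ν : I →₀ ℕ} {x y : fAlg C}
    (hx : x ∈ fAlgWt C (ν + Finsupp.single i 1)) (hy : y ∈ fAlgWt C (ν + Finsupp.single i 1)) :
    tU D 1 (uF D i) * mp D (x ⊗ₜ y) - mp D (x ⊗ₜ y) * tU D 1 (uF D i) =
      (-C.invDen i * ppi ^ (C.p i * C.pw ν)) • (tU D 1 (uJKt D i) * mp D (x ⊗ₜ irbA C i y) -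
        tU D 1 (uKtn D i) * mp D (x ⊗ₜ irA C i y)) := by
  rw [commF_mp D i hx hy, ptw_plus D (irbA_mem C i hy), ptw_plus D (irA_mem C i hy), mp_tmul,
    mp_tmul, tU_mul_left D (uJKt_mem D i), tU_mul_left D (uKtn_mem D i)]
  simp only [one_mul, mul_smul_comm, tU_smul_right]
  module

theorem mulF_mp [C.Consistent] (i : I) {ν : I →₀ ℕ} {x y : fAlg C} (hy : y ∈ fAlgWt C ν) :
    tU D (uF D i) (uKtn D i) * mp D (x ⊗ₜ y) - mp D (x ⊗ₜ y) * tU D (uF D i) (uJKt D i) =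
      tU D 1 (uKtn D i) * mp D ((thA C i * x) ⊗ₜ y) -
        (ppi ^ (C.p i * C.pw ν) * ((qq ^ (-C.dotw (Finsupp.single i 1) ν) : Rπˣ) : Rπ)) •
          (tU D 1 (uJKt D i) * mp D ((x * thA C i) ⊗ₜ y)) := by
  simp only [mp_tmul, map_mul]
  rw [tU_mul_left D (uKtn_mem D i), tU_mul_of_right D (uF_mem D i), ptw_plus D hy,
    tU_mul_left D (uKtn_mem D i), tU_mul_left D (uJKt_mem D i), smul_mul_assoc,
    plus_uJKt D i hy, thA, minus_fmk_th]
  simp only [one_mul, tU_smul_right, smul_smul]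

theorem chi_eq (i : I) (ν : I →₀ ℕ) : C.chi.toFun (Finsupp.single i 1) ν =
    ((qq ^ C.dotw (Finsupp.single i 1) ν : Rπˣ) : Rπ) * ppi ^ (C.p i * C.pw ν) := by
  change _ * ppi ^ (C.pw _ * C.pw ν) = _
  rw [C.pw_single]

theorem qq_zpow_mul_neg (n : ℤ) : ((qq ^ n : Rπˣ) : Rπ) * ((qq ^ (-n) : Rπˣ) : Rπ) = 1 := by
  rw [← Units.val_mul, ← zpow_add, add_neg_cancel, zpow_zero, Units.val_one]

/-- For such `ν` there is no weight `ν - i` whose component could cancel the commutator. It vanishes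
by itself, because both derivatives vanish on the weight space. -/
theorem qR_E_eq_zero [C.Consistent] [Finite I] (i : I) {ν : I →₀ ℕ} (hν : ν i = 0) :
    tU D (uE D i) 1 * qR D ν - qR D ν * tU D (uE D i) 1 = 0 := by
  have h := canon_ext ν (LinearMap.mulLeft Rπ (tU D (uE D i) 1) ∘ₗ mp D -
    LinearMap.mulRight Rπ (tU D (uE D i) 1) ∘ₗ mp D) 0 fun x hx y hy => by
      refine (commE_mp D i hx hy).trans ?_
      rw [irA_eq_zero C i hν hx, irbA_eq_zero C i hν hx, TensorProduct.zero_tmul, map_zero,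
        mul_zero, mul_zero, sub_zero, smul_zero, LinearMap.zero_apply]
  rw [qR, mul_smul_comm, smul_mul_assoc, ← smul_sub]
  exact (congrArg _ h).trans (smul_zero _)

theorem qR_F_eq_zero [C.Consistent] [Finite I] (i : I) {ν : I →₀ ℕ} (hν : ν i = 0) :
    tU D 1 (uF D i) * qR D ν - qR D ν * tU D 1 (uF D i) = 0 := by
  have h := canon_ext ν (LinearMap.mulLeft Rπ (tU D 1 (uF D i)) ∘ₗ mp D -
    LinearMap.mulRight Rπ (tU D 1 (uF D i)) ∘ₗ mp D) 0 fun x hx y hy => by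
      refine (commF_mp D i hx hy).trans ?_
      rw [irA_eq_zero C i hν hy, irbA_eq_zero C i hν hy, map_zero, map_zero, mul_zero, mul_zero,
        tU_zero_right, sub_zero, smul_zero, LinearMap.zero_apply]
  rw [qR, mul_smul_comm, smul_mul_assoc, ← smul_sub]
  exact (congrArg _ h).trans (smul_zero _)

/-- These are the terms of the relation for `E_i` whose first factor has weight `-ν` and whose
second factor has weight `ν + i`. By adjunction the second bracket is written, like the first,
through the derivatives of the canonical element of weight `ν + i`. The two coefficients then vanish
by `sc_add` and `cc_eq`. -/
theorem qR_E [C.Consistent] [Finite I] (i : I) (ν : I →₀ ℕ) :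
    (tU D (uE D i) 1 * qR D (ν + Finsupp.single i 1) -
      qR D (ν + Finsupp.single i 1) * tU D (uE D i) 1) +
    (tU D (uJKt D i) (uE D i) * qR D ν - qR D ν * tU D (uKtn D i) (uE D i)) = 0 := by
  have h1 := canon_ext (ν + Finsupp.single i 1)
    (LinearMap.mulLeft Rπ (tU D (uE D i) 1) ∘ₗ mp D -
      LinearMap.mulRight Rπ (tU D (uE D i) 1) ∘ₗ mp D)
    (C.invDen i • (LinearMap.mulLeft Rπ (tU D (uJKt D i) 1) ∘ₗ mp D ∘ₗ
      TensorProduct.map (irA C i) LinearMap.id -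
      LinearMap.mulLeft Rπ (tU D (uKtn D i) 1) ∘ₗ mp D ∘ₗ
        TensorProduct.map (irbA C i) LinearMap.id)) fun x hx y hy => commE_mp D i hx hy
  have h2 := canon_ext ν
    (LinearMap.mulLeft Rπ (tU D (uJKt D i) (uE D i)) ∘ₗ mp D -
      LinearMap.mulRight Rπ (tU D (uKtn D i) (uE D i)) ∘ₗ mp D)
    (ppi ^ (C.p i * C.pw ν) • (LinearMap.mulLeft Rπ (tU D (uJKt D i) 1) ∘ₗ mp D ∘ₗ
      TensorProduct.map LinearMap.id (LinearMap.mulLeft Rπ (thA C i))) -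
      ((qq ^ (-C.dotw (Finsupp.single i 1) ν) : Rπˣ) : Rπ) •
        (LinearMap.mulLeft Rπ (tU D (uKtn D i) 1) ∘ₗ mp D ∘ₗ
      TensorProduct.map LinearMap.id (LinearMap.mulRight Rπ (thA C i))))
    fun x hx y hy => mulE_mp D i hx
  simp only [LinearMap.sub_apply, LinearMap.smul_apply, LinearMap.comp_apply,
    LinearMap.mulLeft_apply, LinearMap.mulRight_apply, smul_canon_irA, smul_canon_irbA, map_smul] at h1 h2
  simp only [qR, mul_smul_comm, smul_mul_assoc, ← smul_sub]
  rw [h1, h2, sc_add, chi_eq, cc_eq]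
  have hq := qq_zpow_mul_neg (C.dotw (Finsupp.single i 1) ν)
  -- The power of `q` in the bicharacter, from right multiplication by `θ_i`, cancels the power
  -- picked up by `K̃_{-i}` on its way past `x⁻`. The terms with `J̃_i K̃_i` match without any
  -- relation.
  linear_combination (norm := module)
    (-(sc C ν * C.pii i * C.qi i * C.invDen i * ppi ^ (C.p i * C.pw ν)) * hq) •
      (tU D (uKtn D i) 1 * mp D (TensorProduct.map (irbA C i) LinearMap.id
        (canon C (ν + Finsupp.single i 1))))

theorem qR_F [C.Consistent] [Finite I] (i : I) (ν : I →₀ ℕ) :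
    (tU D 1 (uF D i) * qR D (ν + Finsupp.single i 1) -
      qR D (ν + Finsupp.single i 1) * tU D 1 (uF D i)) +
    (tU D (uF D i) (uKtn D i) * qR D ν - qR D ν * tU D (uF D i) (uJKt D i)) = 0 := by
  have h1 := canon_ext (ν + Finsupp.single i 1)
    (LinearMap.mulLeft Rπ (tU D 1 (uF D i)) ∘ₗ mp D -
      LinearMap.mulRight Rπ (tU D 1 (uF D i)) ∘ₗ mp D)
    ((-C.invDen i * ppi ^ (C.p i * C.pw ν)) •
      (LinearMap.mulLeft Rπ (tU D 1 (uJKt D i)) ∘ₗ mp D ∘ₗ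
        TensorProduct.map LinearMap.id (irbA C i) -
      LinearMap.mulLeft Rπ (tU D 1 (uKtn D i)) ∘ₗ mp D ∘ₗ
        TensorProduct.map LinearMap.id (irA C i))) fun x hx y hy => commF_mp_add D i hx hy
  have h2 := canon_ext ν
    (LinearMap.mulLeft Rπ (tU D (uF D i) (uKtn D i)) ∘ₗ mp D -
      LinearMap.mulRight Rπ (tU D (uF D i) (uJKt D i)) ∘ₗ mp D)
    (LinearMap.mulLeft Rπ (tU D 1 (uKtn D i)) ∘ₗ mp D ∘ₗ
      TensorProduct.map (LinearMap.mulLeft Rπ (thA C i)) LinearMap.id -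
      (ppi ^ (C.p i * C.pw ν) * ((qq ^ (-C.dotw (Finsupp.single i 1) ν) : Rπˣ) : Rπ)) •
        (LinearMap.mulLeft Rπ (tU D 1 (uJKt D i)) ∘ₗ mp D ∘ₗ
      TensorProduct.map (LinearMap.mulRight Rπ (thA C i)) LinearMap.id))
    fun x hx y hy => mulF_mp D i hy
  simp only [LinearMap.sub_apply, LinearMap.smul_apply, LinearMap.comp_apply,
    LinearMap.mulLeft_apply, LinearMap.mulRight_apply, smul_canon_irA', smul_canon_irbA', map_smul] at h1 h2
  simp only [qR, mul_smul_comm, smul_mul_assoc, ← smul_sub]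
  rw [h1, h2, sc_add, chi_eq, cc_eq]
  have hq := qq_zpow_mul_neg (C.dotw (Finsupp.single i 1) ν)
  -- The sign `π^{p(i)p(ν)}` enters the commutator twice, once through the parity twist of the
  -- derivative and once through `sc_add`. It also occurs twice in the second bracket, in the terms
  -- with `J̃_i K̃_i`.
  have hs : ppi ^ (C.p i * C.pw ν) * ppi ^ (C.p i * C.pw ν) = 1 := ppi_pow_mul_self _
  linear_combination (norm := module)
    (-(sc C ν * C.pii i * C.qi i * C.invDen i) *
      (ppi ^ (C.p i * C.pw ν) * ppi ^ (C.p i * C.pw ν)) * hq) •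
      (tU D 1 (uJKt D i) * mp D (TensorProduct.map LinearMap.id (irbA C i)
        (canon C (ν + Finsupp.single i 1)))) -
    (sc C ν * C.pii i * C.qi i * C.invDen i * hs) •
      (tU D 1 (uKtn D i) * mp D (TensorProduct.map LinearMap.id (irA C i)
        (canon C (ν + Finsupp.single i 1))))

end

/-! ## Convergence -/

section

variable {I : Type*} [DecidableEq I] {C : SuperCartanDatum I} {Y X : Type*} [AddCommGroup Y]
  [AddCommGroup X] (D : RootDatum C Y X)

theorem ht_add_single (i : I) (ν : I →₀ ℕ) :
    SuperCartanDatum.ht (ν + Finsupp.single i 1) = SuperCartanDatum.ht ν + 1 := by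
  rw [SuperCartanDatum.ht, Finsupp.sum_add_index' (fun _ => rfl) (fun _ _ _ => rfl),
    Finsupp.sum_single_index rfl]; rfl

theorem finite_ht_lt [Finite I] (N : ℕ) : {ν : I →₀ ℕ | SuperCartanDatum.ht ν < N}.Finite := by
  have := Fintype.ofFinite I
  refine (Set.finite_Iic (Finsupp.equivFunOnFinite.symm fun _ : I => N)).subset fun ν hν i => ?_
  rw [Set.mem_ofPred_eq, SuperCartanDatum.ht, Finsupp.sum_fintype _ _ fun _ => rfl] at hν
  exact (Finset.single_le_sum (f := ν) (fun _ _ => Nat.zero_le _) (Finset.mem_univ i)).trans hν.le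

theorem minus_mem_uPM {ν : I →₀ ℕ} {x : fAlg C} (hx : x ∈ fAlgWt C ν) :
    minus D x ∈ uPM D (SuperCartanDatum.ht ν) := by
  rw [uPM_eq]
  refine Tri.word_mem _ _ _ _ ?_
  rw [← iSup_wt_eq D _ _ (minus_fmk_th D)]
  exact Submodule.mem_iSup_of_mem ν (Submodule.mem_iSup_of_mem le_rfl ⟨x, hx, rfl⟩)

theorem canon_mem_of [Finite I] {M : Type*} [AddCommMonoid M] [Module Rπ M] (ν : I →₀ ℕ)
    (f : fAlg C ⊗[Rπ] fAlg C →ₗ[Rπ] M) (S : Submodule Rπ M)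
    (h : ∀ x ∈ fAlgWt C ν, ∀ y ∈ fAlgWt C ν, f (x ⊗ₜ y) ∈ S) : f (canon C ν) ∈ S := by
  obtain ⟨k, m, n, hmn⟩ := exists_isDualFamily C ν
  rw [canon_eq C hmn, map_sum]
  exact Submodule.sum_mem _ fun j _ => h _ (hmn.left_mem j) _ (hmn.right_mem j)

theorem qR_mem_HN [Finite I] (ν : I →₀ ℕ) : qR D ν ∈ HN D (SuperCartanDatum.ht ν) :=
  Submodule.smul_mem _ _ (canon_mem_of ν _ _ fun _ hx _ _ => HN_left_mem D (minus_mem_uPM D hx) _)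

theorem qR_mem [Finite I] (ν : I →₀ ℕ) : qR D ν ∈ uMinusPlus D ν :=
  Submodule.smul_mem _ _ (canon_mem_of ν _ _ fun x hx y hy =>
    Submodule.subset_span ⟨_, ⟨x, hx, rfl⟩, _, ⟨y, hy, rfl⟩, rfl⟩)

theorem qR_zero [Finite I] : qR D 0 = tU D 1 1 := by
  rw [qR, sc_zero, canon_zero, one_smul, mp_tmul, map_one, map_one]

/-- Outside the finite set of weights of height less than `N` all terms lie in `H_N`, so the finite
partial sums form a Cauchy net. The limit exists by completeness. -/
theorem summable_of_mem_HN [Finite I] (f : (I →₀ ℕ) → UU D)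
    (hf : ∀ ν, f ν ∈ HN D (SuperCartanDatum.ht ν)) : Summable fun ν => (f ν : UUhat D) := by
  have h1 : CauchySeq fun s : Finset (I →₀ ℕ) => ∑ ν ∈ s, f ν := by
    rw [cauchySeq_finset_iff_sum_vanishing]
    intro e he
    obtain ⟨N, -, hN⟩ := (HN_hasBasis D).mem_iff.mp he
    refine ⟨(finite_ht_lt N).toFinset, fun t ht => hN (Submodule.sum_mem _ fun ν hν => ?_)⟩
    refine HN_anti D ?_ (hf ν)
    by_contra h
    exact (Finset.disjoint_left.mp ht hν) ((Set.Finite.mem_toFinset _).mpr (not_le.mp h))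
  rw [summable_iff_cauchySeq_finset]
  have h2 := h1.map (UniformSpace.Completion.uniformContinuous_coe (UU D))
  have h3 : (fun s : Finset (I →₀ ℕ) => ∑ ν ∈ s, (f ν : UUhat D)) =
      fun s => ((∑ ν ∈ s, f ν : UU D) : UUhat D) :=
    funext fun s => (map_sum (UniformSpace.Completion.coeRingHom (α := UU D)) f s).symm
  rw [h3]
  exact h2

theorem coe_sub (a b : UU D) : ((a - b : UU D) : UUhat D) = (a : UUhat D) - b :=
  UniformSpace.Completion.coe_sub a b

theorem coe_mul (a b : UU D) : ((a * b : UU D) : UUhat D) = (a : UUhat D) * b :=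
  UniformSpace.Completion.coe_mul a b

theorem coe_add (a b : UU D) : ((a + b : UU D) : UUhat D) = (a : UUhat D) + b :=
  UniformSpace.Completion.coe_add a b

theorem hasSum_commute {f : (I →₀ ℕ) → UU D} {T : UUhat D}
    (hT : HasSum (fun ν => (f ν : UUhat D)) T) (a b : UU D) :
    HasSum (fun ν => ((a * f ν - f ν * b : UU D) : UUhat D)) ((a : UUhat D) * T - T * b) := by
  simp only [coe_sub, coe_mul]
  exact (hT.mul_left _).sub (hT.mul_right _)

/-- A telescoping argument: if the commutators of `f` with `a` and `b` cancel after a shift of the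
weight by `i`, then the sum of `f` intertwines `a + b` and `a' + b'`. -/
theorem intertwine_of_shift {f : (I →₀ ℕ) → UU D} {T : UUhat D}
    (hT : HasSum (fun ν => (f ν : UUhat D)) T) (i : I) (a a' b b' : UU D)
    (h0 : ∀ ν : I →₀ ℕ, ν i = 0 → a * f ν - f ν * a' = 0)
    (h : ∀ ν, (a * f (ν + Finsupp.single i 1) - f (ν + Finsupp.single i 1) * a') +
      (b * f ν - f ν * b') = 0) :
    ((a + b : UU D) : UUhat D) * T = T * ((a' + b' : UU D) : UUhat D) := by
  have h1 := hasSum_commute D hT a a'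
  have h2 := hasSum_commute D hT b b'
  have hinj : Function.Injective fun ν : I →₀ ℕ => ν + Finsupp.single i 1 :=
    add_left_injective _
  -- By `h0` the first family is supported on the weights of the form `ν + i`, so its sum may be
  -- reindexed by the shift. After that the two families cancel term by term.
  rw [← hinj.hasSum_iff (fun ν hν => by
    rw [h0 ν, UniformSpace.Completion.coe_zero]
    by_contra hne
    refine hν ⟨ν - Finsupp.single i 1, tsub_add_cancel_of_le ?_⟩
    exact Finsupp.single_le_iff.mpr (Nat.one_le_iff_ne_zero.mpr hne))] at h1
  have h3 := h1.add h2
  simp only [Function.comp_apply, ← coe_add, h, UniformSpace.Completion.coe_zero] at h3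
  have h4 := h3.unique hasSum_zero
  rw [coe_add, coe_add, add_mul, mul_add]
  rw [← sub_eq_zero, ← h4]
  abel

/-- The two factors of `Θ_ν` have opposite weights, so the scalars picked up by `t` in the two
factors are inverse to each other. -/
theorem torus_commute [Finite I] (t : UAlg D) (ht : t ∈ upar D 0) (ν : I →₀ ℕ) (s : Rπˣ)
    (hm : ∀ x ∈ fAlgWt C ν, t * minus D x = (((s⁻¹ : Rπˣ)) : Rπ) • (minus D x * t))
    (hp : ∀ x ∈ fAlgWt C ν, t * plus D x = (s : Rπ) • (plus D x * t)) :
    tU D t t * qR D ν = qR D ν * tU D t t := by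
  have h := canon_ext ν (LinearMap.mulLeft Rπ (tU D t t) ∘ₗ mp D)
    (LinearMap.mulRight Rπ (tU D t t) ∘ₗ mp D) fun x hx y hy => by
      simp only [LinearMap.comp_apply, LinearMap.mulLeft_apply, LinearMap.mulRight_apply, mp_tmul]
      rw [tU_mul_left D ht, tU_mul_right D ht, hm x hx, hp y hy, tU_smul_left, tU_smul_right,
        smul_smul, Units.inv_mul, one_smul]
  rw [qR, mul_smul_comm, smul_mul_assoc]
  exact congrArg _ h

/-- The elements `Θ_ν` built from the canonical elements form a quasi-R-matrix. -/
theorem isQuasiR_qR [Fintype I] [C.Consistent] : IsQuasiR D (qR D) := by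
  refine ⟨qR_mem D, qR_zero D, ?_⟩
  obtain ⟨T, hT⟩ := summable_of_mem_HN D (qR D) (qR_mem_HN D)
  refine ⟨T, hT, fun u => ?_⟩
  have htorus : ∀ t : UU D, (∀ ν, t * qR D ν = qR D ν * t) → (t : UUhat D) * T = T * t := by
    intro t ht
    have h1 := hasSum_commute D hT t t
    simp only [ht, sub_self, UniformSpace.Completion.coe_zero] at h1
    exact sub_eq_zero.mp (h1.unique hasSum_zero)
  -- The elements `u` that satisfy the relation form a subalgebra, since `Δ` and `Δ̄` are additive,
  -- multiplicative and agree on scalars. Hence only generators need to be checked.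
  have hu : u ∈ Algebra.adjoin Rπ (Set.range fun g : Gen I Y => uMk D (gen g)) := by
    rw [uGen_adjoin]; trivial
  induction hu using Algebra.adjoin_induction with
  | mem u hu =>
    obtain ⟨g, rfl⟩ := hu
    cases g with
    | E i =>
      change (delta D (uE D i) : UUhat D) * T = T * (deltaBar D (uE D i) : UUhat D)
      rw [delta_uE, deltaBar_uE]
      exact intertwine_of_shift D hT i _ _ _ _ (fun ν => qR_E_eq_zero D i) (qR_E D i)
    | F i =>
      change (delta D (uF D i) : UUhat D) * T = T * (deltaBar D (uF D i) : UUhat D)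
      -- The summands are reordered because for `F_i` the commutator of the weight shifted by `i` is
      -- the one with `1 ⊗ F_i`, the second summand of the coproduct.
      rw [delta_uF, deltaBar_uF, add_comm (tU D (uF D i) _), add_comm (tU D (uF D i) _)]
      exact intertwine_of_shift D hT i _ _ _ _ (fun ν => qR_F_eq_zero D i) (qR_F D i)
    | J μ =>
      change (delta D (uJ D μ) : UUhat D) * T = T * (deltaBar D (uJ D μ) : UUhat D)
      rw [deltaBar_uJ]
      refine (congrArg (fun a : UU D => (a : UUhat D) * T) (delta_gen D (.J μ))).trans
        (htorus _ fun ν => torus_commute D _ (uJ_mem D μ) ν (piU ^ wtp D μ ν) (fun x hx => ?_)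
          fun x hx => uJ_plus D μ hx)
      rw [uJ_minus D μ hx, zpow_neg]
    | K μ =>
      change (delta D (uK D μ) : UUhat D) * T = T * (deltaBar D (uK D μ) : UUhat D)
      rw [deltaBar_uK]
      refine (congrArg (fun a : UU D => (a : UUhat D) * T) (delta_gen D (.K μ))).trans
        (htorus _ fun ν => torus_commute D _ (uK_mem D μ) ν (qq ^ wtp D μ ν) (fun x hx => ?_)
          fun x hx => uK_plus D μ hx)
      rw [uK_minus D μ hx, zpow_neg]
  | algebraMap r =>
    rw [deltaBar_algebraMap, AlgHom.commutes]
    exact htorus _ fun ν => Algebra.commutes r _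
  | add a b _ _ ha hb =>
    rw [map_add, deltaBar_add, coe_add, coe_add, add_mul, mul_add, ha, hb]
  | mul a b _ _ ha hb =>
    rw [map_mul, deltaBar_mul, coe_mul, coe_mul, mul_assoc, hb, ← mul_assoc, ha, mul_assoc]

/-- Consequence of an intertwining relation in the completion for the finite partial sums. -/
theorem eventually_sum_mem_HN {f : (I →₀ ℕ) → UU D} {T : UUhat D}
    (hT : HasSum (fun ν => (f ν : UUhat D)) T) (a b : UU D) (h : (a : UUhat D) * T = T * b)
    (N : ℕ) : ∀ᶠ s : Finset (I →₀ ℕ) in Filter.atTop,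
      ∑ ν ∈ s, (a * f ν - f ν * b) ∈ HN D N := by
  have h1 := hasSum_commute D hT a b
  rw [h, sub_self] at h1
  have h2 : Filter.Tendsto (fun s : Finset (I →₀ ℕ) => ∑ ν ∈ s, (a * f ν - f ν * b)) Filter.atTop
      (nhds 0) := by
    -- The topology of `U ⊗ U` is induced from the completion, so convergence to zero may be tested
    -- there. Injectivity of the map to the completion is not required.
    rw [(UniformSpace.Completion.isUniformInducing_coe (UU D)).isInducing.tendsto_nhds_iff]
    refine Filter.Tendsto.congr (fun s => ?_) h1
    exact (map_sum (UniformSpace.Completion.coeRingHom (α := UU D)) _ s).symm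
  exact h2 ((HN_hasBasis D).mem_of_mem trivial)

end

/-! ## Highest and lowest weight modules of `U` on `f` -/

section

variable {I : Type*} [DecidableEq I] (C : SuperCartanDatum I)

theorem fAlg_hom_ext {M : Type*} [AddCommMonoid M] [Module Rπ M] {f g : fAlg C →ₗ[Rπ] M}
    (h : ∀ (κ : I →₀ ℕ), ∀ x ∈ fAlgWt C κ, f x = g x) : f = g :=
  LinearMap.ext fun x => fAlg_sum_induction C (P := fun x => f x = g x)
    (fun x y hx hy => by rw [map_add, map_add, hx, hy]) h x

/-! ### Operators on `f` that are diagonal on weights, lower weights or raise weights -/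

/-- The operator on `'f` which is multiplication by `g κ` on the component of weight `κ`. -/
def diagF (g : (I →₀ ℕ) → Rπ) : Module.End Rπ (FreeF I) :=
  (DirectSum.toModule Rπ (I →₀ ℕ) (FreeF I) fun κ => g κ • (fwt I κ).subtype) ∘ₗ
    (DirectSum.decomposeLinearEquiv (fwt I)).toLinearMap

theorem diagF_of_mem (g : (I →₀ ℕ) → Rπ) {κ : I →₀ ℕ} {x : FreeF I} (hx : x ∈ fwt I κ) :
    diagF g x = g κ • x := by
  lift x to fwt I κ using hx
  simp [diagF]

/-- Different weight spaces are orthogonal, so diagonal operators are self-adjoint and in particular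
preserve the radical. -/
theorem form_diagF (g : (I →₀ ℕ) → Rπ) (x y : FreeF I) :
    form C (diagF g x) y = form C x (diagF g y) := by
  refine fwt_sum_induction (P := fun x => form C (diagF g x) y = form C x (diagF g y))
    (fun x x' hx hx' => ?_) (fun κ x hx => ?_) x
  · simp only [map_add, LinearMap.add_apply, hx, hx']
  refine fwt_sum_induction (P := fun y => form C (diagF g x) y = form C x (diagF g y))
    (fun y y' hy hy' => ?_) (fun μ y hy => ?_) y
  · simp only [map_add, hy, hy']
  rw [diagF_of_mem g hx, diagF_of_mem g hy, map_smul, map_smul, LinearMap.smul_apply]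
  by_cases h : κ = μ
  · rw [h]
  · rw [form_eq_zero_of_ne C h hx hy, smul_zero, smul_zero]

/-- The operator on `f` which is multiplication by `g κ` on the component of weight `κ`. -/
def dg (g : (I →₀ ℕ) → Rπ) : Module.End Rπ (fAlg C) :=
  descend C (diagF g) fun x hx y => by rw [form_diagF]; exact hx _

theorem dg_of_mem (g : (I →₀ ℕ) → Rπ) {κ : I →₀ ℕ} {x : fAlg C} (hx : x ∈ fAlgWt C κ) :
    dg C g x = g κ • x := by
  obtain ⟨x, hx, rfl⟩ := hx
  refine (congrArg (fmk C) (diagF_of_mem g hx)).trans ?_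
  rw [map_smul]; rfl

theorem dg_mul_dg (g h : (I →₀ ℕ) → Rπ) : dg C g * dg C h = dg C fun κ => g κ * h κ := by
  refine fAlg_hom_ext C fun κ x hx => ?_
  rw [Module.End.mul_apply, dg_of_mem C h hx, map_smul, dg_of_mem C g hx, dg_of_mem C _ hx,
    smul_smul, mul_comm]

theorem dg_one : dg C (fun _ => 1) = 1 :=
  fAlg_hom_ext C fun κ x hx => by rw [dg_of_mem C _ hx, one_smul, Module.End.one_apply]

/-- Only the component of weight `0` pairs nontrivially with `1`. In the matrix coefficients `(u z,
1)` a torus element at the left end of `u` therefore contributes a scalar. -/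
theorem fForm_dg_one (g : (I →₀ ℕ) → Rπ) (x : fAlg C) :
    fForm C (dg C g x) 1 = g 0 * fForm C x 1 := by
  have h1 : (1 : fAlg C) ∈ fAlgWt C 0 := ⟨1, SetLike.GradedOne.one_mem, map_one (fmk C)⟩
  refine fAlg_sum_induction C (P := fun x => fForm C (dg C g x) 1 = g 0 * fForm C x 1)
    (fun x y hx hy => ?_) (fun κ x hx => ?_) x
  · rw [map_add, map_add, map_add, LinearMap.add_apply, LinearMap.add_apply, hx, hy, mul_add]
  · rw [dg_of_mem C g hx, map_smul, LinearMap.smul_apply, smul_eq_mul]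
    by_cases h : κ = 0
    · rw [h]
    · rw [fForm_eq_zero_of_ne C h hx h1, mul_zero, mul_zero]

/-- The operator lowers the weight by `i`. -/
structure Lowers (i : I) (g : Module.End Rπ (fAlg C)) : Prop where
  mem : ∀ κ : I →₀ ℕ, ∀ x ∈ fAlgWt C (κ + Finsupp.single i 1), g x ∈ fAlgWt C κ
  eq_zero : ∀ κ : I →₀ ℕ, κ i = 0 → ∀ x ∈ fAlgWt C κ, g x = 0

/-- The operator raises the weight by `i`. -/
def Raises (i : I) (g : Module.End Rπ (fAlg C)) : Prop :=
  ∀ κ : I →₀ ℕ, ∀ x ∈ fAlgWt C κ, g x ∈ fAlgWt C (κ + Finsupp.single i 1)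

theorem exists_add_single (i : I) (κ : I →₀ ℕ) : κ i = 0 ∨ ∃ κ', κ = κ' + Finsupp.single i 1 := by
  by_cases h : κ i = 0
  · exact Or.inl h
  · exact Or.inr ⟨κ - Finsupp.single i 1, (tsub_add_cancel_of_le
      (Finsupp.single_le_iff.mpr (Nat.one_le_iff_ne_zero.mpr h))).symm⟩

theorem Lowers.dg_mul {i : I} {g : Module.End Rπ (fAlg C)} (hg : Lowers C i g)
    {s : (I →₀ ℕ) → Rπ} {r : Rπ} (h : ∀ κ, s κ = r * s (κ + Finsupp.single i 1)) :
    dg C s * g = r • (g * dg C s) := by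
  refine fAlg_hom_ext C fun κ x hx => ?_
  rw [LinearMap.smul_apply, Module.End.mul_apply, Module.End.mul_apply, dg_of_mem C s hx, map_smul]
  obtain hκ | ⟨κ', rfl⟩ := exists_add_single i κ
  · rw [hg.eq_zero κ hκ x hx, map_zero, smul_zero, smul_zero]
  · rw [dg_of_mem C s (hg.mem κ' x hx), h, smul_smul]

theorem Raises.dg_mul {i : I} {g : Module.End Rπ (fAlg C)} (hg : Raises C i g)
    {s : (I →₀ ℕ) → Rπ} {r : Rπ} (h : ∀ κ, s (κ + Finsupp.single i 1) = r * s κ) :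
    dg C s * g = r • (g * dg C s) := by
  refine fAlg_hom_ext C fun κ x hx => ?_
  rw [LinearMap.smul_apply, Module.End.mul_apply, Module.End.mul_apply, dg_of_mem C s hx, map_smul,
    dg_of_mem C s (hg κ x hx), h, smul_smul]

theorem Lowers.smul {i : I} {g : Module.End Rπ (fAlg C)} (hg : Lowers C i g) (r : Rπ) :
    Lowers C i (r • g) :=
  ⟨fun κ x hx => Submodule.smul_mem _ _ (hg.mem κ x hx), fun κ hκ x hx => by
    rw [LinearMap.smul_apply, hg.eq_zero κ hκ x hx, smul_zero]⟩

/-! ### Lowering operators: adjoints of right multiplication -/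

/-- The map on `f` induced by `r_i`. -/
def rrA [C.Consistent] (i : I) : Module.End Rπ (fAlg C) := descend C (rr C i) fun _ => rr_mem_rad C i

theorem lowers_rrA [C.Consistent] (i : I) : Lowers C i (rrA C i) where
  mem κ x hx := by
    obtain ⟨x, hx, rfl⟩ := hx
    exact fmk_mem C (rr_mem_fwt C i hx)
  eq_zero κ hκ x hx := by
    obtain ⟨x, hx, rfl⟩ := hx
    exact (congrArg (fmk C) (rr_eq_zero C i hκ hx)).trans (map_zero _)

theorem rrA_thA_mul [C.Consistent] (i j : I) {κ : I →₀ ℕ} {x : fAlg C} (hx : x ∈ fAlgWt C κ) :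
    rrA C i (thA C j * x) = ((if i = j then (1 : Rπ) else 0) *
      C.chi.toFun (Finsupp.single i 1) κ) • x + thA C j * rrA C i x := by
  obtain ⟨x, hx, rfl⟩ := hx
  refine (congrArg (fmk C) (rr_mul C i j x)).trans ?_
  rw [twist_of_mem C.chi (fwt I) _ hx, smul_smul, map_add, map_smul, map_mul]
  rfl

theorem rrA_mul_thA [C.Consistent] (i j : I) (x : fAlg C) :
    rrA C i (x * thA C j) = (if i = j then (1 : Rπ) else 0) • x +
      (C.chiU i j : Rπ) • (rrA C i x * thA C j) := by
  obtain ⟨x, rfl⟩ := fmk_surjective C x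
  refine (congrArg (fmk C) (rr_mul_th C i j x)).trans ?_
  rw [map_add, map_smul, map_smul, map_mul]
  rfl

/-- The operator `x ↦ (θ_i, θ_i) r_i(x)`, adjoint to right multiplication by `θ_i`. -/
def Aop [C.Consistent] (i : I) : Module.End Rπ (fAlg C) := C.cc i • rrA C i

theorem lowers_Aop [C.Consistent] (i : I) : Lowers C i (Aop C i) := (lowers_rrA C i).smul C _

theorem fForm_Aop [C.Consistent] (i : I) (x y : fAlg C) :
    fForm C (Aop C i x) y = fForm C x (y * thA C i) := by
  obtain ⟨x, rfl⟩ := fmk_surjective C x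
  obtain ⟨y, rfl⟩ := fmk_surjective C y
  rw [Aop, LinearMap.smul_apply, map_smul, LinearMap.smul_apply, smul_eq_mul]
  exact (form_mul_th_rr C i x y).symm

/-- Right multiplication reverses the order of products and so does passage to adjoints, so a word
acts through the adjoint of right multiplication by that same word. The relations of `f` follow from
nondegeneracy, and for `z = 1` the matrix coefficients take their simple form. -/
theorem fForm_lift_Aop [C.Consistent] (x : FreeF I) (y z : fAlg C) :
    fForm C (FreeAlgebra.lift Rπ (Aop C) x y) z = fForm C y (z * fmk C x) := by
  induction x using FreeF.induction_left generalizing z with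
  | h1 => rw [map_one, map_one, mul_one, Module.End.one_apply]
  | hadd a b ha hb => simp only [map_add, LinearMap.add_apply, ha, hb, mul_add]
  | hsmul r a ha => simp only [map_smul, LinearMap.smul_apply, ha, mul_smul_comm]
  | hmul i a ha =>
    rw [map_mul, Module.End.mul_apply, FreeAlgebra.lift_ι_apply, fForm_Aop, ha, map_mul (fmk C),
      mul_assoc]
    rfl

theorem lift_Aop_rad [C.Consistent] {x : FreeF I} (hx : x ∈ rad C) :
    FreeAlgebra.lift Rπ (Aop C) x = 0 :=
  LinearMap.ext fun y => fForm_nondeg C fun z => by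
    rw [fForm_lift_Aop, (fmk_eq_zero C).mpr hx, mul_zero, map_zero]

/-- `∏_i a_i ^ ν_i`. -/
def powW (a : I → Rπ) (ν : I →₀ ℕ) : Rπ := ν.prod fun i n => a i ^ n

theorem isUnit_powW {a : I → Rπ} (ha : ∀ i, IsUnit (a i)) (ν : I →₀ ℕ) : IsUnit (powW a ν) :=
  Finset.prod_induction _ IsUnit (fun _ _ => IsUnit.mul) isUnit_one fun i _ => (ha i).pow _

/-- Rescaling the generators multiplies each homogeneous element by a scalar depending only on its
weight. As the radical is homogeneous, the relations survive the rescaling (`lift_smul_rad`). -/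
theorem lift_smul {A : Type*} [Ring A] [Algebra Rπ A] (a : I → Rπ) (g : I → A) {ν : I →₀ ℕ}
    {x : FreeF I} (hx : x ∈ fwt I ν) :
    FreeAlgebra.lift Rπ (fun i => a i • g i) x = powW a ν • FreeAlgebra.lift Rπ g x := by
  induction hx using Submodule.span_induction with
  | mem x hx =>
    obtain ⟨l, rfl, rfl⟩ := hx
    induction l with
    | nil => simp [powW]
    | cons i l ih =>
      have h : powW a (Finsupp.single i 1 + (l.map fun i => Finsupp.single i 1).sum) =
          a i * powW a (l.map fun i => Finsupp.single i 1).sum := by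
        rw [powW, Finsupp.prod_add_index' (fun _ => pow_zero _) (fun _ _ _ => pow_add _ _ _)]
        refine congrArg (· * _) ?_
        rw [Finsupp.prod_single_index (h := fun i n => a i ^ n) (pow_zero _), pow_one]
      simp only [List.map_cons, List.prod_cons, List.sum_cons, map_mul, h]
      rw [ih, FreeAlgebra.lift_ι_apply, FreeAlgebra.lift_ι_apply, smul_mul_smul_comm]
  | zero => simp
  | add x y _ _ hx hy => rw [map_add, map_add, hx, hy, smul_add]
  | smul r x _ hx => rw [map_smul, map_smul, hx, smul_comm]

theorem lift_smul_rad {A : Type*} [Ring A] [Algebra Rπ A] (a : I → Rπ) (g : I → A)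
    (hg : ∀ x ∈ rad C, FreeAlgebra.lift Rπ g x = 0) (x : FreeF I) (hx : x ∈ rad C) :
    FreeAlgebra.lift Rπ (fun i => a i • g i) x = 0 :=
  rad_kill C (FreeAlgebra.lift Rπ fun i => a i • g i).toLinearMap.toAddMonoidHom
    (fun ν y hy hy' => by
      refine (lift_smul a g hy).trans ?_
      rw [hg y hy', smul_zero]) x hx

theorem lift_conj {A : Type*} [Ring A] [Algebra Rπ A] (g : I → A) {d d' : A} (h : d * d' = 1)
    (h' : d' * d = 1) (x : FreeF I) :
    FreeAlgebra.lift Rπ (fun i => d' * g i * d) x = d' * FreeAlgebra.lift Rπ g x * d := by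
  induction x using FreeF.induction_left with
  | h1 => rw [map_one, map_one, mul_one, h']
  | hadd x y hx hy => rw [map_add, map_add, hx, hy, mul_add, add_mul]
  | hsmul r x hx => rw [map_smul, map_smul, hx, mul_smul_comm, smul_mul_assoc]
  | hmul i x hx =>
    rw [map_mul, map_mul, hx, FreeAlgebra.lift_ι_apply, FreeAlgebra.lift_ι_apply]
    calc d' * g i * d * (d' * FreeAlgebra.lift Rπ g x * d) =
        d' * g i * (d * d') * FreeAlgebra.lift Rπ g x * d := by noncomm_ring
      _ = _ := by rw [h, mul_one]; noncomm_ring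

theorem lift_mulLeft_rad {x : FreeF I} (hx : x ∈ rad C) :
    FreeAlgebra.lift Rπ (fun i => LinearMap.mulLeft Rπ (thA C i)) x = 0 := by
  have h : ∀ x : FreeF I, FreeAlgebra.lift Rπ (fun i => LinearMap.mulLeft Rπ (thA C i)) x =
      LinearMap.mulLeft Rπ (fmk C x) := by
    intro x
    induction x using FreeF.induction_left with
    | h1 => rw [map_one, map_one, LinearMap.mulLeft_one]; rfl
    | hadd x y hx hy => ext z; simp [hx, hy, add_mul]
    | hsmul r x hx => ext z; simp [hx]
    | hmul i x hx =>
      rw [map_mul, hx, map_mul, LinearMap.mulLeft_mul, FreeAlgebra.lift_ι_apply]; rfl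
  rw [h, (fmk_eq_zero C).mpr hx, LinearMap.mulLeft_zero_eq_zero]

/-- A word acts as right multiplication by the reversed word, so the stability of the radical under
reversal is what is needed. -/
theorem lift_mulRight_rad [C.Consistent] {x : FreeF I} (hx : x ∈ rad C) :
    FreeAlgebra.lift Rπ (fun i => LinearMap.mulRight Rπ (thA C i)) x = 0 := by
  have h : ∀ x : FreeF I, FreeAlgebra.lift Rπ (fun i => LinearMap.mulRight Rπ (thA C i)) x =
      LinearMap.mulRight Rπ (fmk C (star x)) := by
    intro x
    induction x using FreeF.induction_left with
    | h1 => rw [map_one, star_one, map_one, LinearMap.mulRight_one]; rfl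
    | hadd x y hx hy => ext z; simp [hx, hy, mul_add]
    | hsmul r x hx => ext z; simp [hx, star_smul']
    | hmul i x hx =>
      rw [map_mul, hx, star_mul, star_th, map_mul, LinearMap.mulRight_mul,
        FreeAlgebra.lift_ι_apply]; rfl
  rw [h, (fmk_eq_zero C).mpr (star_mem_rad C hx), LinearMap.mulRight_zero_eq_zero]

/-! ### Raising operators: twisted commutators with `θ_i` -/

/-- The operator `x ↦ π^{p(i) p(x)} θ_i x`. -/
def Pop (i : I) : Module.End Rπ (fAlg C) :=
  LinearMap.mulLeft Rπ (thA C i) * dg C fun κ => ppi ^ (C.p i * C.pw κ)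

/-- The operator `x ↦ q^{- i · |x|} x θ_i`. -/
def Qop (i : I) : Module.End Rπ (fAlg C) :=
  LinearMap.mulRight Rπ (thA C i) *
    dg C fun κ => ((qq ^ (-C.dotw (Finsupp.single i 1) κ) : Rπˣ) : Rπ)

theorem Pop_apply (i : I) {κ : I →₀ ℕ} {x : fAlg C} (hx : x ∈ fAlgWt C κ) :
    Pop C i x = ppi ^ (C.p i * C.pw κ) • (thA C i * x) := by
  rw [Pop, Module.End.mul_apply, dg_of_mem C _ hx, LinearMap.mulLeft_apply, mul_smul_comm]

theorem Qop_apply (i : I) {κ : I →₀ ℕ} {x : fAlg C} (hx : x ∈ fAlgWt C κ) :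
    Qop C i x = ((qq ^ (-C.dotw (Finsupp.single i 1) κ) : Rπˣ) : Rπ) • (x * thA C i) := by
  rw [Qop, Module.End.mul_apply, dg_of_mem C _ hx, LinearMap.mulRight_apply, smul_mul_assoc]

theorem raises_Pop (i : I) : Raises C i (Pop C i) := fun κ x hx => by
  rw [Pop_apply C i hx]
  exact Submodule.smul_mem _ _ (thA_mul_mem C i hx)

theorem raises_Qop (i : I) : Raises C i (Qop C i) := fun κ x hx => by
  rw [Qop_apply C i hx]
  exact Submodule.smul_mem _ _ (mul_thA_mem C i hx)

/-- Since `e(κ + i) = e(κ) + p(i) p(κ)`, conjugating left multiplication by the diagonal operator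
with entries `π^{e(κ)}` produces exactly the sign in `Pop`. Conjugation preserves relations. -/
theorem lift_Pop_rad {x : FreeF I} (hx : x ∈ rad C) : FreeAlgebra.lift Rπ (Pop C) x = 0 := by
  have h1 : dg C (fun κ => ppi ^ C.e κ) * dg C (fun κ => ppi ^ C.e κ) = 1 := by
    rw [dg_mul_dg]
    simp only [ppi_pow_mul_self, dg_one]
  have h2 : Pop C = fun i => dg C (fun κ => ppi ^ C.e κ) * LinearMap.mulLeft Rπ (thA C i) *
      dg C (fun κ => ppi ^ C.e κ) := by
    funext i
    refine fAlg_hom_ext C fun κ x hx => ?_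
    rw [Pop_apply C i hx, Module.End.mul_apply, Module.End.mul_apply, dg_of_mem C _ hx,
      LinearMap.mulLeft_apply, mul_smul_comm, map_smul, dg_of_mem C _ (thA_mul_mem C i hx),
      smul_smul, add_comm κ, C.e_single_add, pow_add, ← mul_assoc, ppi_pow_mul_self, one_mul]
  rw [h2, lift_conj _ h1 h1, lift_mulLeft_rad C hx, mul_zero, zero_mul]

/-- The quadratic form with `N(κ + i) = N(κ) + i · κ`. -/
def quadN (κ : I →₀ ℕ) : ℤ := C.dotw κ κ / 2 - κ.sum fun i a => a * C.d i

/-- Passing from `κ` to `κ + i` increases half of `κ · κ` by `i · κ + d_i`, and the linear term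
removes `d_i`. The integer division does no harm, as `κ · κ` changes by an even number. -/
theorem quadN_add [C.Consistent] (i : I) (κ : I →₀ ℕ) :
    quadN C (κ + Finsupp.single i 1) = quadN C κ + C.dotw (Finsupp.single i 1) κ := by
  have hc : C.dotw κ (Finsupp.single i 1) = C.dotw (Finsupp.single i 1) κ := by
    induction κ using Finsupp.induction_linear with
    | zero => rw [C.dotw_zero_right, C.dotw_zero_left]
    | add a b ha hb => rw [C.dotw_add_right, C.dotw_add_left, ha, hb]
    | single j n =>
      simp only [SuperCartanDatum.dotw]
      rw [Finsupp.sum_single_index (by simp), Finsupp.sum_single_index (by simp),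
        Finsupp.sum_single_index (by simp), Finsupp.sum_single_index (by simp), C.dot_comm]
      ring
  have hs : ((κ + Finsupp.single i 1).sum fun i a => (a : ℤ) * C.d i) =
      (κ.sum fun i a => (a : ℤ) * C.d i) + C.d i := by
    rw [Finsupp.sum_add_index' (by simp) (by intros; push_cast; ring),
      Finsupp.sum_single_index (by simp)]
    simp
  rw [quadN, quadN, hs, C.dotw_add_left, C.dotw_add_right, C.dotw_add_right, C.dotw_single, hc,
    ← C.two_mul_d]
  omega

/-- By `quadN_add`, `Qop` is right multiplication conjugated by the diagonal operator with entries
`q^{quadN κ}`. -/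
theorem lift_Qop_rad [C.Consistent] {x : FreeF I} (hx : x ∈ rad C) :
    FreeAlgebra.lift Rπ (Qop C) x = 0 := by
  have h1 : dg C (fun κ => ((qq ^ quadN C κ : Rπˣ) : Rπ)) *
      dg C (fun κ => ((qq ^ (-quadN C κ) : Rπˣ) : Rπ)) = 1 := by
    rw [dg_mul_dg]
    simp only [qq_zpow_mul_neg, dg_one]
  have h1' : dg C (fun κ => ((qq ^ (-quadN C κ) : Rπˣ) : Rπ)) *
      dg C (fun κ => ((qq ^ quadN C κ : Rπˣ) : Rπ)) = 1 := by
    rw [dg_mul_dg]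
    simp only [mul_comm, qq_zpow_mul_neg, dg_one]
  have h2 : Qop C = fun i => dg C (fun κ => ((qq ^ (-quadN C κ) : Rπˣ) : Rπ)) *
      LinearMap.mulRight Rπ (thA C i) * dg C (fun κ => ((qq ^ quadN C κ : Rπˣ) : Rπ)) := by
    funext i
    refine fAlg_hom_ext C fun κ x hx => ?_
    rw [Qop_apply C i hx, Module.End.mul_apply, Module.End.mul_apply, dg_of_mem C _ hx,
      LinearMap.mulRight_apply, smul_mul_assoc, map_smul, dg_of_mem C _ (mul_thA_mem C i hx),
      smul_smul, quadN_add, ← Units.val_mul, ← zpow_add]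
    congr 4
    ring
  rw [h2, lift_conj _ h1 h1', lift_mulRight_rad C hx, mul_zero, zero_mul]

/-- The operator `x ↦ π^{p(i) p(x)} θ_i x - q^{2 l_i - i · |x|} x θ_i`. -/
def Wop (l : I → ℤ) (i : I) : Module.End Rπ (fAlg C) :=
  (-((qq ^ (2 * l i) : Rπˣ) : Rπ)) • Qop C i + Pop C i

theorem raises_Wop (l : I → ℤ) (i : I) : Raises C i (Wop C l i) := fun κ x hx =>
  add_mem (Submodule.smul_mem _ _ (raises_Qop C i κ x hx)) (raises_Pop C i κ x hx)

/-- `Pop` and the rescaled `Qop` satisfy the relations of `f` separately, and they commute up to the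
bicharacter because left and right multiplications commute. That is the hypothesis under which
`sum_kill` passes the relations on to their sum. -/
theorem lift_Wop_rad [C.Consistent] [Fintype I] (l : I → ℤ) (x : FreeF I) (hx : x ∈ rad C) :
    FreeAlgebra.lift Rπ (Wop C l) x = 0 := by
  have h := sum_kill C (FreeAlgebra.lift Rπ fun i => (-((qq ^ (2 * l i) : Rπˣ) : Rπ)) • Qop C i)
    (FreeAlgebra.lift Rπ (Pop C)) (lift_smul_rad C _ _ fun x hx => lift_Qop_rad C hx)
    (fun x hx => lift_Pop_rad C hx) (fun i j => ?_) x hx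
  · simp only [FreeAlgebra.lift_ι_apply] at h
    exact h
  · rw [FreeAlgebra.lift_ι_apply, FreeAlgebra.lift_ι_apply, mul_smul_comm, smul_mul_assoc,
      smul_comm]
    congr 1
    refine fAlg_hom_ext C fun κ x hx => ?_
    have h1 : C.dotw (Finsupp.single j 1) (κ + Finsupp.single i 1) =
        C.dotw (Finsupp.single j 1) κ + C.dot i j := by
      rw [C.dotw_add_right, C.dotw_single, C.dot_comm]
    rw [LinearMap.smul_apply, Module.End.mul_apply, Module.End.mul_apply, Qop_apply C j hx,
      Pop_apply C i hx, map_smul, map_smul, Pop_apply C i (mul_thA_mem C j hx),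
      Qop_apply C j (thA_mul_mem C i hx), h1, C.pw_add, C.pw_single, mul_add, pow_add, neg_add,
      zpow_add, Units.val_mul, chiU_val, mul_assoc]
    have hq := qq_zpow_mul_neg (C.dot i j)
    linear_combination (norm := module) (-(((qq ^ (-C.dotw (Finsupp.single j 1) κ) : Rπˣ) : Rπ) *
      ppi ^ (C.p i * C.pw κ) * ppi ^ (C.p i * C.p j)) * hq) • (thA C i * (x * thA C j))

/-- `rrA C i` commutes with each summand of `Wop C l j` up to the same sign `π^{p(i)p(j)}` and a
scalar term for `i = j`. The scalar terms combine to a difference of two powers of `q`, which is the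
shape required by the relation between `E_i` and `F_i`. -/
theorem rrA_Wop [C.Consistent] (l : I → ℤ) (i j : I) {κ : I →₀ ℕ} {x : fAlg C}
    (hx : x ∈ fAlgWt C κ) : rrA C i (Wop C l j x) = ppi ^ (C.p i * C.p j) • Wop C l j (rrA C i x) +
      ((if i = j then (1 : Rπ) else 0) * (((qq ^ C.dotw (Finsupp.single i 1) κ : Rπˣ) : Rπ) -
        ((qq ^ (2 * l i - C.dotw (Finsupp.single i 1) κ) : Rπˣ) : Rπ))) • x := by
  have hs : ppi ^ (C.p i * C.p j) * ppi ^ (C.p i * C.p j) = 1 := ppi_pow_mul_self _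
  have hP : rrA C i (Pop C j x) = ppi ^ (C.p i * C.p j) • Pop C j (rrA C i x) +
      ((if i = j then (1 : Rπ) else 0) * ((qq ^ C.dotw (Finsupp.single i 1) κ : Rπˣ) : Rπ)) • x := by
    -- For `i = j` the sign in `Pop` and the sign in the bicharacter coincide and square to one.
    have hd : (if i = j then (1 : Rπ) else 0) * (ppi ^ (C.p j * C.pw κ) * ppi ^ (C.p i * C.pw κ)) =
        if i = j then (1 : Rπ) else 0 := by
      split_ifs with h
      · rw [h, ppi_pow_mul_self, one_mul]
      · rw [zero_mul]
    rw [Pop_apply C j hx, map_smul, rrA_thA_mul C i j hx, chi_eq]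
    -- The diagonal factor of `Pop` on the derivative of `x` depends on the weight `κ - i`. If that
    -- weight does not exist, the derivative is zero.
    obtain hκ | ⟨κ', rfl⟩ := exists_add_single i κ
    · rw [(lowers_rrA C i).eq_zero κ hκ x hx, map_zero, mul_zero, smul_zero, add_zero, zero_add,
        smul_smul]
      congr 1
      linear_combination ((qq ^ C.dotw (Finsupp.single i 1) κ : Rπˣ) : Rπ) * hd
    · rw [Pop_apply C j ((lowers_rrA C i).mem κ' x hx)]
      rw [C.pw_add, C.pw_single] at hd ⊢
      rw [mul_add (C.p j), pow_add ppi (C.p j * C.pw κ')] at hd ⊢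
      rw [mul_comm (C.p j) (C.p i)] at hd ⊢
      linear_combination (norm := module) (((qq ^ C.dotw (Finsupp.single i 1)
        (κ' + Finsupp.single i 1) : Rπˣ) : Rπ) * hd) • x
  have hQ : rrA C i (Qop C j x) = ppi ^ (C.p i * C.p j) • Qop C j (rrA C i x) +
      ((if i = j then (1 : Rπ) else 0) *
        ((qq ^ (-C.dotw (Finsupp.single i 1) κ) : Rπˣ) : Rπ)) • x := by
    have hd : (if i = j then (1 : Rπ) else 0) *
        ((qq ^ (-C.dotw (Finsupp.single j 1) κ) : Rπˣ) : Rπ) = (if i = j then (1 : Rπ) else 0) *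
        ((qq ^ (-C.dotw (Finsupp.single i 1) κ) : Rπˣ) : Rπ) := by
      split_ifs with h
      · rw [h]
      · rw [zero_mul, zero_mul]
    rw [Qop_apply C j hx, map_smul, rrA_mul_thA, ← hd]
    obtain hκ | ⟨κ', rfl⟩ := exists_add_single i κ
    · rw [(lowers_rrA C i).eq_zero κ hκ x hx, map_zero, zero_mul, smul_zero, smul_zero, add_zero,
        zero_add, smul_smul, mul_comm]
    · rw [Qop_apply C j ((lowers_rrA C i).mem κ' x hx), C.dotw_add_right, C.dotw_single, chiU_val,
        neg_add, zpow_add, Units.val_mul, C.dot_comm j i]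
      have hq := qq_zpow_mul_neg (C.dot i j)
      linear_combination (norm := module) (((qq ^ (-C.dotw (Finsupp.single j 1) κ') : Rπˣ) : Rπ) *
        ppi ^ (C.p i * C.p j) * hq) • (rrA C i x * thA C j)
  have e : ((qq ^ (2 * l i - C.dotw (Finsupp.single i 1) κ) : Rπˣ) : Rπ) =
      ((qq ^ (2 * l i) : Rπˣ) : Rπ) * ((qq ^ (-C.dotw (Finsupp.single i 1) κ) : Rπˣ) : Rπ) := by
    rw [sub_eq_add_neg, zpow_add, Units.val_mul]
  have hl : (if i = j then (1 : Rπ) else 0) * ((qq ^ (2 * l j) : Rπˣ) : Rπ) =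
      (if i = j then (1 : Rπ) else 0) * ((qq ^ (2 * l i) : Rπˣ) : Rπ) := by
    split_ifs with h
    · rw [h]
    · rw [zero_mul, zero_mul]
  rw [Wop, LinearMap.add_apply, LinearMap.smul_apply, map_add, map_smul, hP, hQ, e,
    LinearMap.add_apply, LinearMap.smul_apply]
  linear_combination (norm := module)
    (-hl * ((qq ^ (-C.dotw (Finsupp.single i 1) κ) : Rπˣ) : Rπ)) • x

end

/-! ### Lowest and highest weight representations of `U` on `f` -/

section

variable {I : Type*} [DecidableEq I] {C : SuperCartanDatum I} {Y X : Type*} [AddCommGroup Y]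
  [AddCommGroup X] (D : RootDatum C Y X)

/-- The action of `K_μ` on `f`, by `q ^ (⟨μ, lam⟩ + ε ⟨μ, κ'⟩)` on the component of weight `κ`. -/
def torK (lam : Y →ₗ[ℤ] ℤ) (ε : ℤ) (μ : Y) : Module.End Rπ (fAlg C) :=
  dg C fun κ => ((qq ^ (lam μ + ε * wtp D μ κ) : Rπˣ) : Rπ)

/-- The action of `J_μ` on `f`, by `π ^ (ε ⟨μ, κ'⟩)` on the component of weight `κ`. -/
def torJ (ε : ℤ) (μ : Y) : Module.End Rπ (fAlg C) :=
  dg C fun κ => ((piU ^ (ε * wtp D μ κ) : Rπˣ) : Rπ)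

/-- The integers `⟨d_i i, lam⟩`. -/
def hw (lam : Y →ₗ[ℤ] ℤ) (i : I) : ℤ := lam (C.d i • D.coroot i)

theorem torK_zero (lam : Y →ₗ[ℤ] ℤ) (ε : ℤ) : torK D lam ε 0 = 1 := by
  simp only [torK, wtp_zero_left, map_zero, mul_zero, add_zero, zpow_zero, Units.val_one, dg_one]

theorem torK_add (lam : Y →ₗ[ℤ] ℤ) (ε : ℤ) (μ μ' : Y) :
    torK D lam ε (μ + μ') = torK D lam ε μ * torK D lam ε μ' := by
  rw [torK, torK, torK, dg_mul_dg]
  congr 1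
  funext κ
  rw [← Units.val_mul, ← zpow_add, wtp_add_left, map_add]
  congr 2
  ring

theorem torJ_add (ε : ℤ) (μ μ' : Y) : torJ D ε (μ + μ') = torJ D ε μ * torJ D ε μ' := by
  rw [torJ, torJ, torJ, dg_mul_dg]
  congr 1
  funext κ
  rw [← Units.val_mul, ← zpow_add, wtp_add_left]
  congr 2
  ring

theorem torJ_two (ε : ℤ) (μ : Y) : torJ D ε (2 • μ) = 1 := by
  rw [torJ, ← dg_one]
  congr 1
  funext κ
  rw [two_smul, wtp_add_left, piU_zpow_even ((Even.add_self _).mul_left ε), Units.val_one]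

theorem torJ_torK (lam : Y →ₗ[ℤ] ℤ) (ε : ℤ) (μ μ' : Y) :
    torJ D ε μ * torK D lam ε μ' = torK D lam ε μ' * torJ D ε μ := by
  rw [torJ, torK, dg_mul_dg, dg_mul_dg]
  simp only [mul_comm]

/-- The operators by which the generators of `U` act on `f`. -/
def repGen (e f : I → Module.End Rπ (fAlg C)) (lam : Y →ₗ[ℤ] ℤ) (ε : ℤ) :
    Gen I Y → Module.End Rπ (fAlg C)
  | .E i => e i
  | .F i => f i
  | .J μ => torJ D ε μ
  | .K μ => torK D lam ε μ

/-- The operators satisfy the defining relations of `U`. -/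
structure IsRep (e f : I → Module.End Rπ (fAlg C)) (lam : Y →ₗ[ℤ] ℤ) (ε : ℤ) : Prop where
  K_E : ∀ μ i, torK D lam ε μ * e i =
    ((qq ^ D.pairing μ (D.root i) : Rπˣ) : Rπ) • (e i * torK D lam ε μ)
  J_E : ∀ μ i, torJ D ε μ * e i =
    ((piU ^ D.pairing μ (D.root i) : Rπˣ) : Rπ) • (e i * torJ D ε μ)
  K_F : ∀ μ i, torK D lam ε μ * f i =
    ((qq ^ (-D.pairing μ (D.root i)) : Rπˣ) : Rπ) • (f i * torK D lam ε μ)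
  J_F : ∀ μ i, torJ D ε μ * f i =
    ((piU ^ (-D.pairing μ (D.root i)) : Rπˣ) : Rπ) • (f i * torJ D ε μ)
  E_F : ∀ i j, e i * f j - ppi ^ (C.p i * C.p j) • (f j * e i) =
    if i = j then C.invDen i • (torJ D ε (C.d i • D.coroot i) * torK D lam ε (C.d i • D.coroot i) -
      torK D lam ε (-(C.d i • D.coroot i))) else 0
  rad_E : ∀ x ∈ rad C, FreeAlgebra.lift Rπ e x = 0
  rad_F : ∀ x ∈ rad C, FreeAlgebra.lift Rπ f x = 0

section

variable {D} {e f : I → Module.End Rπ (fAlg C)} {lam : Y →ₗ[ℤ] ℤ} {ε : ℤ}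

theorem lift_substE (x : FreeF I) :
    FreeAlgebra.lift Rπ (repGen D e f lam ε) (substE I Y x) = FreeAlgebra.lift Rπ e x := by
  refine AlgHom.congr_fun (φ₁ := (FreeAlgebra.lift Rπ (repGen D e f lam ε)).comp (substE I Y)) ?_ x
  refine FreeAlgebra.hom_ext (funext fun i => ?_)
  simp [substE, repGen]

theorem lift_substF (x : FreeF I) :
    FreeAlgebra.lift Rπ (repGen D e f lam ε) (substF I Y x) = FreeAlgebra.lift Rπ f x := by
  refine AlgHom.congr_fun (φ₁ := (FreeAlgebra.lift Rπ (repGen D e f lam ε)).comp (substF I Y)) ?_ x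
  refine FreeAlgebra.hom_ext (funext fun i => ?_)
  simp [substF, repGen]

theorem IsRep.rel (H : IsRep D e f lam ε) (a b : UFree I Y) (h : URel D a b) :
    FreeAlgebra.lift Rπ (repGen D e f lam ε) a = FreeAlgebra.lift Rπ (repGen D e f lam ε) b := by
  cases h with
  | K_zero => simpa [repGen] using torK_zero D lam ε
  | K_add μ μ' => simpa [repGen] using (torK_add D lam ε μ μ').symm
  | J_two μ => simpa only [FreeAlgebra.lift_ι_apply, map_one, repGen] using torJ_two D ε μ
  | J_add μ μ' => simpa [repGen] using (torJ_add D ε μ μ').symm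
  | J_K μ μ' => simpa [repGen] using torJ_torK D lam ε μ μ'
  | K_E μ i => simpa only [FreeAlgebra.lift_ι_apply, map_mul, map_smul, repGen] using H.K_E μ i
  | J_E μ i => simpa only [FreeAlgebra.lift_ι_apply, map_mul, map_smul, repGen] using H.J_E μ i
  | K_F μ i => simpa only [FreeAlgebra.lift_ι_apply, map_mul, map_smul, repGen] using H.K_F μ i
  | J_F μ i => simpa only [FreeAlgebra.lift_ι_apply, map_mul, map_smul, repGen] using H.J_F μ i
  | E_F i j =>
    rw [map_sub, map_smul, map_mul, map_mul, FreeAlgebra.lift_ι_apply, FreeAlgebra.lift_ι_apply]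
    refine (H.E_F i j).trans ?_
    split_ifs
    · rw [map_smul, map_sub, map_mul, FreeAlgebra.lift_ι_apply, FreeAlgebra.lift_ι_apply,
        FreeAlgebra.lift_ι_apply]
      rfl
    · rw [map_zero]
  | rad_E x hx => rw [lift_substE, H.rad_E x hx, map_zero]
  | rad_F x hx => rw [lift_substF, H.rad_F x hx, map_zero]

/-- The representation of `U` on `f` given by operators which satisfy the defining relations. -/
def IsRep.rep (H : IsRep D e f lam ε) : UAlg D →ₐ[Rπ] Module.End Rπ (fAlg C) :=
  uLift D (FreeAlgebra.lift Rπ (repGen D e f lam ε)) H.rel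

theorem IsRep.rep_gen (H : IsRep D e f lam ε) (g : Gen I Y) :
    H.rep (uMk D (gen g)) = repGen D e f lam ε g :=
  (uLift_uMk D _ _ _).trans (FreeAlgebra.lift_ι_apply _ _)

theorem IsRep.rep_plus (H : IsRep D e f lam ε) (x : FreeF I) :
    H.rep (plus D (fmk C x)) = FreeAlgebra.lift Rπ e x :=
  (uLift_uMk D _ _ _).trans (lift_substE x)

theorem IsRep.rep_minus (H : IsRep D e f lam ε) (x : FreeF I) :
    H.rep (minus D (fmk C x)) = FreeAlgebra.lift Rπ f x :=
  (uLift_uMk D _ _ _).trans (lift_substF x)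

/-- The matrix coefficient `u ↦ (u z, 1)`. -/
def IsRep.coeff (H : IsRep D e f lam ε) (z : fAlg C) : UAlg D →ₗ[Rπ] Rπ :=
  (fForm C).flip 1 ∘ₗ LinearMap.applyₗ z ∘ₗ H.rep.toLinearMap

theorem IsRep.coeff_apply (H : IsRep D e f lam ε) (z : fAlg C) (u : UAlg D) :
    H.coeff z u = fForm C (H.rep u z) 1 := rfl

/-- Only the action on weight `0` matters, by `fForm_dg_one`. There `J̃_i` is trivial and `K̃_i` is
the scalar `q^{λ_i}` with `λ_i = hw D lam i`. -/
theorem IsRep.coeff_uJKt (H : IsRep D e f lam ε) (z : fAlg C) (i : I) (u : UAlg D) :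
    H.coeff z (uJKt D i * u) = ((qq ^ hw D lam i : Rπˣ) : Rπ) * H.coeff z u := by
  have h : H.rep (uJKt D i) = torJ D ε (C.d i • D.coroot i) * torK D lam ε (C.d i • D.coroot i) := by
    rw [uJKt, map_mul]
    exact congrArg₂ (· * ·) (H.rep_gen (.J _)) (H.rep_gen (.K _))
  rw [IsRep.coeff_apply, map_mul, h, torJ, torK, dg_mul_dg, Module.End.mul_apply, fForm_dg_one,
    wtp_zero, mul_zero, zpow_zero, add_zero, Units.val_one, one_mul, IsRep.coeff_apply, hw]

theorem IsRep.coeff_uKtn (H : IsRep D e f lam ε) (z : fAlg C) (i : I) (u : UAlg D) :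
    H.coeff z (uKtn D i * u) = ((qq ^ (-hw D lam i) : Rπˣ) : Rπ) * H.coeff z u := by
  have h : H.rep (uKtn D i) = torK D lam ε (-(C.d i • D.coroot i)) := H.rep_gen (.K _)
  rw [IsRep.coeff_apply, map_mul, h, torK, Module.End.mul_apply, fForm_dg_one,
    wtp_zero, mul_zero, add_zero, map_neg, IsRep.coeff_apply, hw]

end

/-- `J̃_i` acts trivially on all of `f`, since `i · κ` is even. What remains is the difference of
the two actions of `K̃_{±i}`. -/
theorem dg_EF [C.Consistent] (lam : Y →ₗ[ℤ] ℤ) (ε : ℤ) (i : I) {κ : I →₀ ℕ} {x : fAlg C}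
    (hx : x ∈ fAlgWt C κ) :
    (torJ D ε (C.d i • D.coroot i) * torK D lam ε (C.d i • D.coroot i) -
      torK D lam ε (-(C.d i • D.coroot i))) x =
    (((qq ^ (hw D lam i + ε * C.dotw (Finsupp.single i 1) κ) : Rπˣ) : Rπ) -
      ((qq ^ (-(hw D lam i + ε * C.dotw (Finsupp.single i 1) κ)) : Rπˣ) : Rπ)) • x := by
  rw [torJ, torK, torK, dg_mul_dg, LinearMap.sub_apply, dg_of_mem C _ hx, dg_of_mem C _ hx,
    wtp_neg_left, wtp_coroot, piU_zpow_even ((even_dotw_single i κ).mul_left ε), Units.val_one,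
    one_mul, ← sub_smul, map_neg, mul_neg, neg_add, hw]

theorem Lowers.torK_mul {i : I} {g : Module.End Rπ (fAlg C)} (hg : Lowers C i g)
    (lam : Y →ₗ[ℤ] ℤ) (ε : ℤ) (μ : Y) : torK D lam ε μ * g =
      ((qq ^ (-ε * D.pairing μ (D.root i)) : Rπˣ) : Rπ) • (g * torK D lam ε μ) :=
  hg.dg_mul C fun κ => by
    rw [← Units.val_mul, ← zpow_add, wtp_add, wtp_single]
    congr 2
    ring

theorem Lowers.torJ_mul {i : I} {g : Module.End Rπ (fAlg C)} (hg : Lowers C i g)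
    (ε : ℤ) (μ : Y) : torJ D ε μ * g =
      ((piU ^ (-ε * D.pairing μ (D.root i)) : Rπˣ) : Rπ) • (g * torJ D ε μ) :=
  hg.dg_mul C fun κ => by
    rw [← Units.val_mul, ← zpow_add, wtp_add, wtp_single]
    congr 2
    ring

theorem Raises.torK_mul {i : I} {g : Module.End Rπ (fAlg C)} (hg : Raises C i g)
    (lam : Y →ₗ[ℤ] ℤ) (ε : ℤ) (μ : Y) : torK D lam ε μ * g =
      ((qq ^ (ε * D.pairing μ (D.root i)) : Rπˣ) : Rπ) • (g * torK D lam ε μ) :=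
  hg.dg_mul C fun κ => by
    rw [← Units.val_mul, ← zpow_add, wtp_add, wtp_single]
    congr 2
    ring

theorem Raises.torJ_mul {i : I} {g : Module.End Rπ (fAlg C)} (hg : Raises C i g)
    (ε : ℤ) (μ : Y) : torJ D ε μ * g =
      ((piU ^ (ε * D.pairing μ (D.root i)) : Rπˣ) : Rπ) • (g * torJ D ε μ) :=
  hg.dg_mul C fun κ => by
    rw [← Units.val_mul, ← zpow_add, wtp_add, wtp_single]
    congr 2
    ring

variable (C) in
/-- The scalar by which `F_i` differs from the adjoint of right multiplication by `θ_i` on the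
lowest weight module. -/
def lowC (i : I) : Rπ := -(((C.qi i)⁻¹ : Rπˣ) : Rπ)

variable (C) in
/-- The scalar by which `E_i` differs from the adjoint of right multiplication by `θ_i` on the
highest weight module. -/
def highC (l : I → ℤ) (i : I) : Rπ :=
  -(C.pii i * (((C.qi i)⁻¹ : Rπˣ) : Rπ) * ((qq ^ (-l i) : Rπˣ) : Rπ))

theorem isUnit_lowC (i : I) : IsUnit (lowC C i) := (Units.isUnit _).neg

theorem isUnit_highC (l : I → ℤ) (i : I) : IsUnit (highC C l i) :=
  (((piU.isUnit.pow (C.p i)).mul (Units.isUnit _)).mul (Units.isUnit _)).neg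

/-- The constants `lowC` and `highC` are found by solving for this product and the next: they are
the multiples of `rrA C i` for which `rrA_Wop` becomes the relation between `E_i` and `F_i`. -/
theorem lowC_mul_cc (i : I) : lowC C i * C.cc i = -(C.pii i * C.invDen i) := by
  have hq : ((C.qi i : Rπˣ) : Rπ) * (((C.qi i)⁻¹ : Rπˣ) : Rπ) = 1 := Units.mul_inv _
  rw [lowC, cc_eq]
  linear_combination (-(C.pii i * C.invDen i)) * hq

theorem highC_mul_cc (l : I → ℤ) (i : I) :
    highC C l i * C.cc i = -(C.invDen i * ((qq ^ (-l i) : Rπˣ) : Rπ)) := by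
  have hp : C.pii i * C.pii i = 1 := ppi_pow_mul_self _
  have hq : ((C.qi i : Rπˣ) : Rπ) * (((C.qi i)⁻¹ : Rπˣ) : Rπ) = 1 := Units.mul_inv _
  rw [highC, cc_eq]
  linear_combination (-(C.invDen i * ((qq ^ (-l i) : Rπˣ) : Rπ))) *
    (((C.qi i : Rπˣ) : Rπ) * (((C.qi i)⁻¹ : Rπˣ) : Rπ) * hp + hq)

/-- The sign `ε = 1` makes the `E_i` raise and the `F_i` lower the grading, so `1` is a lowest
weight vector, of weight `0`. As in the dual of a Verma module, the `F_i` act by adjoints of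
multiplications. The case `i = j` of the mixed relation is `rrA_Wop` with `l = 0`, multiplied by the
constant of `lowC_mul_cc`. -/
theorem isRep_low [C.Consistent] [Fintype I] :
    IsRep D (Wop C 0) (fun i => lowC C i • Aop C i) 0 1 where
  K_E μ i := by simpa using (raises_Wop C 0 i).torK_mul D 0 1 μ
  J_E μ i := by simpa using (raises_Wop C 0 i).torJ_mul D 1 μ
  K_F μ i := by simpa using ((lowers_Aop C i).smul C (lowC C i)).torK_mul D 0 1 μ
  J_F μ i := by simpa using ((lowers_Aop C i).smul C (lowC C i)).torJ_mul D 1 μ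
  E_F i j := by
    refine fAlg_hom_ext C fun κ x hx => ?_
    have h := rrA_Wop C 0 j i hx
    have hs : ppi ^ (C.p i * C.p j) * ppi ^ (C.p i * C.p j) = 1 := ppi_pow_mul_self _
    have hc := lowC_mul_cc (C := C) j
    simp only [LinearMap.sub_apply, LinearMap.smul_apply, Module.End.mul_apply, Aop, h, map_smul]
    by_cases hij : i = j
    · subst hij
      have hpp : ppi ^ (C.p i * C.p i) = C.pii i := by
        have := C.p_le_one i
        rw [SuperCartanDatum.pii]
        interval_cases C.p i <;> rfl
      have hp : C.pii i * C.pii i = 1 := ppi_pow_mul_self _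
      rw [if_pos rfl, if_pos rfl, hpp, LinearMap.smul_apply, dg_EF D _ _ _ hx, one_mul,
        show hw D 0 i = 0 from rfl, zero_add, one_mul, Pi.zero_apply, mul_zero, zero_sub]
      linear_combination (norm := module) (-(lowC C i * C.cc i) * hp) • Wop C 0 i (rrA C i x) +
        ((C.invDen i * hp - C.pii i * hc) *
          (((qq ^ C.dotw (Finsupp.single i 1) κ : Rπˣ) : Rπ) -
          ((qq ^ (-C.dotw (Finsupp.single i 1) κ) : Rπˣ) : Rπ))) • x
    · rw [if_neg hij, if_neg (Ne.symm hij), zero_mul, zero_smul, add_zero, LinearMap.zero_apply,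
        mul_comm (C.p j)]
      linear_combination (norm := module) (-(lowC C j * C.cc j) * hs) • Wop C 0 i (rrA C j x)
  rad_E x hx := lift_Wop_rad C 0 x hx
  rad_F x hx := lift_smul_rad C _ _ (fun x hx => lift_Aop_rad C hx) x hx

/-- Here `ε = -1` and the roles of `E_i` and `F_i` are exchanged. The highest weight `λ` is an
arbitrary homomorphism `Y → ℤ`, and the uniqueness proof uses this freedom by comparing two choices.
-/
theorem isRep_high [C.Consistent] [Fintype I] (lam : Y →ₗ[ℤ] ℤ) :
    IsRep D (fun i => highC C (hw D lam) i • Aop C i)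
      (Wop C (hw D lam)) lam (-1) where
  K_F μ i := by simpa using (raises_Wop C (hw D lam) i).torK_mul D lam (-1) μ
  J_F μ i := by simpa using (raises_Wop C (hw D lam) i).torJ_mul D (-1) μ
  K_E μ i := by
    simpa using ((lowers_Aop C i).smul C (highC C (hw D lam) i)).torK_mul
      D lam (-1) μ
  J_E μ i := by
    simpa using ((lowers_Aop C i).smul C (highC C (hw D lam) i)).torJ_mul
      D (-1) μ
  E_F i j := by
    refine fAlg_hom_ext C fun κ x hx => ?_
    have h := rrA_Wop C (hw D lam) i j hx
    have hc := highC_mul_cc (C := C) (hw D lam) i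
    simp only [LinearMap.sub_apply, LinearMap.smul_apply, Module.End.mul_apply, Aop, h, map_smul]
    by_cases hij : i = j
    · subst hij
      -- The factor `q^{-λ_i}` built into `highC` makes the difference `q^{i·κ} - q^{2 λ_i - i·κ}`
      -- of `rrA_Wop` symmetric, with exponents `±(λ_i - i·κ)`.
      have e1 : ((qq ^ (hw D lam i + -1 * C.dotw (Finsupp.single i 1) κ) : Rπˣ) : Rπ) =
          ((qq ^ (-hw D lam i) : Rπˣ) : Rπ) *
            ((qq ^ (2 * hw D lam i - C.dotw (Finsupp.single i 1) κ) : Rπˣ) : Rπ) := by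
        rw [← Units.val_mul, ← zpow_add]
        congr 2
        ring
      have e2 : ((qq ^ (-(hw D lam i + -1 * C.dotw (Finsupp.single i 1) κ)) : Rπˣ) :
          Rπ) = ((qq ^ (-hw D lam i) : Rπˣ) : Rπ) *
            ((qq ^ C.dotw (Finsupp.single i 1) κ : Rπˣ) : Rπ) := by
        rw [← Units.val_mul, ← zpow_add]
        congr 2
        ring
      rw [if_pos rfl, if_pos rfl, LinearMap.smul_apply, dg_EF D _ _ _ hx, one_mul, e1, e2]
      linear_combination (norm := module)
        (hc * (((qq ^ C.dotw (Finsupp.single i 1) κ : Rπˣ) : Rπ) -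
          ((qq ^ (2 * hw D lam i - C.dotw (Finsupp.single i 1) κ) : Rπˣ) : Rπ))) • x
    · rw [if_neg hij, if_neg hij, zero_mul, zero_smul, add_zero, LinearMap.zero_apply]
      module
  rad_F x hx := lift_Wop_rad C _ x hx
  rad_E x hx := lift_smul_rad C _ _ (fun x hx => lift_Aop_rad C hx) x hx

-- By `fForm_lift_Aop`, pairing `x⁻ z` with `1` amounts to pairing `z` with `x`, up to the unit
-- collected from the scalars `lowC`. As `z` varies, these coefficients detect `x`, and they do so
-- through `x⁻` alone.
variable {D} in
theorem coeff_low [C.Consistent] [Fintype I] {ν : I →₀ ℕ} {x : fAlg C} (hx : x ∈ fAlgWt C ν)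
    (z : fAlg C) : (isRep_low D).coeff z (minus D x) = powW (lowC C) ν * fForm C z x := by
  obtain ⟨x, hx, rfl⟩ := hx
  rw [IsRep.coeff_apply]
  change fForm C ((isRep_low D).rep (minus D (fmk C x)) z) 1 = _
  rw [IsRep.rep_minus, lift_smul _ _ hx, LinearMap.smul_apply, map_smul, LinearMap.smul_apply,
    fForm_lift_Aop, one_mul, smul_eq_mul]
  rfl

variable {D} in
theorem coeff_high [C.Consistent] [Fintype I] (lam : Y →ₗ[ℤ] ℤ) {ν : I →₀ ℕ} {x : fAlg C}
    (hx : x ∈ fAlgWt C ν) (z : fAlg C) :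
    (isRep_high D lam).coeff z (plus D x) = powW (highC C (hw D lam)) ν * fForm C z x := by
  obtain ⟨x, hx, rfl⟩ := hx
  rw [IsRep.coeff_apply]
  change fForm C ((isRep_high D lam).rep (plus D (fmk C x)) z) 1 = _
  rw [IsRep.rep_plus, lift_smul _ _ hx, LinearMap.smul_apply, map_smul, LinearMap.smul_apply,
    fForm_lift_Aop, one_mul, smul_eq_mul]
  rfl

/-! ### Local nilpotency, and functionals that vanish on some `H_N` -/

theorem Aop_lenLT [C.Consistent] (i : I) {n : ℕ} {z : fAlg C}
    (hz : z ∈ (lenLT I (n + 1)).map (fmk C).toLinearMap) :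
    Aop C i z ∈ (lenLT I n).map (fmk C).toLinearMap := by
  obtain ⟨z, hz, rfl⟩ := hz
  exact Submodule.smul_mem _ _ ⟨_, rr_lenLT C i hz, rfl⟩

theorem word_lenLT {g : I → Module.End Rπ (fAlg C)}
    (hg : ∀ i n, ∀ z ∈ (lenLT I (n + 1)).map (fmk C).toLinearMap,
      g i z ∈ (lenLT I n).map (fmk C).toLinearMap) (l : List I) (n : ℕ) (z : fAlg C)
    (hz : z ∈ (lenLT I (n + l.length)).map (fmk C).toLinearMap) :
    (l.map g).prod z ∈ (lenLT I n).map (fmk C).toLinearMap := by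
  induction l generalizing n with
  | nil => exact hz
  | cons i l ih =>
    rw [List.map_cons, List.prod_cons, Module.End.mul_apply]
    refine hg i n _ (ih (n + 1) ?_)
    rwa [List.length_cons, add_comm l.length, ← add_assoc] at hz

/-- Long words in locally nilpotent operators kill a given element. -/
theorem exists_rep_triL_eq_zero (ρ : UAlg D →ₐ[Rπ] Module.End Rπ (fAlg C)) (x y : I → UAlg D)
    (T : Subalgebra Rπ (UAlg D)) (hy : ∀ i n, ∀ z ∈ (lenLT I (n + 1)).map (fmk C).toLinearMap,
      ρ (y i) z ∈ (lenLT I n).map (fmk C).toLinearMap) (z : fAlg C) :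
    ∃ N, ∀ n ≥ N, ∀ u ∈ triL x y T n, ρ u z = 0 := by
  obtain ⟨z, rfl⟩ := fmk_surjective C z
  obtain ⟨N, hN⟩ := exists_lenLT z
  refine ⟨N, fun n hn u hu => ?_⟩
  induction hu using Submodule.mul_induction_on' with
  | mem_mul_mem a ha w hw =>
    have h0 : ρ w (fmk C z) = 0 := by
      induction hw using Submodule.span_induction with
      | mem w hw =>
        obtain ⟨l, hl, rfl⟩ := hw
        have h1 : (l.map fun i => ρ (y i)).prod (fmk C z) ∈
            (lenLT I 0).map (fmk C).toLinearMap := by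
          have hle : lenLT I N ≤ lenLT I (0 + l.length) :=
            Submodule.span_mono fun w ⟨l', hl', e⟩ => ⟨l', by omega, e⟩
          exact word_lenLT hy l 0 _ ⟨z, hle hN, rfl⟩
        obtain ⟨v, hv, e⟩ := h1
        have h2 : v = 0 := by
          have : {x : FreeF I | ∃ l : List I, l.length < 0 ∧ (l.map fun i => th i).prod = x} = ∅ :=
            Set.eq_empty_of_forall_notMem fun _ ⟨l, hl, _⟩ => Nat.not_lt_zero _ hl
          rw [SetLike.mem_coe, lenLT, this, Submodule.span_empty] at hv
          exact hv
        rw [map_list_prod, List.map_map]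
        exact e.symm.trans (by rw [h2, map_zero])
      | zero => rw [map_zero, LinearMap.zero_apply]
      | add a b _ _ ha hb => rw [map_add, LinearMap.add_apply, ha, hb, add_zero]
      | smul r a _ ha => rw [map_smul, LinearMap.smul_apply, ha, smul_zero]
    rw [map_mul, Module.End.mul_apply, h0, map_zero]
  | add a _ b _ ha hb => rw [map_add, LinearMap.add_apply, ha, hb, add_zero]

theorem exists_coeff_low_eq_zero [C.Consistent] [Fintype I] (z : fAlg C) :
    ∃ N, ∀ n ≥ N, ∀ u ∈ uPM D n, (isRep_low D).coeff z u = 0 := by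
  obtain ⟨N, hN⟩ := exists_rep_triL_eq_zero D (isRep_low D).rep (uE D) (uF D) (uZero D)
    (fun i n z hz => by
      have h : (isRep_low D).rep (uF D i) = lowC C i • Aop C i := (isRep_low D).rep_gen (.F i)
      rw [h]
      exact Submodule.smul_mem _ _ (Aop_lenLT i hz)) z
  refine ⟨N, fun n hn u hu => ?_⟩
  rw [uPM_eq] at hu
  rw [IsRep.coeff_apply, hN n hn u hu, map_zero, LinearMap.zero_apply]

theorem exists_coeff_high_eq_zero [C.Consistent] [Fintype I] (lam : Y →ₗ[ℤ] ℤ) (z : fAlg C) :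
    ∃ N, ∀ n ≥ N, ∀ u ∈ uMP D n, (isRep_high D lam).coeff z u = 0 := by
  obtain ⟨N, hN⟩ := exists_rep_triL_eq_zero D (isRep_high D lam).rep (uF D) (uE D) (uZero D)
    (fun i n z hz => by
      have h : (isRep_high D lam).rep (uE D i) = highC C (hw D lam) i • Aop C i :=
        (isRep_high D lam).rep_gen (.E i)
      rw [h]
      exact Submodule.smul_mem _ _ (Aop_lenLT i hz)) z
  refine ⟨N, fun n hn u hu => ?_⟩
  rw [uMP_eq] at hu
  rw [IsRep.coeff_apply, hN n hn u hu, map_zero, LinearMap.zero_apply]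

/-- The functional `a ⊗ b ↦ φ(a) ψ(b)` on `U ⊗ U`. -/
def pairF (φ ψ : UAlg D →ₗ[Rπ] Rπ) : UU D →ₗ[Rπ] Rπ :=
  (LinearMap.mul' Rπ Rπ ∘ₗ TensorProduct.map φ ψ : UAlg D ⊗[Rπ] UAlg D →ₗ[Rπ] Rπ)

theorem pairF_tU (φ ψ : UAlg D →ₗ[Rπ] Rπ) (a b : UAlg D) : pairF D φ ψ (tU D a b) = φ a * ψ b := rfl

/-- Long words in the `F_i` kill a given vector of the lowest weight module, and long words in the
`E_i` kill a given vector of the highest weight module. This matches the two summands of `H_N` and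
explains the choice of module for each factor. The functional can then be evaluated on relations in
the completion. -/
theorem exists_pairF_eq_zero [C.Consistent] [Fintype I] (lam : Y →ₗ[ℤ] ℤ) (z z' : fAlg C) :
    ∃ N, ∀ u ∈ HN D N, pairF D ((isRep_low D).coeff z) ((isRep_high D lam).coeff z') u = 0 := by
  obtain ⟨N, hN⟩ := exists_coeff_low_eq_zero D z
  obtain ⟨N', hN'⟩ := exists_coeff_high_eq_zero D lam z'
  refine ⟨max N N', fun u hu => HN_induction D
    (P := fun u => pairF D ((isRep_low D).coeff z) ((isRep_high D lam).coeff z') u = 0)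
    (map_zero _) (fun x y hx hy => by rw [map_add, hx, hy, add_zero])
    (fun r x hx => by rw [map_smul, hx, smul_zero]) (fun a ha b => ?_) (fun a b hb => ?_) hu⟩
  · rw [pairF_tU, hN _ (le_max_left _ _) a ha, zero_mul]
  · rw [pairF_tU, hN' _ (le_max_right _ _) b hb, mul_zero]

end

/-! ## Uniqueness of the quasi-R-matrix -/

section

variable {I : Type*} [DecidableEq I] [Fintype I] {C : SuperCartanDatum I} [C.Consistent]
  {Y X : Type*} [AddCommGroup Y] [AddCommGroup X] {D : RootDatum C Y X}

theorem coeff_low_eq_zero {μ ν : I →₀ ℕ} (h : μ ≠ ν) {x z : fAlg C} (hx : x ∈ fAlgWt C μ)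
    (hz : z ∈ fAlgWt C ν) : (isRep_low D).coeff z (minus D x) = 0 := by
  rw [coeff_low hx, fForm_eq_zero_of_ne C h.symm hz hx, mul_zero]

/-- All first factors lie in the torus times `U⁻_{μ+i}`, or in `U⁻_{μ+i}` itself, while the
coefficient at `z` only sees `U⁻_ν`. -/
theorem pairF_mulF_eq_zero (i : I) {μ ν : I →₀ ℕ} (h : μ + Finsupp.single i 1 ≠ ν) {z : fAlg C}
    (hz : z ∈ fAlgWt C ν) (ψ : UAlg D →ₗ[Rπ] Rπ) {x y : fAlg C} (hx : x ∈ fAlgWt C μ)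
    (hy : y ∈ fAlgWt C μ) :
    pairF D ((isRep_low D).coeff z) ψ (tU D (uF D i) (uKtn D i) * mp D (x ⊗ₜ y) -
      mp D (x ⊗ₜ y) * tU D (uF D i) (uJKt D i)) = 0 := by
  rw [mulF_mp D i hy, mp_tmul, mp_tmul, tU_mul_left D (uKtn_mem D i), tU_mul_left D (uJKt_mem D i),
    one_mul, one_mul, map_sub, map_smul, pairF_tU, pairF_tU,
    coeff_low_eq_zero h (thA_mul_mem C i hx) hz, coeff_low_eq_zero h (mul_thA_mem C i hx) hz,
    zero_mul, zero_mul, smul_zero, sub_zero]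

theorem pairF_commF_eq_zero (i : I) {μ ν : I →₀ ℕ} (h : μ ≠ ν) {z : fAlg C} (hz : z ∈ fAlgWt C ν)
    (ψ : UAlg D →ₗ[Rπ] Rπ) {x y : fAlg C} (hx : x ∈ fAlgWt C μ) (hy : y ∈ fAlgWt C μ) :
    pairF D ((isRep_low D).coeff z) ψ (tU D 1 (uF D i) * mp D (x ⊗ₜ y) -
      mp D (x ⊗ₜ y) * tU D 1 (uF D i)) = 0 := by
  rw [commF_mp D i hx hy, map_smul, map_sub, pairF_tU, pairF_tU, coeff_low_eq_zero h hx hz,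
    zero_mul, zero_mul, sub_zero, smul_zero]

/-- The torus elements of `commF_mp_add` become the scalars `q^{±λ_i}`. Apart from an overall unit,
this is the only way in which `λ` enters. -/
theorem pairF_commF (i : I) (ν : I →₀ ℕ) (lam : Y →ₗ[ℤ] ℤ) (z z' : fAlg C) {x y : fAlg C}
    (hx : x ∈ fAlgWt C (ν + Finsupp.single i 1)) (hy : y ∈ fAlgWt C (ν + Finsupp.single i 1)) :
    pairF D ((isRep_low D).coeff z) ((isRep_high D lam).coeff z')
      (tU D 1 (uF D i) * mp D (x ⊗ₜ y) - mp D (x ⊗ₜ y) * tU D 1 (uF D i)) =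
    (-C.invDen i * ppi ^ (C.p i * C.pw ν) * powW (lowC C) (ν + Finsupp.single i 1) *
      powW (highC C (hw D lam)) ν) * (fForm C z x *
        (((qq ^ hw D lam i : Rπˣ) : Rπ) * fForm C z' (irbA C i y) -
          ((qq ^ (-hw D lam i) : Rπˣ) : Rπ) * fForm C z' (irA C i y))) := by
  rw [commF_mp_add D i hx hy, mp_tmul, mp_tmul, tU_mul_left D (uKtn_mem D i),
    tU_mul_left D (uJKt_mem D i), one_mul, map_smul, map_sub, pairF_tU, pairF_tU, coeff_low hx,
    IsRep.coeff_uJKt, IsRep.coeff_uKtn, coeff_high lam (irbA_mem C i hy),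
    coeff_high lam (irA_mem C i hy), smul_eq_mul]
  ring

/-- An element of `U⁻_ν ⊗ U⁺_ν` written in terms of a dual family. -/
theorem exists_eq_sum_mp {ν : I →₀ ℕ} {κ : Type*} [Fintype κ] {m n : κ → fAlg C}
    (h : IsDualFamily C ν m n) {w : UU D} (hw : w ∈ uMinusPlus D ν) :
    ∃ y : κ → fAlg C, (∀ k, y k ∈ fAlgWt C ν) ∧ w = ∑ k, mp D (m k ⊗ₜ y k) := by
  induction hw using Submodule.span_induction with
  | mem w hw =>
    obtain ⟨_, ⟨x, hx, rfl⟩, _, ⟨y, hy, rfl⟩, rfl⟩ := hw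
    refine ⟨fun k => fForm C (n k) x • y, fun k => Submodule.smul_mem _ _ hy, ?_⟩
    change mp D (x ⊗ₜ y) = _
    conv_lhs => rw [← h.sum_left x hx, TensorProduct.sum_tmul, map_sum]
    simp only [TensorProduct.smul_tmul]
  | zero => exact ⟨0, fun _ => zero_mem _, by simp⟩
  | add a b _ _ ha hb =>
    obtain ⟨y, hy, rfl⟩ := ha
    obtain ⟨y', hy', rfl⟩ := hb
    refine ⟨y + y', fun k => add_mem (hy k) (hy' k), ?_⟩
    simp only [Pi.add_apply, TensorProduct.tmul_add, map_add, Finset.sum_add_distrib]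
  | smul r a _ ha =>
    obtain ⟨y, hy, rfl⟩ := ha
    refine ⟨r • y, fun k => Submodule.smul_mem _ _ (hy k), ?_⟩
    simp only [Pi.smul_apply, TensorProduct.tmul_smul, map_smul, Finset.smul_sum]

/-- A functional which vanishes on the images of homogeneous tensors vanishes on
`U⁻_μ ⊗ U⁺_μ`. -/
theorem eq_zero_on_uMinusPlus {M : Type*} [AddCommMonoid M] [Module Rπ M] {μ : I →₀ ℕ}
    (g : UU D →ₗ[Rπ] M) (hg : ∀ x ∈ fAlgWt C μ, ∀ y ∈ fAlgWt C μ, g (mp D (x ⊗ₜ y)) = 0) {w : UU D}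
    (hw : w ∈ uMinusPlus D μ) : g w = 0 := by
  obtain ⟨k, m, n, h⟩ := exists_isDualFamily C μ
  obtain ⟨y, hy, rfl⟩ := exists_eq_sum_mp h hw
  rw [map_sum]
  exact Finset.sum_eq_zero fun j _ => hg _ (h.left_mem j) _ (hy j)

theorem pairF_delta_uF (i : I) {μ ν : I →₀ ℕ} (h : μ + Finsupp.single i 1 ≠ ν) {z : fAlg C}
    (hz : z ∈ fAlgWt C ν) (ψ : UAlg D →ₗ[Rπ] Rπ) {w : UU D} (hw : w ∈ uMinusPlus D μ) :
    pairF D ((isRep_low D).coeff z) ψ (delta D (uF D i) * w - w * deltaBar D (uF D i)) =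
      pairF D ((isRep_low D).coeff z) ψ (tU D 1 (uF D i) * w - w * tU D 1 (uF D i)) := by
  have h1 : pairF D ((isRep_low D).coeff z) ψ
      (tU D (uF D i) (uKtn D i) * w - w * tU D (uF D i) (uJKt D i)) = 0 :=
    eq_zero_on_uMinusPlus (pairF D ((isRep_low D).coeff z) ψ ∘ₗ
      (LinearMap.mulLeft Rπ (tU D (uF D i) (uKtn D i)) -
        LinearMap.mulRight Rπ (tU D (uF D i) (uJKt D i))))
      (fun _ hx _ hy => pairF_mulF_eq_zero i h hz ψ hx hy) hw
  rw [delta_uF, deltaBar_uF, add_mul, mul_add, add_sub_add_comm, map_add, h1, zero_add]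

theorem pairF_commF_eq_zero' (i : I) {μ ν : I →₀ ℕ} (h : μ ≠ ν) {z : fAlg C}
    (hz : z ∈ fAlgWt C ν) (ψ : UAlg D →ₗ[Rπ] Rπ) {w : UU D} (hw : w ∈ uMinusPlus D μ) :
    pairF D ((isRep_low D).coeff z) ψ (tU D 1 (uF D i) * w - w * tU D 1 (uF D i)) = 0 :=
  eq_zero_on_uMinusPlus (pairF D ((isRep_low D).coeff z) ψ ∘ₗ
    (LinearMap.mulLeft Rπ (tU D 1 (uF D i)) - LinearMap.mulRight Rπ (tU D 1 (uF D i))))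
    (fun _ hx _ hy => pairF_commF_eq_zero i h hz ψ hx hy) hw

variable {f : (I →₀ ℕ) → UU D} {T : UUhat D}

/-- The lowest nonzero component of an intertwiner commutes with `1 ⊗ F_i`, as seen by matrix
coefficients. -/
theorem pairF_commF_of_intertwines (hf : ∀ ν, f ν ∈ uMinusPlus D ν)
    (hT : HasSum (fun ν => (f ν : UUhat D)) T)
    (h : ∀ u : UAlg D, (delta D u : UUhat D) * T = T * (deltaBar D u : UUhat D)) {ν : I →₀ ℕ}
    (hν : ∀ μ, SuperCartanDatum.ht μ < SuperCartanDatum.ht ν → f μ = 0) (i : I)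
    (lam : Y →ₗ[ℤ] ℤ) {z : fAlg C} (hz : z ∈ fAlgWt C ν) (z' : fAlg C) :
    pairF D ((isRep_low D).coeff z) ((isRep_high D lam).coeff z')
      (tU D 1 (uF D i) * f ν - f ν * tU D 1 (uF D i)) = 0 := by
  obtain ⟨N, hN⟩ := exists_pairF_eq_zero D lam z z'
  -- The set `s` is so large that it contains `ν` and that the partial sum of the relation for `F_i`
  -- lies in the `H_N` killed by the functional.
  obtain ⟨s, hs, hνs⟩ := ((eventually_sum_mem_HN D hT _ _ (h (uF D i)) N).and
    (Filter.eventually_ge_atTop {ν})).exists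
  have h1 := hN _ hs
  rw [map_sum, Finset.sum_eq_single_of_mem ν (hνs (Finset.mem_singleton_self ν)),
    pairF_delta_uF i (by simp) hz _ (hf ν)] at h1
  · exact h1
  intro μ _ hμ
  -- The terms with `F_i ⊗ K̃_{-i}` and `F_i ⊗ J̃_i K̃_i` reach the weight `ν` only from `μ = ν -
  -- i`, where `f` vanishes by minimality. Every other `μ ≠ ν` is invisible to the coefficient at
  -- `z`.
  by_cases hμν : μ + Finsupp.single i 1 = ν
  · rw [hν μ (by rw [← hμν, ht_add_single]; exact Nat.lt_succ_self _), mul_zero, zero_mul, sub_zero,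
      map_zero]
  · rw [pairF_delta_uF i hμν hz _ (hf μ), pairF_commF_eq_zero' i hμ hz _ (hf μ)]

theorem hw_root (i : I) : hw D (D.pairing.flip (D.root i)) i = C.dot i i := by
  rw [hw, LinearMap.flip_apply, D.d_mul_pairing]

/-- Induction on the height. The relation for `F_i` alone, tested against all matrix coefficients,
shows that each contraction of `f ν` in the first factor is killed by all `irA C i`. A vector of
nonzero weight with this property is zero. -/
theorem eq_zero_of_intertwines (hf : ∀ ν, f ν ∈ uMinusPlus D ν) (h0 : f 0 = 0)
    (hT : HasSum (fun ν => (f ν : UUhat D)) T)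
    (h : ∀ u : UAlg D, (delta D u : UUhat D) * T = T * (deltaBar D u : UUhat D)) (ν : I →₀ ℕ) :
    f ν = 0 := by
  induction hn : SuperCartanDatum.ht ν using Nat.strong_induction_on generalizing ν with
  | _ n ih =>
  by_cases hν0 : ν = 0
  · rw [hν0, h0]
  have hν : ∀ μ, SuperCartanDatum.ht μ < SuperCartanDatum.ht ν → f μ = 0 := fun μ hμ =>
    ih _ (hn ▸ hμ) μ rfl
  obtain ⟨k, m, n, hmn⟩ := exists_isDualFamily C ν
  obtain ⟨y, hy, e⟩ := exists_eq_sum_mp hmn (hf ν)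
  -- The sum is the contraction of `f ν` with `z` in the first factor, taken in `f`: no information
  -- about the kernel of `f → U⁺` is used.
  have key : ∀ z ∈ fAlgWt C ν, ∑ j, fForm C z (m j) • y j = 0 := by
    intro z hz
    have hY : ∑ j, fForm C z (m j) • y j ∈ fAlgWt C ν :=
      Submodule.sum_mem _ fun j _ => Submodule.smul_mem _ _ (hy j)
    refine eq_zero_of_irA C hν0 hY fun i => ?_
    obtain hi | ⟨ν', rfl⟩ := exists_add_single i ν
    · exact irA_eq_zero C i hi hY
    have h2 : ∀ (lam : Y →ₗ[ℤ] ℤ) (z' : fAlg C),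
        ((qq ^ hw D lam i : Rπˣ) : Rπ) * fForm C z' (irbA C i (∑ j, fForm C z (m j) • y j)) -
          ((qq ^ (-hw D lam i) : Rπˣ) : Rπ) * fForm C z' (irA C i (∑ j, fForm C z (m j) • y j)) =
            0 := by
      intro lam z'
      have h3 := pairF_commF_of_intertwines hf hT h hν i lam hz z'
      rw [e, Finset.mul_sum, Finset.sum_mul, ← Finset.sum_sub_distrib, map_sum,
        Finset.sum_congr rfl fun j _ => pairF_commF i ν' lam z z' (hmn.left_mem j) (hy j),
        ← Finset.mul_sum] at h3
      -- The prefactor depends on `λ` but is always invertible, so it can be dropped before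
      -- different `λ` are compared.
      have hu : IsUnit (-C.invDen i * ppi ^ (C.p i * C.pw ν') *
          powW (lowC C) (ν' + Finsupp.single i 1) * powW (highC C (hw D lam)) ν') :=
        (((C.isUnit_den i).ringInverse.neg.mul (piU.isUnit.pow _)).mul
          (isUnit_powW isUnit_lowC _)).mul (isUnit_powW (isUnit_highC _) _)
      have h4 := hu.mul_right_eq_zero.mp h3
      rw [← h4]
      simp only [map_sum, map_smul, smul_eq_mul, Finset.mul_sum, mul_sub, ← Finset.sum_sub_distrib]
      exact Finset.sum_congr rfl fun j _ => by ring
    refine fForm_nondeg C fun z' => ?_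
    rw [fForm_symm]
    -- The value `λ = 0` shows that `irbA C i` and `irA C i` give the same pairing with `z'`. The
    -- value `λ = i'`, for which `λ_i = i · i = 2 d_i`, then leaves `(q^{2 d_i} - q^{-2 d_i})` times
    -- that pairing, and this factor is a unit.
    have h5 := h2 0 z'
    have h6 := h2 (D.pairing.flip (D.root i)) z'
    rw [show hw D 0 i = 0 from rfl, neg_zero, zpow_zero, Units.val_one, one_mul, one_mul,
      sub_eq_zero] at h5
    rw [h5, hw_root, ← sub_mul, ← C.two_mul_d] at h6
    refine (IsUnit.mul_right_eq_zero ?_).mp h6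
    have hu := SuperCartanDatum.qq_zpow_sub_isUnit (C.d_pos i)
    rwa [← Units.val_pow_eq_pow_val, ← Units.val_pow_eq_pow_val, inv_pow, pow_two, ← zpow_add,
      ← two_mul, ← zpow_neg] at hu
  have h7 : ∀ j, m j = ∑ l, fForm C (n l) (m j) • m l := fun j =>
    (hmn.sum_left _ (hmn.left_mem j)).symm
  -- The family `m` need not be independent. Expanding each `m j` through the dual family collects
  -- the contractions with the `n l`, which vanish by `key`.
  have h8 : ∑ j, m j ⊗ₜ[Rπ] y j = 0 := by
    calc ∑ j, m j ⊗ₜ[Rπ] y j = ∑ j, ∑ l, m l ⊗ₜ[Rπ] (fForm C (n l) (m j) • y j) := by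
          refine Finset.sum_congr rfl fun j _ => ?_
          conv_lhs => rw [h7 j, TensorProduct.sum_tmul]
          simp only [TensorProduct.smul_tmul]
      _ = ∑ l, m l ⊗ₜ[Rπ] ∑ j, fForm C (n l) (m j) • y j := by
          rw [Finset.sum_comm]
          simp only [TensorProduct.tmul_sum]
      _ = 0 := Finset.sum_eq_zero fun l _ => by
          rw [key _ (hmn.right_mem l), TensorProduct.tmul_zero]
  rw [e, ← map_sum, h8, map_zero]

theorem IsQuasiR.unique {f g : (I →₀ ℕ) → UU D} (hf : IsQuasiR D f) (hg : IsQuasiR D g) :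
    f = g := by
  obtain ⟨T, hT, h⟩ := hf.intertwines
  obtain ⟨T', hT', h'⟩ := hg.intertwines
  funext ν
  refine sub_eq_zero.mp (eq_zero_of_intertwines (f := fun ν => f ν - g ν) (T := T - T')
    (fun ν => sub_mem (hf.mem ν) (hg.mem ν)) ?_ ?_ (fun u => ?_) ν)
  · rw [hf.zero, hg.zero, sub_self]
  · simpa only [coe_sub] using hT.sub hT'
  · rw [mul_sub, sub_mul, h, h']

end

/-! ## Dual bases -/

section

variable {I : Type*} [DecidableEq I] {C : SuperCartanDatum I} {ν : I →₀ ℕ} {S : Set (fAlg C)}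

theorem isDualFamily_of_dual [Fintype S] (hS : Submodule.span Rπ S = fAlgWt C ν) {bs : S → fAlg C}
    (hmem : ∀ b, bs b ∈ fAlgWt C ν) (hself : ∀ b : S, fForm C b (bs b) = 1)
    (hne : ∀ b b' : S, b ≠ b' → fForm C b (bs b') = 0) :
    IsDualFamily C ν (fun b : S => (b : fAlg C)) bs := by
  refine .of_left (fun b => hS ▸ Submodule.subset_span b.2) hmem fun z hz => ?_
  rw [← hS] at hz
  induction hz using Submodule.span_induction with
  | mem z hz =>
    rw [Finset.sum_eq_single_of_mem (⟨z, hz⟩ : S) (Finset.mem_univ _), fForm_symm,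
      hself ⟨z, hz⟩, one_smul]
    intro b _ hb
    rw [fForm_symm, hne ⟨z, hz⟩ b hb.symm, zero_smul]
  | zero => simp only [map_zero, zero_smul, Finset.sum_const_zero]
  | add x y _ _ hx hy => simp only [map_add, add_smul, Finset.sum_add_distrib, hx, hy]
  | smul r x _ hx => simp only [map_smul, smul_eq_mul, mul_smul, ← Finset.smul_sum, hx]

theorem IsDualBasis.mem {bs : S → fAlg C} (h : IsDualBasis C ν S bs) (b : S) :
    bs b ∈ fAlgWt C ν := h.span_range ▸ Submodule.subset_span ⟨b, rfl⟩

theorem IsDualBasis.isDualFamily [Fintype S] (hS : Submodule.span Rπ S = fAlgWt C ν)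
    {bs : S → fAlg C} (h : IsDualBasis C ν S bs) :
    IsDualFamily C ν (fun b : S => (b : fAlg C)) bs :=
  isDualFamily_of_dual hS h.mem h.form_self h.form_ne

theorem IsDualBasis.unique (hS : Submodule.span Rπ S = fAlgWt C ν) {bs bs' : S → fAlg C}
    (h : IsDualBasis C ν S bs) (h' : IsDualBasis C ν S bs') : bs = bs' := by
  funext b
  refine sub_eq_zero.mp (fForm_nondeg_wt C (sub_mem (h.mem b) (h'.mem b)) fun z hz => ?_)
  rw [← hS] at hz
  rw [fForm_symm]
  induction hz using Submodule.span_induction with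
  | mem z hz =>
    rw [map_sub, sub_eq_zero]
    by_cases hb : (⟨z, hz⟩ : S) = b
    · rw [← hb]
      exact (h.form_self ⟨z, hz⟩).trans (h'.form_self ⟨z, hz⟩).symm
    · exact (h.form_ne ⟨z, hz⟩ b hb).trans (h'.form_ne ⟨z, hz⟩ b hb).symm
  | zero => rw [map_zero, LinearMap.zero_apply]
  | add x y _ _ hx hy => rw [map_add, LinearMap.add_apply, hx, hy, add_zero]
  | smul r x _ hx => rw [map_smul, LinearMap.smul_apply, hx, smul_zero]

theorem exists_wt_basis (hli : LinearIndependent Rπ (fun b : S => (b : fAlg C)))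
    (hS : Submodule.span Rπ S = fAlgWt C ν) :
    ∃ β : Module.Basis S Rπ (fAlgWt C ν), ∀ b : S, (β b : fAlg C) = b := by
  have hr : Submodule.span Rπ (Set.range fun b : S => (b : fAlg C)) = fAlgWt C ν := by
    rw [Subtype.range_coe, hS]
  refine ⟨(Module.Basis.span hli).map (LinearEquiv.ofEq _ _ hr), fun b => ?_⟩
  rw [Module.Basis.map_apply, LinearEquiv.coe_ofEq_apply, Module.Basis.span_apply]

/-- A basis of a finitely generated module over a nontrivial commutative ring is finite. -/
theorem finite_of_wt_basis [Finite I]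
    (hli : LinearIndependent Rπ (fun b : S => (b : fAlg C)))
    (hS : Submodule.span Rπ S = fAlgWt C ν) : S.Finite := by
  obtain ⟨β, -⟩ := exists_wt_basis hli hS
  exact Set.finite_coe_iff.mp (Module.Finite.finite_basis β)

theorem exists_isDualBasis [Finite I] (hli : LinearIndependent Rπ (fun b : S => (b : fAlg C)))
    (hS : Submodule.span Rπ S = fAlgWt C ν) : ∃ bs : S → fAlg C, IsDualBasis C ν S bs := by
  obtain ⟨β, hβ⟩ := exists_wt_basis hli hS
  have := (finite_of_wt_basis hli hS).fintype
  -- The dual vectors are those which represent the coordinate functionals of the basis through the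
  -- perfect form.
  choose bs hmem hbs using fun b => exists_fForm_eq C ν (β.coord b)
  have hself : ∀ b : S, fForm C b (bs b) = 1 := fun b => by
    rw [fForm_symm, ← hβ, hbs, Module.Basis.coord_apply, Module.Basis.repr_self,
      Finsupp.single_eq_same]
  have hne : ∀ b b' : S, b ≠ b' → fForm C b (bs b') = 0 := fun b b' h => by
    rw [fForm_symm, ← hβ, hbs, Module.Basis.coord_apply, Module.Basis.repr_self,
      Finsupp.single_eq_of_ne h.symm]
  have hd := isDualFamily_of_dual hS hmem hself hne
  refine ⟨bs, Fintype.linearIndependent_iff.mpr fun g hg b => ?_, le_antisymm ?_ fun z hz => ?_,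
    hself, hne⟩
  · have h := congrArg (fForm C (b : fAlg C)) hg
    rw [map_sum, map_zero, Finset.sum_eq_single_of_mem b (Finset.mem_univ _) fun b' _ hb => by
      rw [map_smul, hne b b' hb.symm, smul_zero], map_smul, hself, smul_eq_mul, mul_one] at h
    exact h
  · rw [Submodule.span_le]
    rintro _ ⟨b, rfl⟩
    exact hmem b
  · rw [← hd.sum_right z hz]
    exact Submodule.sum_mem _ fun b _ => Submodule.smul_mem _ _ (Submodule.subset_span ⟨b, rfl⟩)

end

end QCov

end

/-! ### The theorem -/

theorem mainTheorem1 {I : Type*} [Fintype I] [DecidableEq I]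
    (C : QCov.SuperCartanDatum I) [C.Consistent]
    {Y X : Type*} [AddCommGroup Y] [AddCommGroup X] (D : QCov.RootDatum C Y X) :
    ∃ Θ : (I →₀ ℕ) → QCov.UU D,
      QCov.IsQuasiR D Θ ∧
      (∀ Θ' : (I →₀ ℕ) → QCov.UU D, QCov.IsQuasiR D Θ' → Θ' = Θ) ∧
      ∀ B : Set (QCov.fAlg C),
        LinearIndependent QCov.Rπ (fun b : B => (b : QCov.fAlg C)) →
        Submodule.span QCov.Rπ B = ⊤ →
        (∀ ν, Submodule.span QCov.Rπ (B ∩ QCov.fAlgWt C ν) = QCov.fAlgWt C ν) →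
        ∀ ν : I →₀ ℕ,
          (B ∩ QCov.fAlgWt C ν : Set (QCov.fAlg C)).Finite ∧
          (∃! bs : (B ∩ QCov.fAlgWt C ν : Set (QCov.fAlg C)) → QCov.fAlg C,
            QCov.IsDualBasis C ν (B ∩ QCov.fAlgWt C ν) bs) ∧
          ∀ [Fintype (B ∩ QCov.fAlgWt C ν : Set (QCov.fAlg C))]
            (bs : (B ∩ QCov.fAlgWt C ν : Set (QCov.fAlg C)) → QCov.fAlg C),
            QCov.IsDualBasis C ν (B ∩ QCov.fAlgWt C ν) bs →
            Θ ν = ((-1) ^ QCov.SuperCartanDatum.ht ν * QCov.ppi ^ C.e ν * C.pν ν * C.qν ν) •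
              ∑ b : (B ∩ QCov.fAlgWt C ν : Set (QCov.fAlg C)),
                QCov.tU D (QCov.minus D (b : QCov.fAlg C)) (QCov.plus D (bs b)) := by
  refine ⟨QCov.qR D, QCov.isQuasiR_qR D, fun Θ' h => h.unique (QCov.isQuasiR_qR D),
    fun B hli _ hB ν => ?_⟩
  have hS := hB ν
  have hli' := hli.comp (Set.inclusion (Set.inter_subset_left (t := (QCov.fAlgWt C ν : Set _))))
    (Set.inclusion_injective _)
  refine ⟨QCov.finite_of_wt_basis hli' hS, ?_, fun {_} bs hbs => ?_⟩
  · obtain ⟨bs, hbs⟩ := QCov.exists_isDualBasis hli' hS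
    exact ⟨bs, hbs, fun bs' h => QCov.IsDualBasis.unique hS h hbs⟩
  -- The canonical element may be computed from any dual pair, in particular from `B_ν` and its dual
  -- basis. The scalar `sc` is by definition the one in the statement.
  · rw [QCov.qR, QCov.canon_eq C (hbs.isDualFamily hS), map_sum]
    rfl
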